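/- Let $\Omega=(0,1)^2$, let $k\ge 1$ be an integer, $\sigma\ge k+1$, $\beta_1,\beta_2>0$, $M\in\mathbb R$ and $\delta>0$. Then there is a constant $C$, depending only on $k,\sigma,\beta_1,\beta_2,M,\delta$, such that the following holds. Let $\varepsilon>0$, let $N\ge 4$ be even with $\varepsilon\le N^{-1}$, and let $b_1,b_2,c,f$ be smooth on $\bar\Omega$ with $b_1\ge\beta_1$, $b_2\ge\beta_2$ and $c+\frac12\nabla\cdot\boldsymbol b\ge\gamma$ on $\bar\Omega$ for some constant $\gamma>0$, where $\boldsymbol b=(b_1,b_2)^T$. Let $u$ solve $-\varepsilon\Delta u-\boldsymbol b\cdot\nabla u+cu=f$ in $\Omega$, $u=0$ on $\partial\Omega$, and suppose $u=S+E_1+E_2+E_{12}$ with $S,E_1,E_2,E_{12}\in C^{k+1}(\bar\Omega)$ such that on $\bar\Omega$, for $0\le i+j\le k+1$, $$|\partial_x^i\partial_y^jS|\le M,\quad |\partial_x^i\partial_y^jE_1|\le M\varepsilon^{-i}e^{-\beta_1x/\varepsilon},\quad |\partial_x^i\partial_y^jE_2|\le M\varepsilon^{-j}e^{-\beta_2y/\varepsilon},\quad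 |\partial_x^i\partial_y^jE_{12}|\le M\varepsilon^{-(i+j)}e^{-(\beta_1x+\beta_2y)/\varepsilon}.$$ Let $x_i=\frac{\sigma\varepsilon}{\beta_1}\varphi(i/N)$ for $0\le i\le N/2$, with $\varphi(t)=-\ln(1-2(1-\varepsilon)t)$, and $x_i=1-(1-x_{N/2})\frac{2(N-i)}{N}$ for $N/2<i\le N$; define $y_j$ in the same way with $\beta_2$ in place of $\beta_1$. Assume that $\varepsilon$ is so small that $x_{N/2}\le 1-\delta$ and $y_{N/2}\le 1-\delta$, that is, $\frac{\sigma}{\beta_i}\varepsilon|\ln\varepsilon|\le 1-\delta$ for $i=1,2$. Put $x_i^s=x_i+\frac sk(x_{i+1}-x_i)$ for $0\le i<N$, $0\le s<k$, and $x_N^0=x_N$; similarly $y_j^t$. Let $\theta_{i,j}^{s,t}$ be the continuous hat function, of degree at most $k$ in each variable on every mesh rectangle $[x_l,x_{l+1}]\times[y_m,y_{m+1}]$, that is $1$ at $(x_i^s,y_j^t)$ and $0$ at all other nodes, and let $v^I=\sum v(x_i^s,y_j^t)\theta_{i,j}^{s,t}$ (sum over all nodes) be the Lagrange interpolant. Let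 $\mathcal P_1E_1$, $\mathcal P_2E_2$, $\mathcal P_{12}E_{12}$ be the parts of the sums $E_1^I$, $E_2^I$, $E_{12}^I$ over the nodes with $i=N/2-1$, with $j=N/2-1$, and with $i=j=N/2-1$, respectively; let $\mathcal B_1E_1$ be the part of $\mathcal P_1E_1$ over the nodes on the sides $y=0$ and $y=1$, and $\mathcal B_2E_2$ the part of $\mathcal P_2E_2$ over the nodes on the sides $x=0$ and $x=1$. Define $$\pi_iE_i=E_i^I-\mathcal P_iE_i+\mathcal B_iE_i\ (i=1,2),\qquad \pi_{12}E_{12}=E_{12}^I-\mathcal P_{12}E_{12},\qquad \Pi u=S^I+\pi_1E_1+\pi_2E_2+\pi_{12}E_{12}.$$ Then $$\sum_{i=1,2,12}\|\pi_iE_i-E_i\|\le CN^{-(k+1)},\qquad \|\nabla(S-S^I)\|+\|u-u^I\|_\varepsilon+\|u-\Pi u\|_\varepsilon\le CN^{-k},$$ where $\|\cdot\|$ is the $L^2(\Omega)$ norm and $\|v\|_\varepsilon=(\varepsilon\|\nabla v\|^2+\|v\|^2)^{1/2}$. Moreover, $\pi_1E_1$ vanishes at all nodes $(x_{N/2-1}^s,y)$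 off the sides $y=0,1$, $\pi_2E_2$ vanishes at all nodes $(x,y_{N/2-1}^t)$ off the sides $x=0,1$, $\pi_{12}E_{12}$ vanishes at the nodes $(x_{N/2-1}^s,y_{N/2-1}^t)$ ($0\le s,t<k$), and $\Pi u$ is continuous on $\bar\Omega$, zero on $\partial\Omega$, and a polynomial of degree at most $k$ in each variable on each mesh rectangle. The two bounds and the vanishing at these nodes hold also if $+\mathcal B_i$ is replaced by $-\mathcal B_i$ in the definition of $\pi_1$ and $\pi_2$. -/

import Mathlib

open MeasureTheory Set
open scoped ENNReal ContDiff

noncomputable section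

namespace Bakhvalov

/-- The open unit square `Ω = (0,1)²`. -/
def openSquare : Set (ℝ × ℝ) := Ioo (0 : ℝ) 1 ×ˢ Ioo (0 : ℝ) 1

/-- The closed unit square, the closure of `Ω`. -/
def closedSquare : Set (ℝ × ℝ) := Icc (0 : ℝ) 1 ×ˢ Icc (0 : ℝ) 1

/-- Partial derivative in `x` on the closed square (one-sided on the sides `x = 0`, `x = 1`). -/
def Dx (v : ℝ × ℝ → ℝ) (p : ℝ × ℝ) : ℝ := derivWithin (fun t => v (t, p.2)) (Icc 0 1) p.1

/-- Partial derivative in `y` on the closed square (one-sided on the sides `y = 0`, `y = 1`). -/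
def Dy (v : ℝ × ℝ → ℝ) (p : ℝ × ℝ) : ℝ := derivWithin (fun t => v (p.1, t)) (Icc 0 1) p.2

/-! ### The boundary value problem -/

/-- Standing assumptions on the data: `b₁, b₂, c, f` are smooth on the closed square,
`b₁ ≥ β₁ > 0`, `b₂ ≥ β₂ > 0` and `c + (1/2) div b ≥ γ > 0` there. -/
structure ProblemData (β₁ β₂ γ : ℝ) (b₁ b₂ c f : ℝ × ℝ → ℝ) : Prop where
  smooth_b₁ : ContDiffOn ℝ ∞ b₁ closedSquare
  smooth_b₂ : ContDiffOn ℝ ∞ b₂ closedSquare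
  smooth_c : ContDiffOn ℝ ∞ c closedSquare
  smooth_f : ContDiffOn ℝ ∞ f closedSquare
  pos_β₁ : 0 < β₁
  pos_β₂ : 0 < β₂
  pos_γ : 0 < γ
  le_b₁ : ∀ p ∈ closedSquare, β₁ ≤ b₁ p
  le_b₂ : ∀ p ∈ closedSquare, β₂ ≤ b₂ p
  le_c : ∀ p ∈ closedSquare, γ ≤ c p + 1 / 2 * (Dx b₁ p + Dy b₂ p)

/-- `u` solves `-ε Δu - b · ∇u + c u = f` in `Ω`, `u = 0` on `∂Ω`. -/
structure IsSolution (ε : ℝ) (b₁ b₂ c f u : ℝ × ℝ → ℝ) : Prop where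
  regular : ContDiffOn ℝ 2 u closedSquare
  equation : ∀ p ∈ openSquare,
    -ε * (Dx (Dx u) p + Dy (Dy u) p) - (b₁ p * Dx u p + b₂ p * Dy u p) + c p * u p = f p
  boundary : ∀ p ∈ closedSquare \ openSquare, u p = 0

/-- The decomposition of `u` into a smooth part `S`, exponential layers `E₁`, `E₂` along `x = 0`
and `y = 0` and a corner layer `E₁₂`, with derivative bounds up to order `k + 1` with
constant `M`. -/
structure Decomposition (k : ℕ) (ε β₁ β₂ M : ℝ) (u S E₁ E₂ E₁₂ : ℝ × ℝ → ℝ) : Prop where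
  smooth_S : ContDiffOn ℝ (k + 1 : ℕ) S closedSquare
  smooth_E₁ : ContDiffOn ℝ (k + 1 : ℕ) E₁ closedSquare
  smooth_E₂ : ContDiffOn ℝ (k + 1 : ℕ) E₂ closedSquare
  smooth_E₁₂ : ContDiffOn ℝ (k + 1 : ℕ) E₁₂ closedSquare
  sum_eq : ∀ p ∈ closedSquare, u p = S p + E₁ p + E₂ p + E₁₂ p
  bound_S : ∀ i j : ℕ, i + j ≤ k + 1 → ∀ p ∈ closedSquare, |(Dx^[i] (Dy^[j] S)) p| ≤ M
  bound_E₁ : ∀ i j : ℕ, i + j ≤ k + 1 → ∀ p ∈ closedSquare,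
    |(Dx^[i] (Dy^[j] E₁)) p| ≤ M * (ε ^ i)⁻¹ * Real.exp (-β₁ * p.1 / ε)
  bound_E₂ : ∀ i j : ℕ, i + j ≤ k + 1 → ∀ p ∈ closedSquare,
    |(Dx^[i] (Dy^[j] E₂)) p| ≤ M * (ε ^ j)⁻¹ * Real.exp (-β₂ * p.2 / ε)
  bound_E₁₂ : ∀ i j : ℕ, i + j ≤ k + 1 → ∀ p ∈ closedSquare,
    |(Dx^[i] (Dy^[j] E₁₂)) p| ≤
      M * (ε ^ (i + j))⁻¹ * Real.exp (-(β₁ * p.1 + β₂ * p.2) / ε)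

/-! ### The Bakhvalov-type mesh -/

/-- The mesh generating function `φ(t) = -ln (1 - 2 (1 - ε) t)`. -/
def phi (ε t : ℝ) : ℝ := -Real.log (1 - 2 * (1 - ε) * t)

/-- The points of the Bakhvalov-type mesh in one direction (meant for `i ≤ N`):
`(σ ε / β) φ(i / N)` for `i ≤ N / 2`, and equidistant on `[x_{N/2}, 1]`. -/
def meshPt (σ ε β : ℝ) (N i : ℕ) : ℝ :=
  if i ≤ N / 2 then σ * ε / β * phi ε ((i : ℝ) / N)
  else 1 - (1 - σ * ε / β * phi ε (((N / 2 : ℕ) : ℝ) / N)) * (2 * ((N : ℝ) - i) / N)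

/-- The interpolation node `x_i^s = x_i + (s / k) (x_{i+1} - x_i)`. -/
def node (k : ℕ) (x : ℕ → ℝ) (a : ℕ × ℕ) : ℝ :=
  x a.1 + (a.2 : ℝ) / k * (x (a.1 + 1) - x a.1)

/-- The indices `(i, s)` of the one-dimensional nodes: `i < N`, `s < k`, and `(N, 0)`. -/
def nodeIdx (k N : ℕ) : Finset (ℕ × ℕ) :=
  insert (N, 0) (Finset.range N ×ˢ Finset.range k)

/-- The Lagrange basis polynomial of degree `k` on `[0,1]` that is `1` at `s / k` and `0` at
the other points `r / k`. -/
def lagrangeRef (k s : ℕ) (z : ℝ) : ℝ :=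
  ∏ r ∈ (Finset.range (k + 1)).erase s, ((k : ℝ) * z - r) / ((s : ℝ) - r)

/-- The one-dimensional piecewise degree `k` hat function of the node `x_i^s`, `s < k`: a
Lagrange basis polynomial on `[x_i, x_{i+1}]`, for `s = 0` also on `[x_{i-1}, x_i]`, and zero
elsewhere. -/
def hat (k : ℕ) (x : ℕ → ℝ) (a : ℕ × ℕ) (ξ : ℝ) : ℝ :=
  if x a.1 ≤ ξ ∧ ξ ≤ x (a.1 + 1) then
    lagrangeRef k a.2 ((ξ - x a.1) / (x (a.1 + 1) - x a.1))
  else if a.2 = 0 ∧ 1 ≤ a.1 ∧ x (a.1 - 1) ≤ ξ ∧ ξ ≤ x a.1 then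
    lagrangeRef k k ((ξ - x (a.1 - 1)) / (x a.1 - x (a.1 - 1)))
  else 0

/-- The two-dimensional hat function `θ_{i,j}^{s,t}`, with `a = (i, s)` and `b = (j, t)`. -/
def theta (k : ℕ) (x y : ℕ → ℝ) (a b : ℕ × ℕ) (p : ℝ × ℝ) : ℝ :=
  hat k x a p.1 * hat k y b p.2

/-- The standard Lagrange interpolant `v^I`. -/
def lagrangeInterp (k N : ℕ) (x y : ℕ → ℝ) (v : ℝ × ℝ → ℝ) (p : ℝ × ℝ) : ℝ :=
  ∑ a ∈ nodeIdx k N, ∑ b ∈ nodeIdx k N, v (node k x a, node k y b) * theta k x y a b p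

/-- The finite element space `V^N`: continuous on the closed square, zero on its boundary, and
a polynomial of degree at most `k` in each variable on each mesh rectangle. -/
structure MemVN (k N : ℕ) (x y : ℕ → ℝ) (v : ℝ × ℝ → ℝ) : Prop where
  cont : ContinuousOn v closedSquare
  boundary : ∀ p ∈ closedSquare \ openSquare, v p = 0
  poly : ∀ i < N, ∀ j < N, ∃ q : ℕ → ℕ → ℝ,
    ∀ p ∈ Icc (x i) (x (i + 1)) ×ˢ Icc (y j) (y (j + 1)),
      v p = ∑ r ∈ Finset.range (k + 1), ∑ s ∈ Finset.range (k + 1), q r s * p.1 ^ r * p.2 ^ s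

/-! ### The modified interpolant -/

/-- `P₁ E`: the part of the Lagrange interpolant from the nodes with `i = N/2 - 1`. -/
def P₁ (k N : ℕ) (x y : ℕ → ℝ) (E : ℝ × ℝ → ℝ) (p : ℝ × ℝ) : ℝ :=
  ∑ s ∈ Finset.range k, ∑ b ∈ nodeIdx k N,
    E (node k x (N / 2 - 1, s), node k y b) * theta k x y (N / 2 - 1, s) b p

/-- `P₂ E`: the part of the Lagrange interpolant from the nodes with `j = N/2 - 1`. -/
def P₂ (k N : ℕ) (x y : ℕ → ℝ) (E : ℝ × ℝ → ℝ) (p : ℝ × ℝ) : ℝ :=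
  ∑ t ∈ Finset.range k, ∑ a ∈ nodeIdx k N,
    E (node k x a, node k y (N / 2 - 1, t)) * theta k x y a (N / 2 - 1, t) p

/-- `P₁₂ E`: the part of the Lagrange interpolant from the nodes with `i = j = N/2 - 1`. -/
def P₁₂ (k N : ℕ) (x y : ℕ → ℝ) (E : ℝ × ℝ → ℝ) (p : ℝ × ℝ) : ℝ :=
  ∑ s ∈ Finset.range k, ∑ t ∈ Finset.range k,
    E (node k x (N / 2 - 1, s), node k y (N / 2 - 1, t)) *
      theta k x y (N / 2 - 1, s) (N / 2 - 1, t) p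

/-- `B₁ E`: the part of `P₁ E` from the nodes on the sides `y = 0` and `y = 1`. -/
def B₁ (k N : ℕ) (x y : ℕ → ℝ) (E : ℝ × ℝ → ℝ) (p : ℝ × ℝ) : ℝ :=
  ∑ s ∈ Finset.range k, ∑ j ∈ ({0, N} : Finset ℕ),
    E (node k x (N / 2 - 1, s), node k y (j, 0)) * theta k x y (N / 2 - 1, s) (j, 0) p

/-- `B₂ E`: the part of `P₂ E` from the nodes on the sides `x = 0` and `x = 1`. -/
def B₂ (k N : ℕ) (x y : ℕ → ℝ) (E : ℝ × ℝ → ℝ) (p : ℝ × ℝ) : ℝ :=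
  ∑ i ∈ ({0, N} : Finset ℕ), ∑ t ∈ Finset.range k,
    E (node k x (i, 0), node k y (N / 2 - 1, t)) * theta k x y (i, 0) (N / 2 - 1, t) p

/-- `π₁ E = E^I - P₁ E + κ B₁ E`, where `κ = 1` or `κ = -1` is the sign of the boundary
correction; `κ = 1` restores the boundary values that `P₁` removes. -/
def pi₁ (κ : ℝ) (k N : ℕ) (x y : ℕ → ℝ) (E : ℝ × ℝ → ℝ) (p : ℝ × ℝ) : ℝ :=
  lagrangeInterp k N x y E p - P₁ k N x y E p + κ * B₁ k N x y E p

/-- `π₂ E = E^I - P₂ E + κ B₂ E`, with the same convention for `κ`. -/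
def pi₂ (κ : ℝ) (k N : ℕ) (x y : ℕ → ℝ) (E : ℝ × ℝ → ℝ) (p : ℝ × ℝ) : ℝ :=
  lagrangeInterp k N x y E p - P₂ k N x y E p + κ * B₂ k N x y E p

/-- `π₁₂ E = E^I - P₁₂ E`. -/
def pi₁₂ (k N : ℕ) (x y : ℕ → ℝ) (E : ℝ × ℝ → ℝ) (p : ℝ × ℝ) : ℝ :=
  lagrangeInterp k N x y E p - P₁₂ k N x y E p

/-- The modified interpolant `Π u = S^I + π₁ E₁ + π₂ E₂ + π₁₂ E₁₂`. -/
def bigPi (κ : ℝ) (k N : ℕ) (x y : ℕ → ℝ) (S E₁ E₂ E₁₂ : ℝ × ℝ → ℝ) (p : ℝ × ℝ) : ℝ :=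
  lagrangeInterp k N x y S p + pi₁ κ k N x y E₁ p + pi₂ κ k N x y E₂ p + pi₁₂ k N x y E₁₂ p

/-! ### Norms -/

/-- The `L²(Ω)` norm. -/
def normL2 (v : ℝ × ℝ → ℝ) : ℝ≥0∞ := eLpNorm v 2 (volume.restrict openSquare)

/-- `‖∇v‖`, the `H¹(Ω)` seminorm, for continuous and piecewise `C¹` functions `v`, whose weak
gradient is the pointwise one (defined off the mesh lines, hence almost everywhere). -/
def seminormH1 (v : ℝ × ℝ → ℝ) : ℝ≥0∞ :=
  (normL2 (Dx v) ^ 2 + normL2 (Dy v) ^ 2) ^ (1 / 2 : ℝ)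

/-- The energy norm `‖v‖_ε = (ε |v|₁² + ‖v‖²)^{1/2}`. -/
def normEnergy (ε : ℝ) (v : ℝ × ℝ → ℝ) : ℝ≥0∞ :=
  (ENNReal.ofReal ε * seminormH1 v ^ 2 + normL2 v ^ 2) ^ (1 / 2 : ℝ)

end Bakhvalov

end

open Bakhvalov

namespace Bakhvalov

/-! Put `q ξ = exp (-β ξ / (σ ε))`. Since `σ ≥ k + 1`, the `i`-th derivative of a layer function is
at most `M ε^{-i} q^{k+1}`. On the fine part of the mesh `q` is affine in the index: `q (x l) = 1 -
l d` with `d = 2 (1 - ε) / N` (`exists_meshFacts`). This separates three regimes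
(`exists_weightBound_layer`), with `h` the length of a mesh interval. On every fine interval but the
last, `h q ≤ C ε / N`, so the powers of `h / ε` in the interpolation error are paid for by powers of
`q`. On the last fine interval this may fail, but there `q ≤ d + ε ≤ 3 / N`, so function and
interpolant are both `O(N^{-(k+1)})`. On the coarse part `q ≤ ε ≤ 1 / N`.

Derivatives of errors are measured against the weight `1 + q / ε + 1 / (N h)`, whose last term is
what an inverse estimate produces. Multiplied by `ε`, the integral of its square stays bounded: `q²
/ ε²` integrates to `O(1 / ε)`, and `ε ∑ h / (N h)²` is bounded because `h ≥ c ε / N` on every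
interval (`lintegral_layerDom_le`).

In two dimensions `v - I_x I_y v = (v - I_x v) + I_x (v - I_y v)`, and the derivative bounds are
products of one-dimensional weights, so one-dimensional estimates suffice (`interp_error_dx`). The
second term, differentiated in `x`, has only `k` derivatives left in `y`, which still gives the rate
`N^{-k}`.

The modified interpolant differs from the Lagrange interpolant by finite element functions whose
nodal values live where `q ≤ 3 / N`. These values are `O(N^{-(k+1)})`, and the inverse estimate
costs a factor `N` times the weight (`comb_cellBound`). With the sign `κ = 1`, the values at
boundary nodes are those of `u`, hence zero (`memVN_bigPi`). -/

/-! ### Lagrange interpolation on one interval. -/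

open Polynomial in
/-- The Lagrange basis polynomial whose values are `lagrangeRef k s`. -/
noncomputable def lagrangePoly (k s : ℕ) : ℝ[X] :=
  Lagrange.basis (Finset.range (k + 1)) (fun r : ℕ => (r : ℝ) / k) s

theorem lagrangeRef_eq_eval {k : ℕ} (hk : 1 ≤ k) (s : ℕ) (z : ℝ) :
    lagrangeRef k s z = (lagrangePoly k s).eval z := by
  have hk' : (k : ℝ) ≠ 0 := by positivity
  unfold lagrangeRef lagrangePoly Lagrange.basis
  rw [Polynomial.eval_prod]
  refine Finset.prod_congr rfl fun r hr => ?_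
  have hrs : (s : ℝ) - r ≠ 0 := by
    rw [sub_ne_zero]; exact_mod_cast (Finset.ne_of_mem_erase hr).symm
  have : (s : ℝ) / k - r / k ≠ 0 := by
    rw [← sub_div]; exact div_ne_zero hrs hk'
  simp only [Lagrange.basisDivisor, Polynomial.eval_mul, Polynomial.eval_C, Polynomial.eval_sub,
    Polynomial.eval_X]
  rw [← sub_div, inv_div, div_mul_eq_mul_div, mul_sub, mul_div_cancel₀ _ hk']

theorem injOn_div_nat {k : ℕ} (hk : 1 ≤ k) (s : Set ℕ) :
    Set.InjOn (fun r : ℕ => (r : ℝ) / k) s := by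
  have hk' : (k : ℝ) ≠ 0 := by positivity
  intro a _ b _ h
  have := (div_left_inj' hk').1 h
  exact_mod_cast this

theorem lagrangeRef_node {k : ℕ} (hk : 1 ≤ k) {s r : ℕ} (hs : s ≤ k) (hr : r ≤ k) :
    lagrangeRef k s ((r : ℝ) / k) = if r = s then 1 else 0 := by
  rw [lagrangeRef_eq_eval hk, lagrangePoly]
  split_ifs with h
  · subst h
    exact Lagrange.eval_basis_self (injOn_div_nat hk _) (Finset.mem_range.2 (by omega))
  · exact Lagrange.eval_basis_of_ne (v := fun r : ℕ => (r : ℝ) / k) (s := Finset.range (k + 1))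
      (Ne.symm h) (Finset.mem_range.2 (Nat.lt_succ_of_le hr))

/-- The combination of the Lagrange basis functions of the interval `[a, a + h]` with
coefficients `c`. -/
noncomputable def cellSum (k : ℕ) (a h : ℝ) (c : ℕ → ℝ) (ξ : ℝ) : ℝ :=
  ∑ s ∈ Finset.range (k + 1), c s * (lagrangePoly k s).eval ((ξ - a) / h)

/-- The derivative of `cellSum`. -/
noncomputable def cellSumDeriv (k : ℕ) (a h : ℝ) (c : ℕ → ℝ) (ξ : ℝ) : ℝ :=
  ∑ s ∈ Finset.range (k + 1), c s * ((lagrangePoly k s).derivative.eval ((ξ - a) / h) / h)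

theorem hasDerivAt_cellSum (k : ℕ) (a h : ℝ) (c : ℕ → ℝ) (ξ : ℝ) :
    HasDerivAt (cellSum k a h c) (cellSumDeriv k a h c ξ) ξ := by
  unfold cellSum cellSumDeriv
  refine HasDerivAt.fun_sum fun s _ => ?_
  refine HasDerivAt.const_mul _ ?_
  have h1 : HasDerivAt (fun ξ : ℝ => (ξ - a) / h) (1 / h) ξ :=
    ((hasDerivAt_id ξ).sub_const a).div_const h
  have h2 := ((lagrangePoly k s).hasDerivAt ((ξ - a) / h)).comp ξ h1
  simpa [Function.comp_def, div_eq_mul_inv] using h2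

theorem cellSum_sub (k : ℕ) (a h : ℝ) (c d : ℕ → ℝ) (ξ : ℝ) :
    cellSum k a h (fun s => c s - d s) ξ = cellSum k a h c ξ - cellSum k a h d ξ := by
  simp [cellSum, sub_mul, Finset.sum_sub_distrib]

theorem cellSumDeriv_sub (k : ℕ) (a h : ℝ) (c d : ℕ → ℝ) (ξ : ℝ) :
    cellSumDeriv k a h (fun s => c s - d s) ξ
      = cellSumDeriv k a h c ξ - cellSumDeriv k a h d ξ := by
  simp [cellSumDeriv, sub_mul, Finset.sum_sub_distrib]

/-- Stability and inverse estimate on one interval. -/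
theorem exists_cellSum_bound (k : ℕ) : ∃ Λ : ℝ, 1 ≤ Λ ∧ ∀ (a h K : ℝ) (c : ℕ → ℝ), 0 < h →
    (∀ s ≤ k, |c s| ≤ K) → ∀ ξ ∈ Icc a (a + h),
      |cellSum k a h c ξ| ≤ Λ * K ∧ |cellSumDeriv k a h c ξ| ≤ Λ * K / h := by
  have hb : ∀ p : Polynomial ℝ, ∃ B : ℝ, ∀ z ∈ Icc (0 : ℝ) 1, |p.eval z| ≤ B := fun p =>
    isCompact_Icc.exists_bound_of_continuousOn p.continuous.continuousOn
  choose B hB using hb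
  have hB0 : ∀ p, 0 ≤ B p := fun p => (abs_nonneg _).trans (hB p 0 (by simp))
  set Λ := 1 + ∑ s ∈ Finset.range (k + 1), B (lagrangePoly k s)
    + ∑ s ∈ Finset.range (k + 1), B (lagrangePoly k s).derivative with hΛ
  have n1 : 0 ≤ ∑ s ∈ Finset.range (k + 1), B (lagrangePoly k s) :=
    Finset.sum_nonneg fun _ _ => hB0 _
  have n2 : 0 ≤ ∑ s ∈ Finset.range (k + 1), B (lagrangePoly k s).derivative :=
    Finset.sum_nonneg fun _ _ => hB0 _
  refine ⟨Λ, by linarith, fun a h K c hh hc ξ hξ => ?_⟩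
  have hK : 0 ≤ K := (abs_nonneg _).trans (hc 0 (Nat.zero_le _))
  have hz : (ξ - a) / h ∈ Icc (0 : ℝ) 1 :=
    ⟨div_nonneg (by linarith [hξ.1]) hh.le, (div_le_one hh).2 (by linarith [hξ.2])⟩
  have key : ∀ p : ℕ → Polynomial ℝ,
      ∑ s ∈ Finset.range (k + 1), |c s| * |(p s).eval ((ξ - a) / h)|
        ≤ (∑ s ∈ Finset.range (k + 1), B (p s)) * K := fun p => by
    rw [Finset.sum_mul]
    refine Finset.sum_le_sum fun s hs => ?_
    rw [mul_comm]
    exact mul_le_mul (hB _ _ hz) (hc s (by simp at hs; omega)) (abs_nonneg _) (hB0 _)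
  constructor
  · refine (Finset.abs_sum_le_sum_abs _ _).trans ?_
    simp only [abs_mul]
    refine (key _).trans (mul_le_mul_of_nonneg_right ?_ hK)
    linarith
  · have : cellSumDeriv k a h c ξ = (∑ s ∈ Finset.range (k + 1),
        c s * (lagrangePoly k s).derivative.eval ((ξ - a) / h)) / h := by
      rw [cellSumDeriv, Finset.sum_div]
      exact Finset.sum_congr rfl fun s _ => by ring
    rw [this, abs_div, abs_of_pos hh]
    refine div_le_div_of_nonneg_right ?_ hh.le
    refine (Finset.abs_sum_le_sum_abs _ _).trans ?_
    simp only [abs_mul]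
    refine (key _).trans (mul_le_mul_of_nonneg_right ?_ hK)
    linarith

/-- After the affine change to the reference interval, a polynomial of degree at most `k` is
determined by its values at the `k + 1` distinct points `s / k`. -/
theorem cellSum_polynomial {k : ℕ} (hk : 1 ≤ k) (a : ℝ) {h : ℝ} (hh : h ≠ 0)
    {p : Polynomial ℝ} (hp : p.natDegree ≤ k) (ξ : ℝ) :
    cellSum k a h (fun s => p.eval (a + s / k * h)) ξ = p.eval ξ := by
  set q : Polynomial ℝ := p.comp (Polynomial.C a + Polynomial.C h * Polynomial.X) with hq
  have hdeg : q.degree < (Finset.range (k + 1)).card := by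
    rw [Finset.card_range]
    refine Polynomial.degree_le_natDegree.trans_lt ?_
    have h1 : q.natDegree ≤ k := by
      refine Polynomial.natDegree_comp_le.trans ?_
      have : (Polynomial.C a + Polynomial.C h * Polynomial.X).natDegree ≤ 1 := by
        compute_degree
      nlinarith
    exact_mod_cast Nat.lt_succ_of_le h1
  have h2 := Lagrange.eq_interpolate (injOn_div_nat hk _) hdeg
  have h3 := congrArg (Polynomial.eval ((ξ - a) / h)) h2
  rw [Lagrange.interpolate_apply, Polynomial.eval_finsetSum] at h3
  have h4 : q.eval ((ξ - a) / h) = p.eval ξ := by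
    rw [hq, Polynomial.eval_comp]
    congr 1
    simp only [Polynomial.eval_add, Polynomial.eval_C, Polynomial.eval_mul, Polynomial.eval_X]
    field_simp
    ring
  rw [h4] at h3
  rw [h3, cellSum]
  refine Finset.sum_congr rfl fun s _ => ?_
  rw [Polynomial.eval_mul, Polynomial.eval_C, lagrangePoly]
  congr 1
  rw [hq, Polynomial.eval_comp]
  congr 1
  simp only [Polynomial.eval_add, Polynomial.eval_C, Polynomial.eval_mul, Polynomial.eval_X]
  ring

theorem cellSumDeriv_polynomial {k : ℕ} (hk : 1 ≤ k) (a : ℝ) {h : ℝ} (hh : h ≠ 0)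
    {p : Polynomial ℝ} (hp : p.natDegree ≤ k) (ξ : ℝ) :
    cellSumDeriv k a h (fun s => p.eval (a + s / k * h)) ξ = p.derivative.eval ξ := by
  refine (hasDerivAt_cellSum k a h _ ξ).unique ?_
  have : cellSum k a h (fun s => p.eval (a + s / k * h)) = fun ξ => p.eval ξ :=
    funext (cellSum_polynomial hk a hh hp)
  rw [this]
  exact p.hasDerivAt ξ

theorem exists_primitive_polynomial (p : Polynomial ℝ) (a y : ℝ) :
    ∃ q : Polynomial ℝ, q.derivative = p ∧ q.eval a = y ∧ q.natDegree ≤ p.natDegree + 1 := by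
  set r : Polynomial ℝ := ∑ n ∈ Finset.range (p.natDegree + 1),
    Polynomial.monomial (n + 1) (p.coeff n / (n + 1)) with hr
  refine ⟨r + Polynomial.C (y - r.eval a), ?_, by simp, ?_⟩
  · rw [Polynomial.derivative_add, Polynomial.derivative_C, add_zero, hr,
      Polynomial.derivative_sum]
    conv_rhs => rw [p.as_sum_range]
    refine Finset.sum_congr rfl fun n _ => ?_
    rw [Polynomial.derivative_monomial]
    have : (n : ℝ) + 1 ≠ 0 := by positivity
    congr 1
    push_cast
    field_simp
  · rw [Polynomial.natDegree_add_C]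
    refine Polynomial.natDegree_sum_le_of_forall_le _ _ fun n hn => ?_
    refine (Polynomial.natDegree_monomial_le _).trans ?_
    simp at hn; omega

/-- One step of the Taylor expansion. -/
theorem exists_polynomial_step {a h K : ℝ} {g g' : ℝ → ℝ} {p : Polynomial ℝ}
    (hh : 0 ≤ h)
    (hg : ∀ ξ ∈ Icc a (a + h), HasDerivWithinAt g (g' ξ) (Icc a (a + h)) ξ)
    (hp : ∀ ξ ∈ Icc a (a + h), |g' ξ - p.eval ξ| ≤ K) :
    ∃ q : Polynomial ℝ, q.derivative = p ∧ q.natDegree ≤ p.natDegree + 1 ∧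
      ∀ ξ ∈ Icc a (a + h), |g ξ - q.eval ξ| ≤ h * K := by
  obtain ⟨q, h1, h2, h3⟩ := exists_primitive_polynomial p a (g a)
  refine ⟨q, h1, h3, fun ξ hξ => ?_⟩
  have hd : ∀ ξ ∈ Icc a (a + h), HasDerivWithinAt (fun t => g t - q.eval t)
      (g' ξ - p.eval ξ) (Icc a (a + h)) ξ := fun ξ hξ => by
    have := (hg ξ hξ).sub (q.hasDerivAt ξ).hasDerivWithinAt
    rw [h1] at this
    exact this
  have hK : 0 ≤ K := (abs_nonneg _).trans (hp ξ hξ)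
  have := (convex_Icc a (a + h)).norm_image_sub_le_of_norm_hasDerivWithin_le hd
    (fun ξ hξ => hp ξ hξ) (left_mem_Icc.2 (by linarith)) hξ
  simp only [h2, sub_self, sub_zero, Real.norm_eq_abs] at this
  refine this.trans ?_
  rw [mul_comm]
  refine mul_le_mul_of_nonneg_right ?_ hK
  rw [abs_of_nonneg (by linarith [hξ.1])]; linarith [hξ.2]

/-- `g 0, g 1, …, g m` are successive derivatives on `[a, a + h]`. -/
def IsChain (a h : ℝ) (m : ℕ) (g : ℕ → ℝ → ℝ) : Prop :=
  ∀ i < m, ∀ ξ ∈ Icc a (a + h), HasDerivWithinAt (g i) (g (i + 1) ξ) (Icc a (a + h)) ξ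

theorem IsChain.mono {a h : ℝ} {m n : ℕ} {g : ℕ → ℝ → ℝ} (hg : IsChain a h n g) (hmn : m ≤ n) :
    IsChain a h m g := fun i hi => hg i (hi.trans_le hmn)

/-- Induction on the order: a polynomial close to `g 1` is integrated, with the value of `g 0` at
`a` as constant, and the mean value inequality adds one factor `h`. The same polynomial therefore
approximates the function and its derivative, as the next estimate requires. -/
theorem exists_taylor_polynomial {a h : ℝ} (hh : 0 ≤ h) (m : ℕ) :
    ∀ (K : ℝ) (g : ℕ → ℝ → ℝ), IsChain a h (m + 1) g → (∀ ξ ∈ Icc a (a + h), |g (m + 1) ξ| ≤ K) →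
    ∃ p : Polynomial ℝ, p.natDegree ≤ m ∧ (∀ ξ ∈ Icc a (a + h), |g 0 ξ - p.eval ξ| ≤ h ^ (m + 1) * K)
      ∧ ∀ ξ ∈ Icc a (a + h), |g 1 ξ - p.derivative.eval ξ| ≤ h ^ m * K := by
  induction m with
  | zero =>
    intro K g hg hK
    obtain ⟨q, h1, h2, h3⟩ := exists_polynomial_step (p := 0) hh (hg 0 (by omega))
      (by simpa using hK)
    refine ⟨q, ?_, by simpa using h3, by simpa [h1] using hK⟩
    exact (Polynomial.derivative_eq_zero.1 h1).le
  | succ m ih =>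
    intro K g hg hK
    obtain ⟨p, hp1, hp2, -⟩ := ih K (fun i => g (i + 1)) (fun i hi => hg (i + 1) (by omega)) hK
    obtain ⟨q, h1, h2, h3⟩ := exists_polynomial_step hh (hg 0 (by omega)) hp2
    refine ⟨q, by omega, fun ξ hξ => (h3 ξ hξ).trans (le_of_eq (by ring)), ?_⟩
    rw [h1]; exact hp2

/-- Interpolation error on one interval. -/
theorem exists_cellSum_error {k : ℕ} (hk : 1 ≤ k) : ∃ Λ : ℝ, 1 ≤ Λ ∧
    ∀ (m : ℕ), m ≤ k → ∀ (a h K : ℝ) (g : ℕ → ℝ → ℝ), 0 < h → IsChain a h (m + 1) g →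
    (∀ ξ ∈ Icc a (a + h), |g (m + 1) ξ| ≤ K) → ∀ ξ ∈ Icc a (a + h),
      |g 0 ξ - cellSum k a h (fun s => g 0 (a + s / k * h)) ξ| ≤ Λ * (h ^ (m + 1) * K) ∧
      |g 1 ξ - cellSumDeriv k a h (fun s => g 0 (a + s / k * h)) ξ| ≤ Λ * (h ^ m * K) := by
  obtain ⟨Λ, hΛ, H⟩ := exists_cellSum_bound k
  refine ⟨Λ + 1, by linarith, fun m hm a h K g hh hg hK ξ hξ => ?_⟩
  obtain ⟨p, hp, h0, h1⟩ := exists_taylor_polynomial hh.le m K g hg hK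
  have hkp : (0 : ℝ) < k := by positivity
  have hnode : ∀ s ≤ k, a + (s : ℝ) / k * h ∈ Icc a (a + h) := fun s hs => by
    have : (s : ℝ) / k ≤ 1 := (div_le_one hkp).2 (by exact_mod_cast hs)
    constructor
    · have : 0 ≤ (s : ℝ) / k * h := by positivity
      linarith
    · nlinarith
  -- Interpolation reproduces `p`, so the error for `g 0` is `g 0 - p` minus the interpolant of `g 0
  -- - p`; the stability bound is applied to the nodal values of this difference.
  obtain ⟨b0, b1⟩ := H a h (h ^ (m + 1) * K)
    (fun s => g 0 (a + s / k * h) - p.eval (a + s / k * h)) hh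
    (fun s hs => h0 _ (hnode s hs)) ξ hξ
  rw [cellSum_sub, cellSum_polynomial hk a hh.ne' (hp.trans hm)] at b0
  rw [cellSumDeriv_sub, cellSumDeriv_polynomial hk a hh.ne' (hp.trans hm)] at b1
  have e1 : Λ * (h ^ (m + 1) * K) / h = Λ * (h ^ m * K) := by
    field_simp; ring
  rw [e1] at b1
  have c0 := h0 ξ hξ
  have c1 := h1 ξ hξ
  rw [abs_le] at b0 b1 c0 c1
  constructor <;> rw [abs_le] <;> constructor <;> linarith

/-! ### The Bakhvalov-type mesh. -/

/-- `exp (-β ξ / (σ ε))`: its `σ`-th power is the exponential layer, and it is affine in the index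
at the fine mesh points. -/
noncomputable def layerFun (σ ε β ξ : ℝ) : ℝ := Real.exp (-(β * ξ / (σ * ε)))

/-- The properties of the one-dimensional mesh used in the error analysis. -/
structure MeshFacts (N : ℕ) (x : ℕ → ℝ) (q : ℝ → ℝ) (ε C : ℝ) : Prop where
  zero : x 0 = 0
  last : x N = 1
  lt : ∀ l ≤ N, x l < x (l + 1)
  step_le : ∀ l < N, x (l + 1) - x l ≤ C / N
  le_step : ∀ l < N, ε / N ≤ C * (x (l + 1) - x l)
  layer : ∀ l, l + 2 ≤ N / 2 → (x (l + 1) - x l) * q (x l) ≤ C * (ε / N)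
  layer_ratio : ∀ l, l + 2 ≤ N / 2 → q (x l) ≤ 2 * q (x (l + 1))
  transition : ∀ l, l + 1 = N / 2 → q (x l) ≤ 3 / N
  coarse : ∀ l, N / 2 ≤ l → l ≤ N → q (x l) ≤ ε

/-- With `Q l = 1 - l d`, the fine points are `-(σ ε / β) log (Q l)`, so the layer function there is
`Q l` and a fine step is `(σ ε / β) log (Q l / Q (l + 1))`. The logarithm lies between `d / Q l` and
`d / Q (l + 1)`. The condition involving `δ` keeps the coarse steps from degenerating. -/
theorem exists_meshFacts {σ β δ : ℝ} (hσ : 0 < σ) (hβ : 0 < β) (hδ : 0 < δ) :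
    ∃ C : ℝ, 1 ≤ C ∧ ∀ (ε : ℝ) (N : ℕ), 0 < ε → 4 ≤ N → Even N → ε ≤ (N : ℝ)⁻¹ →
      meshPt σ ε β N (N / 2) ≤ 1 - δ →
      MeshFacts N (meshPt σ ε β N) (layerFun σ ε β) ε C := by
  -- `4 σ / β` serves the upper bounds on fine steps, `β / σ` the lower one; `2` and `1 / δ` serve
  -- the upper and lower bounds on coarse steps.
  refine ⟨4 * (σ / β) + β / σ + 2 + 1 / δ, ?_, ?_⟩
  · have : 0 ≤ 4 * (σ / β) + β / σ + 1 / δ := by positivity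
    linarith
  intro ε N hε hN4 hev hεN hmid
  set C := 4 * (σ / β) + β / σ + 2 + 1 / δ with hC
  have hsb : 0 < σ / β := by positivity
  have hbs : 0 < β / σ := by positivity
  have hdi : 0 < 1 / δ := by positivity
  obtain ⟨n, rfl⟩ := hev
  have hn2 : 2 ≤ n := by omega
  have hhalf : (n + n) / 2 = n := by omega
  rw [hhalf] at hmid
  set N := n + n with hNdef
  have hNn : (N : ℝ) = 2 * n := by rw [hNdef]; push_cast; ring
  have hN4' : (4 : ℝ) ≤ N := by exact_mod_cast hN4
  have hNpos : (0 : ℝ) < N := by linarith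
  have hεN' : ε ≤ 1 / N := by rwa [one_div]
  have hε4 : ε ≤ 1 / 4 := hεN'.trans (one_div_le_one_div_of_le (by norm_num) hN4')
  set d : ℝ := 2 * (1 - ε) / N with hd
  have hdlow : 3 / 2 / N ≤ d := by
    rw [hd]; exact div_le_div_of_nonneg_right (by linarith) hNpos.le
  have hdup : d ≤ 2 / N := by
    rw [hd]; exact div_le_div_of_nonneg_right (by linarith) hNpos.le
  have hd0 : 0 < d := lt_of_lt_of_le (by positivity) hdlow
  have hnd : n * d = 1 - ε := by
    rw [hd, hNn]
    have : (n : ℝ) ≠ 0 := by positivity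
    field_simp
  set Q : ℕ → ℝ := fun l => 1 - l * d with hQ
  have hQn : Q n = ε := by simp only [hQ]; linarith
  have hQle : ∀ l ≤ n, ε ≤ Q l := fun l hl => by
    have : (l : ℝ) ≤ n := by exact_mod_cast hl
    simp only [hQ]; nlinarith
  have hQpos : ∀ l ≤ n, 0 < Q l := fun l hl => hε.trans_le (hQle l hl)
  have hQ1 : ∀ l, Q l ≤ 1 := fun l => by
    have : 0 ≤ (l : ℝ) * d := by positivity
    simp only [hQ]; linarith
  have hQs : ∀ l, Q l - Q (l + 1) = d := fun l => by simp only [hQ]; push_cast; ring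
  have hfine : ∀ l ≤ n, meshPt σ ε β N l = σ * ε / β * -Real.log (Q l) := fun l hl => by
    rw [meshPt, if_pos (by omega), phi]
    congr 4
    simp only [hd]; ring
  have hcoarse : ∀ l, n ≤ l → meshPt σ ε β N l
      = 1 - (1 - meshPt σ ε β N n) * (2 * ((N : ℝ) - l) / N) := fun l hl => by
    rcases hl.eq_or_lt with rfl | hl
    · have : 2 * ((N : ℝ) - n) / N = 1 := by
        rw [hNn]
        have : (n : ℝ) ≠ 0 := by positivity
        field_simp; ring
      rw [this]; ring
    · rw [meshPt, if_neg (by omega), hhalf, meshPt, if_pos (by omega)]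
  have hxn0 : 0 ≤ meshPt σ ε β N n := by
    rw [hfine n le_rfl]
    have := Real.log_nonpos (hQpos n le_rfl).le (hQ1 n)
    have : 0 ≤ -Real.log (Q n) := by linarith
    positivity
  have hsf : ∀ l, l + 1 ≤ n → meshPt σ ε β N (l + 1) - meshPt σ ε β N l
      = σ / β * ε * Real.log (Q l / Q (l + 1)) := fun l hl => by
    rw [hfine _ hl, hfine l (by omega), Real.log_div (hQpos l (by omega)).ne' (hQpos _ hl).ne']
    ring
  have hsc : ∀ l, n ≤ l → meshPt σ ε β N (l + 1) - meshPt σ ε β N l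
      = (1 - meshPt σ ε β N n) * (2 / N) := fun l hl => by
    rw [hcoarse (l + 1) (by omega), hcoarse l hl]
    push_cast
    field_simp
    ring
  have hlog_low : ∀ l, l + 1 ≤ n → 3 / 2 / N ≤ Real.log (Q l / Q (l + 1)) := fun l hl => by
    have h0 := hQpos l (by omega)
    have h1 := hQpos (l + 1) hl
    have h2 := Real.one_sub_inv_le_log_of_pos (div_pos h0 h1)
    refine hdlow.trans (le_trans ?_ h2)
    have : 1 - (Q l / Q (l + 1))⁻¹ = d / Q l := by
      rw [inv_div, ← hQs l]; field_simp
    rw [this, le_div_iff₀ h0]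
    have := hQ1 l
    nlinarith
  have hlog_up : ∀ l, l + 1 ≤ n → Real.log (Q l / Q (l + 1)) ≤ d / Q (l + 1) := fun l hl => by
    have h0 := hQpos l (by omega)
    have h1 := hQpos (l + 1) hl
    refine (Real.log_le_sub_one_of_pos (div_pos h0 h1)).trans (le_of_eq ?_)
    rw [← hQs l]; field_simp
  have hqQ : ∀ l ≤ n, layerFun σ ε β (meshPt σ ε β N l) = Q l := fun l hl => by
    rw [layerFun, hfine l hl]
    have : -(β * (σ * ε / β * -Real.log (Q l)) / (σ * ε)) = Real.log (Q l) := by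
      field_simp
    rw [this, Real.exp_log (hQpos l hl)]
  -- `d = Q (l + 1) - Q (l + 2) < Q (l + 1)`. This needs a further fine point; on the last fine
  -- interval the ratio is `(d + ε) / ε`, which is not bounded.
  have hgood : ∀ l, l + 2 ≤ n → Q l ≤ 2 * Q (l + 1) := fun l hl => by
    have h1 := hQs l
    have h2 := hQs (l + 1)
    have h3 := hQpos (l + 1 + 1) hl
    linarith
  refine ⟨?_, ?_, ?_, ?_, ?_, ?_, ?_, ?_, ?_⟩
  · rw [hfine 0 (by omega)]; simp [hQ]
  · rw [hcoarse N (by omega)]; simp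
  · intro l _
    rcases lt_or_ge l n with h | h
    · have := hsf l h
      have h2 := hlog_low l h
      have : 0 < σ / β * ε * Real.log (Q l / Q (l + 1)) :=
        mul_pos (by positivity) (lt_of_lt_of_le (by positivity) h2)
      linarith
    · have := hsc l h
      have : 0 < (1 - meshPt σ ε β N n) * (2 / N) := mul_pos (by linarith) (by positivity)
      linarith
  · intro l _
    rcases lt_or_ge l n with h | h
    · rw [hsf l h]
      have h2 := hlog_up l h
      have h3 : d / Q (l + 1) ≤ d / ε := div_le_div_of_nonneg_left hd0.le hε (hQle _ h)
      calc σ / β * ε * Real.log (Q l / Q (l + 1)) ≤ σ / β * ε * (d / ε) :=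
            mul_le_mul_of_nonneg_left (h2.trans h3) (by positivity)
        _ = σ / β * d := by field_simp
        _ ≤ σ / β * (2 / N) := mul_le_mul_of_nonneg_left hdup hsb.le
        _ = (σ / β * 2) / N := by ring
        _ ≤ C / N := div_le_div_of_nonneg_right (by linarith) hNpos.le
    · rw [hsc l h]
      calc (1 - meshPt σ ε β N n) * (2 / N) ≤ 1 * (2 / N) :=
            mul_le_mul_of_nonneg_right (by linarith) (by positivity)
        _ = 2 / N := one_mul _
        _ ≤ C / N := div_le_div_of_nonneg_right (by linarith) hNpos.le
  · intro l _
    rcases lt_or_ge l n with h | h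
    · rw [hsf l h]
      have h2 := hlog_low l h
      calc ε / N ≤ β / σ * (σ / β * ε * (3 / 2 / N)) := by
            have : β / σ * (σ / β * ε * (3 / 2 / N)) = 3 / 2 * (ε / N) := by field_simp
            rw [this]
            have : 0 ≤ ε / N := by positivity
            linarith
        _ ≤ C * (σ / β * ε * Real.log (Q l / Q (l + 1))) := by
            refine mul_le_mul (by linarith) (mul_le_mul_of_nonneg_left h2 (by positivity))
              (by positivity) (by linarith)
    · rw [hsc l h]
      calc ε / N ≤ 2 / N := div_le_div_of_nonneg_right (by linarith) hNpos.le
        _ = 1 / δ * (δ * (2 / N)) := by field_simp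
        _ ≤ C * ((1 - meshPt σ ε β N n) * (2 / N)) := by
            refine mul_le_mul (by linarith) (mul_le_mul_of_nonneg_right (by linarith)
              (by positivity)) (by positivity) (by linarith)
  · intro l hl
    rw [hhalf] at hl
    rw [hsf l (by omega), hqQ l (by omega)]
    have h1 := hQpos (l + 1) (by omega)
    have h0 := hQpos l (by omega)
    calc σ / β * ε * Real.log (Q l / Q (l + 1)) * Q l
        ≤ σ / β * ε * (d / Q (l + 1)) * (2 * Q (l + 1)) := by
          refine mul_le_mul (mul_le_mul_of_nonneg_left (hlog_up l (by omega)) (by positivity))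
            (hgood l hl) h0.le (by positivity)
      _ = σ / β * ε * (2 * d) := by field_simp
      _ ≤ σ / β * ε * (2 * (2 / N)) := by
          refine mul_le_mul_of_nonneg_left (by linarith) (by positivity)
      _ = 4 * (σ / β) * (ε / N) := by ring
      _ ≤ C * (ε / N) := mul_le_mul_of_nonneg_right (by linarith) (by positivity)
  · intro l hl
    rw [hhalf] at hl
    rw [hqQ l (by omega), hqQ (l + 1) (by omega)]
    exact hgood l hl
  · intro l hl
    rw [hhalf] at hl
    rw [hqQ l (by omega)]
    have h1 := hQs l
    rw [hl, hQn] at h1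
    calc Q l = d + ε := by linarith
      _ ≤ 2 / N + 1 / N := add_le_add hdup hεN'
      _ = 3 / N := by ring
  · intro l hl hlN
    rw [hhalf] at hl
    have h1 : meshPt σ ε β N n ≤ meshPt σ ε β N l := by
      rw [hcoarse l hl]
      have h2 : 2 * ((N : ℝ) - l) / N ≤ 1 := by
        rw [div_le_one hNpos]
        have : (n : ℝ) ≤ l := by exact_mod_cast hl
        linarith
      nlinarith
    calc layerFun σ ε β (meshPt σ ε β N l) ≤ layerFun σ ε β (meshPt σ ε β N n) := by
          unfold layerFun
          refine Real.exp_le_exp.2 (neg_le_neg ?_)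
          exact div_le_div_of_nonneg_right (mul_le_mul_of_nonneg_left h1 hβ.le) (by positivity)
      _ = ε := by rw [hqQ n le_rfl, hQn]

/-! ### Weighted one-dimensional interpolation estimates on the mesh. -/

/-- The length of the mesh interval `[x l, x (l + 1)]`. -/
def step (x : ℕ → ℝ) (l : ℕ) : ℝ := x (l + 1) - x l

/-- Interpolation estimates, on all mesh intervals, for functions whose `i`-th derivative is bounded
by a multiple of `A i`; the derivative of the error is measured against `gam`. -/
structure WeightBound (k N : ℕ) (x : ℕ → ℝ) (A gam : ℕ → ℝ → ℝ) (C : ℝ) : Prop where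
  nonneg : ∀ i ξ, 0 ≤ A i ξ
  zero_le_one : ∀ ξ, 0 ≤ ξ → A 0 ξ ≤ 1
  gam_nonneg : ∀ l < N, ∀ ξ, 0 ≤ gam l ξ
  error : ∀ l < N, ∀ n, n = k ∨ n = k + 1 → ∀ (K : ℝ) (g : ℕ → ℝ → ℝ), 0 ≤ K →
    IsChain (x l) (step x l) n g →
    (∀ i ≤ n, ∀ ξ ∈ Icc (x l) (x l + step x l), |g i ξ| ≤ K * A i ξ) →
    ∀ ξ ∈ Icc (x l) (x l + step x l),
      |g 0 ξ - cellSum k (x l) (step x l) (fun s => g 0 (x l + s / k * step x l)) ξ| ≤ C * K / N ^ n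
  deriv_error : ∀ l < N, ∀ (K : ℝ) (g : ℕ → ℝ → ℝ), 0 ≤ K →
    IsChain (x l) (step x l) (k + 1) g →
    (∀ i ≤ k + 1, ∀ ξ ∈ Icc (x l) (x l + step x l), |g i ξ| ≤ K * A i ξ) →
    ∀ ξ ∈ Icc (x l) (x l + step x l),
      |g 1 ξ - cellSumDeriv k (x l) (step x l) (fun s => g 0 (x l + s / k * step x l)) ξ|
        ≤ C * K / N ^ k * gam l ξ
  deriv_stable : ∀ l < N, ∀ (K : ℝ) (g : ℕ → ℝ → ℝ), 0 ≤ K →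
    IsChain (x l) (step x l) 1 g →
    (∀ i ≤ 1, ∀ ξ ∈ Icc (x l) (x l + step x l), |g i ξ| ≤ K * A i ξ) →
    ∀ ξ ∈ Icc (x l) (x l + step x l),
      |cellSumDeriv k (x l) (step x l) (fun s => g 0 (x l + s / k * step x l)) ξ| ≤ C * K * gam l ξ

theorem MeshFacts.step_pos {N : ℕ} {x : ℕ → ℝ} {q : ℝ → ℝ} {ε C : ℝ}
    (h : MeshFacts N x q ε C) {l : ℕ} (hl : l ≤ N) : 0 < step x l := sub_pos.2 (h.lt l hl)

theorem MeshFacts.nonneg {N : ℕ} {x : ℕ → ℝ} {q : ℝ → ℝ} {ε C : ℝ}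
    (h : MeshFacts N x q ε C) {l : ℕ} (hl : l ≤ N) : 0 ≤ x l := by
  induction l with
  | zero => exact h.zero.ge
  | succ l ih => exact (ih (by omega)).trans (h.lt l (by omega)).le

theorem nodes_mem_Icc {k : ℕ} (hk : 1 ≤ k) {a h : ℝ} (hh : 0 < h) {s : ℕ} (hs : s ≤ k) :
    a + (s : ℝ) / k * h ∈ Icc a (a + h) := by
  have hkp : (0 : ℝ) < k := by positivity
  have : (s : ℝ) / k ≤ 1 := (div_le_one hkp).2 (by exact_mod_cast hs)
  constructor
  · have : 0 ≤ (s : ℝ) / k * h := by positivity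
    linarith
  · nlinarith

/-- Meant for a direction without a layer: of the mesh, only the positivity of the steps and `h ≤ D
/ N` enter. -/
theorem exists_weightBound_one {k : ℕ} (hk : 1 ≤ k) (D : ℝ) (hD : 1 ≤ D) : ∃ C : ℝ, 1 ≤ C ∧
    ∀ (ε : ℝ) (N : ℕ) (x : ℕ → ℝ) (q : ℝ → ℝ), 4 ≤ N → MeshFacts N x q ε D →
      WeightBound k N x (fun _ _ => 1) (fun _ _ => 1) C := by
  obtain ⟨Λ, hΛ, herr⟩ := exists_cellSum_error hk
  have hpow : ∀ n, 1 ≤ D ^ n := fun n => one_le_pow₀ hD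
  have hmono : ∀ n ≤ k + 1, D ^ n ≤ D ^ (k + 1) := fun n hn => pow_le_pow_right₀ hD hn
  refine ⟨2 * Λ * D ^ (k + 1), by nlinarith [hpow (k + 1)], fun ε N x q hN hm => ?_⟩
  have hNpos : (0 : ℝ) < N := by exact_mod_cast (by omega : 0 < N)
  have hbd : ∀ l < N, ∀ n ≤ k + 1, ∀ K : ℝ, 0 ≤ K →
      Λ * (step x l ^ n * (K * 1)) ≤ 2 * Λ * D ^ (k + 1) * K / N ^ n := by
    intro l hl n hn K hK
    have h1 : step x l ^ n ≤ D ^ (k + 1) / N ^ n := by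
      refine (pow_le_pow_left₀ (hm.step_pos hl.le).le (hm.step_le l hl) n).trans ?_
      rw [div_pow]
      exact div_le_div_of_nonneg_right (hmono n hn) (by positivity)
    calc Λ * (step x l ^ n * (K * 1)) ≤ Λ * (D ^ (k + 1) / N ^ n * (K * 1)) := by gcongr
      _ = 1 * (Λ * D ^ (k + 1) * K / N ^ n) := by ring
      _ ≤ 2 * (Λ * D ^ (k + 1) * K / N ^ n) := by gcongr; norm_num
      _ = 2 * Λ * D ^ (k + 1) * K / N ^ n := by ring
  refine ⟨fun _ _ => zero_le_one, fun _ _ => le_rfl, fun _ _ _ => zero_le_one, ?_, ?_, ?_⟩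
  · intro l hl n hn K g hK hg hb ξ hξ
    obtain ⟨m, rfl⟩ : ∃ m, n = m + 1 := ⟨n - 1, by omega⟩
    exact ((herr m (by omega) _ _ (K * 1) g (hm.step_pos hl.le) hg (hb (m + 1) le_rfl) ξ hξ).1).trans
      (hbd l hl _ (by omega) K hK)
  · intro l hl K g hK hg hb ξ hξ
    rw [mul_one]
    exact ((herr k le_rfl _ _ (K * 1) g (hm.step_pos hl.le) hg (hb (k + 1) le_rfl) ξ hξ).2).trans
      (hbd l hl _ (by omega) K hK)
  · intro l hl K g hK hg hb ξ hξ
    -- For `m = 0` the derivative error is at most a multiple of the bound on `g 1`, without any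
    -- power of `h`; the triangle inequality then gives stability.
    have h1 := (herr 0 (by omega) _ _ (K * 1) g (hm.step_pos hl.le) hg (hb 1 le_rfl) ξ hξ).2
    have h2 := hb 1 le_rfl ξ hξ
    have h3 : 2 * (Λ * K) * 1 ≤ 2 * (Λ * K) * D ^ (k + 1) := by gcongr; exact hpow _
    have h4 : K ≤ Λ * K := le_mul_of_one_le_left hK hΛ
    rw [abs_le] at *
    constructor <;> linarith

/-- The measure for derivatives of interpolation errors of layer functions. -/
noncomputable def layerGam (N : ℕ) (x : ℕ → ℝ) (q : ℝ → ℝ) (ε : ℝ) (l : ℕ) (ξ : ℝ) : ℝ :=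
  1 + q ξ / ε + 1 / (N * step x l)

/-- Intervals with `l + 2 ≤ N / 2` are handled by `h q ≤ D ε / N`, the others by `q (x l) ≤ 3 / N`.
The derivative bounds keep `q ξ / ε` at the running point `ξ`, because its square has to be
integrated over the layer. -/
theorem exists_weightBound_layer {k : ℕ} (hk : 1 ≤ k) (D : ℝ) (hD : 1 ≤ D) : ∃ C : ℝ, 1 ≤ C ∧
    ∀ (ε : ℝ) (N : ℕ) (x : ℕ → ℝ) (q : ℝ → ℝ), 0 < ε → 4 ≤ N → ε ≤ (N : ℝ)⁻¹ → Antitone q →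
      (∀ ξ, 0 < q ξ) → (∀ ξ, 0 ≤ ξ → q ξ ≤ 1) → MeshFacts N x q ε D →
      WeightBound k N x (fun i ξ => (ε ^ i)⁻¹ * q ξ ^ (k + 1)) (layerGam N x q ε) C := by
  obtain ⟨Λ₁, hΛ₁, herr₁⟩ := exists_cellSum_error hk
  obtain ⟨Λ₂, hΛ₂, hbnd₂⟩ := exists_cellSum_bound k
  set Λ := max Λ₁ Λ₂ with hΛdef
  have hΛ : 1 ≤ Λ := hΛ₁.trans (le_max_left _ _)
  -- One constant for both regimes: it dominates the powers of `D` from the fine intervals and the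
  -- powers of `3` from `q ≤ 3 / N`.
  set P := (3 * D) ^ (k + 1) with hP
  have hP1 : 1 ≤ P := one_le_pow₀ (by linarith)
  have hP3 : ∀ n ≤ k + 1, 3 ^ n ≤ P := fun n hn =>
    (pow_le_pow_left₀ (by norm_num) (by linarith) n).trans (pow_le_pow_right₀ (by linarith) hn)
  have hPD : ∀ n ≤ k + 1, D ^ n ≤ P := fun n hn =>
    (pow_le_pow_left₀ (by linarith) (by linarith) n).trans (pow_le_pow_right₀ (by linarith) hn)
  refine ⟨4 * Λ * P, by nlinarith, fun ε N x q hε hN hεN hqa hq0 hq1 hm => ?_⟩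
  have hNpos : (0 : ℝ) < N := by exact_mod_cast (by omega : 0 < N)
  have hN1 : (1 : ℝ) ≤ N := by exact_mod_cast (by omega : 1 ≤ N)
  have hε3 : ε ≤ 3 / N := by
    refine hεN.trans ?_
    rw [inv_eq_one_div]
    exact div_le_div_of_nonneg_right (by norm_num) hNpos.le
  have hεN' : ε ^ k ≤ 1 / N ^ k := by
    rw [one_div, ← inv_pow]; exact pow_le_pow_left₀ hε.le hεN k
  have hstep : ∀ l < N, 0 < step x l := fun l hl => hm.step_pos hl.le
  have hQ1 : ∀ l < N, q (x l) ≤ 1 := fun l hl => hq1 _ (hm.nonneg hl.le)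
  have hqQ : ∀ l, ∀ ξ ∈ Icc (x l) (x l + step x l), q ξ ≤ q (x l) := fun l ξ hξ => hqa hξ.1
  have hqR : ∀ l, ∀ ξ ∈ Icc (x l) (x l + step x l), q (x (l + 1)) ≤ q ξ := fun l ξ hξ =>
    hqa (hξ.2.trans (by simp [step]))
  have hgam : ∀ l < N, ∀ ξ, 1 ≤ layerGam N x q ε l ξ ∧ q ξ / ε ≤ layerGam N x q ε l ξ ∧
      1 / (N * step x l) ≤ layerGam N x q ε l ξ ∧
      q ξ / ε + 1 / (N * step x l) ≤ layerGam N x q ε l ξ := fun l hl ξ => by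
    have h1 : 0 ≤ q ξ / ε := div_nonneg (hq0 ξ).le hε.le
    have h2 : 0 ≤ 1 / (N * step x l) := by have := hstep l hl; positivity
    unfold layerGam
    refine ⟨?_, ?_, ?_, ?_⟩ <;> linarith
  -- on `[x l, x (l + 1)]`, the weights are largest at `x l`
  have hsup : ∀ (l : ℕ) (K : ℝ) (g : ℕ → ℝ → ℝ) (n : ℕ), 0 ≤ K →
      (∀ i ≤ n, ∀ ξ ∈ Icc (x l) (x l + step x l), |g i ξ| ≤ K * ((ε ^ i)⁻¹ * q ξ ^ (k + 1))) →
      ∀ i ≤ n, ∀ ξ ∈ Icc (x l) (x l + step x l),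
        |g i ξ| ≤ K * ((ε ^ i)⁻¹ * q (x l) ^ (k + 1)) := by
    intro l K g n hK hb i hi ξ hξ
    refine (hb i hi ξ hξ).trans ?_
    have := pow_le_pow_left₀ (hq0 ξ).le (hqQ l ξ hξ) (k + 1)
    gcongr
  have herr : ∀ (m : ℕ), m ≤ k → ∀ (a h K : ℝ) (g : ℕ → ℝ → ℝ), 0 < h → IsChain a h (m + 1) g →
      (∀ ξ ∈ Icc a (a + h), |g (m + 1) ξ| ≤ K) → ∀ ξ ∈ Icc a (a + h),
      |g 0 ξ - cellSum k a h (fun s => g 0 (a + s / k * h)) ξ| ≤ Λ * (h ^ (m + 1) * K) ∧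
      |g 1 ξ - cellSumDeriv k a h (fun s => g 0 (a + s / k * h)) ξ| ≤ Λ * (h ^ m * K) := by
    intro m hmk a h K g hh hg hb ξ hξ
    have hK : 0 ≤ K := (abs_nonneg _).trans (hb ξ hξ)
    obtain ⟨h1, h2⟩ := herr₁ m hmk a h K g hh hg hb ξ hξ
    exact ⟨h1.trans (mul_le_mul_of_nonneg_right (le_max_left _ _) (by positivity)),
      h2.trans (mul_le_mul_of_nonneg_right (le_max_left _ _) (by positivity))⟩
  have hbnd : ∀ (l : ℕ) (K : ℝ) (g : ℝ → ℝ), l < N →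
      (∀ ξ ∈ Icc (x l) (x l + step x l), |g ξ| ≤ K) → ∀ ξ ∈ Icc (x l) (x l + step x l),
      |cellSum k (x l) (step x l) (fun s => g (x l + s / k * step x l)) ξ| ≤ Λ * K ∧
      |cellSumDeriv k (x l) (step x l) (fun s => g (x l + s / k * step x l)) ξ|
        ≤ Λ * K / step x l := by
    intro l K g hl hb ξ hξ
    have hK : 0 ≤ K := (abs_nonneg _).trans (hb ξ hξ)
    have hs := hstep l hl
    obtain ⟨h1, h2⟩ := hbnd₂ (x l) (step x l) K (fun s => g (x l + s / k * step x l)) hs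
      (fun s hs' => hb _ (nodes_mem_Icc hk hs hs')) ξ hξ
    refine ⟨h1.trans (mul_le_mul_of_nonneg_right (le_max_right _ _) hK), h2.trans ?_⟩
    exact div_le_div_of_nonneg_right (mul_le_mul_of_nonneg_right (le_max_right _ _) hK) hs.le
  have hlayer : ∀ l < N, l + 2 ≤ N / 2 → ∀ n, step x l ^ n * ((ε ^ n)⁻¹ * q (x l) ^ n) ≤
      D ^ n / N ^ n := by
    intro l hl hl2 n
    have h1 : step x l * q (x l) ≤ D * (ε / N) := hm.layer l hl2
    have h2 := hstep l hl
    have h3 := hq0 (x l)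
    calc step x l ^ n * ((ε ^ n)⁻¹ * q (x l) ^ n) = (step x l * q (x l)) ^ n / ε ^ n := by
          rw [mul_pow]; field_simp
      _ ≤ (D * (ε / N)) ^ n / ε ^ n := by gcongr
      _ = D ^ n / N ^ n := by rw [mul_pow, div_pow]; field_simp
  have hout : ∀ l < N, ¬ l + 2 ≤ N / 2 → q (x l) ≤ 3 / N := by
    intro l hl hl2
    rcases (by omega : l + 1 = N / 2 ∨ N / 2 ≤ l) with h | h
    · exact hm.transition l h
    · exact (hm.coarse l h hl.le).trans hε3
  have hNmono : ∀ n ≤ k + 1, (1 : ℝ) / N ^ (k + 1) ≤ 1 / N ^ n := fun n hn =>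
    one_div_le_one_div_of_le (by positivity) (pow_le_pow_right₀ hN1 hn)
  have houtpow : ∀ l < N, ¬ l + 2 ≤ N / 2 → ∀ n ≤ k + 1, q (x l) ^ n ≤ P / N ^ n := by
    intro l hl hl2 n hn
    refine (pow_le_pow_left₀ (hq0 _).le (hout l hl hl2) n).trans ?_
    rw [div_pow]
    exact div_le_div_of_nonneg_right (hP3 n hn) (by positivity)
  refine ⟨?_, ?_, ?_, ?_, ?_, ?_⟩
  · intro i ξ
    have := hq0 ξ
    positivity
  · intro ξ hξ
    simpa using pow_le_one₀ (hq0 ξ).le (hq1 ξ hξ)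
  · intro l hl ξ
    exact zero_le_one.trans (hgam l hl ξ).1
  · intro l hl n hn K g hK hg hb ξ hξ
    have hs := hstep l hl
    have hQ := hq0 (x l)
    have hb' := hsup l K g n hK hb
    -- On the fine intervals `n` of the `k + 1` powers of `q` compensate `ε^{-n}`. Elsewhere
    -- `q^{k+1}` alone is small enough, and function and interpolant are bounded separately without
    -- derivatives.
    by_cases hl2 : l + 2 ≤ N / 2
    · obtain ⟨m, rfl⟩ : ∃ m, n = m + 1 := ⟨n - 1, by omega⟩
      refine (herr m (by omega) _ _ _ g hs hg (hb' (m + 1) le_rfl) ξ hξ).1.trans ?_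
      have h1 := hlayer l hl hl2 (m + 1)
      have h2 : q (x l) ^ (k + 1) ≤ q (x l) ^ (m + 1) :=
        pow_le_pow_of_le_one hQ.le (hQ1 l hl) (by omega)
      calc Λ * (step x l ^ (m + 1) * (K * ((ε ^ (m + 1))⁻¹ * q (x l) ^ (k + 1))))
          ≤ Λ * (step x l ^ (m + 1) * (K * ((ε ^ (m + 1))⁻¹ * q (x l) ^ (m + 1)))) := by gcongr
        _ = Λ * K * (step x l ^ (m + 1) * ((ε ^ (m + 1))⁻¹ * q (x l) ^ (m + 1))) := by ring
        _ ≤ Λ * K * (D ^ (m + 1) / N ^ (m + 1)) := by gcongr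
        _ ≤ Λ * K * (P / N ^ (m + 1)) := by gcongr; exact hPD _ (by omega)
        _ = 1 * (Λ * K * (P / N ^ (m + 1))) := by ring
        _ ≤ 4 * (Λ * K * (P / N ^ (m + 1))) := by gcongr; norm_num
        _ = _ := by ring
    · have h0 := hb' 0 (Nat.zero_le _)
      simp only [pow_zero, inv_one, one_mul] at h0
      have h1 := (hbnd l _ (g 0) hl h0 ξ hξ).1
      have h2 := h0 ξ hξ
      have h3 := houtpow l hl hl2 (k + 1) le_rfl
      have h4 : K * q (x l) ^ (k + 1) ≤ Λ * (K * q (x l) ^ (k + 1)) :=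
        le_mul_of_one_le_left (by positivity) hΛ
      calc |g 0 ξ - cellSum k (x l) (step x l) (fun s => g 0 (x l + s / k * step x l)) ξ|
          ≤ 2 * (Λ * (K * q (x l) ^ (k + 1))) := by
            rw [abs_le] at *; constructor <;> linarith
        _ ≤ 2 * (Λ * (K * (P / N ^ (k + 1)))) := by gcongr
        _ = 2 * (Λ * (K * (P * (1 / N ^ (k + 1))))) := by ring
        _ ≤ 2 * (Λ * (K * (P * (1 / N ^ n)))) := by gcongr 2 * (Λ * (K * (P * ?_))); exact hNmono n (by omega)
        _ ≤ 4 * (Λ * (K * (P * (1 / N ^ n)))) := by gcongr; norm_num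
        _ = _ := by ring
  · intro l hl K g hK hg hb ξ hξ
    have hs := hstep l hl
    have hQ := hq0 (x l)
    have hqξ := hq0 ξ
    have hb' := hsup l K g (k + 1) hK hb
    obtain ⟨g1, g2, g3, g4⟩ := hgam l hl ξ
    by_cases hl2 : l + 2 ≤ N / 2
    · refine (herr k le_rfl _ _ _ g hs hg (hb' (k + 1) le_rfl) ξ hξ).2.trans ?_
      have h1 := hlayer l hl hl2 k
      -- Of the `k + 1` factors `q (x l) / ε`, `k` are absorbed by `h^k`; the remaining one is moved
      -- to `ξ` and becomes part of the weight.
      have h2 : q (x l) ≤ 2 * q ξ := (hm.layer_ratio l hl2).trans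
        (mul_le_mul_of_nonneg_left (hqR l ξ hξ) (by norm_num))
      calc Λ * (step x l ^ k * (K * ((ε ^ (k + 1))⁻¹ * q (x l) ^ (k + 1))))
          = Λ * K * (step x l ^ k * ((ε ^ k)⁻¹ * q (x l) ^ k)) * (q (x l) / ε) := by
            field_simp; ring
        _ ≤ Λ * K * (P / N ^ k) * (2 * q ξ / ε) := by
            have := h1.trans (div_le_div_of_nonneg_right (hPD k (by omega)) (by positivity))
            gcongr
        _ = 2 * Λ * P * K / N ^ k * (q ξ / ε) := by ring
        _ ≤ 4 * Λ * P * K / N ^ k * layerGam N x q ε l ξ := by gcongr; norm_num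
    · rcases (by omega : l + 1 = N / 2 ∨ N / 2 ≤ l) with h | h
      -- The transition interval: the derivative of `g 0` contributes `q ξ / ε`, that of the
      -- interpolant, by the inverse estimate, `1 / (N h)`.
      · have h0 := hb' 0 (Nat.zero_le _)
        simp only [pow_zero, inv_one, one_mul] at h0
        have h1 := (hbnd l _ (g 0) hl h0 ξ hξ).2
        have h2 : |g 1 ξ| ≤ Λ * K * (P / N ^ k) * (q ξ / ε) := by
          refine (hb 1 (by omega) ξ hξ).trans ?_
          have e1 : q ξ ^ k ≤ P / N ^ k :=
            (pow_le_pow_left₀ hqξ.le (hqQ l ξ hξ) k).trans (houtpow l hl hl2 k (by omega))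
          calc K * ((ε ^ 1)⁻¹ * q ξ ^ (k + 1)) = 1 * K * q ξ ^ k * (q ξ / ε) := by
                rw [pow_one, pow_succ]; field_simp
            _ ≤ _ := by gcongr
        have h3 : Λ * (K * q (x l) ^ (k + 1)) / step x l
            ≤ Λ * K * (P / N ^ k) * (1 / (N * step x l)) := by
          have := houtpow l hl hl2 (k + 1) le_rfl
          calc Λ * (K * q (x l) ^ (k + 1)) / step x l
              ≤ Λ * (K * (P / N ^ (k + 1))) / step x l := by gcongr
            _ = _ := by rw [pow_succ]; field_simp
        calc |g 1 ξ - cellSumDeriv k (x l) (step x l) (fun s => g 0 (x l + s / k * step x l)) ξ|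
            ≤ Λ * K * (P / N ^ k) * (q ξ / ε + 1 / (N * step x l)) := by
              rw [abs_le] at *; constructor <;> linarith
          _ ≤ 4 * (Λ * K * (P / N ^ k)) * (layerGam N x q ε l ξ) := by
              have : 0 ≤ Λ * K * (P / N ^ k) := by positivity
              have := mul_le_mul_of_nonneg_left g4 this
              nlinarith
          _ = _ := by ring
      -- Coarse intervals: the lowest order suffices, since `ε^{-1} q^{k+1} ≤ ε^k ≤ N^{-k}` without
      -- help from `h`.
      · have h1 := (herr 0 (by omega) _ _ _ g hs (hg.mono (by omega)) (hb' 1 (by omega)) ξ hξ).2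
        refine h1.trans ?_
        have h2 := hm.coarse l h hl.le
        calc Λ * (step x l ^ 0 * (K * ((ε ^ 1)⁻¹ * q (x l) ^ (k + 1))))
            ≤ Λ * (step x l ^ 0 * (K * ((ε ^ 1)⁻¹ * ε ^ (k + 1)))) := by gcongr
          _ = Λ * K * ε ^ k := by rw [pow_succ]; field_simp; ring
          _ ≤ Λ * K * (1 / N ^ k) := by gcongr
          _ = 1 * Λ * 1 * K / N ^ k * 1 := by ring
          _ ≤ _ := by gcongr; norm_num
  · intro l hl K g hK hg hb ξ hξ
    have hs := hstep l hl
    have hQ := hq0 (x l)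
    have hqξ := hq0 ξ
    have hb' := hsup l K g 1 hK hb
    obtain ⟨g1, g2, g3, g4⟩ := hgam l hl ξ
    -- On the transition interval `q (x l) / ε` is not controlled by the weight, so the inverse
    -- estimate replaces the comparison with `g 1`.
    by_cases hl1 : l + 1 = N / 2
    · have h0 := hb' 0 (Nat.zero_le _)
      simp only [pow_zero, inv_one, one_mul] at h0
      refine (hbnd l _ (g 0) hl h0 ξ hξ).2.trans ?_
      have h3 : q (x l) ^ (k + 1) ≤ P * (1 / N) := by
        have := houtpow l hl (by omega) (k + 1) le_rfl
        refine this.trans ?_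
        rw [div_eq_mul_one_div]
        have := hNmono 1 (by omega)
        rw [pow_one] at this
        gcongr
      calc Λ * (K * q (x l) ^ (k + 1)) / step x l ≤ Λ * (K * (P * (1 / N))) / step x l := by gcongr
        _ = 1 * Λ * P * K * (1 / (N * step x l)) := by field_simp
        _ ≤ _ := by gcongr; norm_num
    · have h1 := (herr 0 (by omega) _ _ _ g hs hg (hb' 1 (by omega)) ξ hξ).2
      have h2 := hb' 1 le_rfl ξ hξ
      have hQε : q (x l) / ε ≤ 2 * layerGam N x q ε l ξ := by
        rcases (by omega : l + 2 ≤ N / 2 ∨ N / 2 ≤ l) with h | h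
        · have h2 : q (x l) ≤ 2 * q ξ := (hm.layer_ratio l h).trans
            (mul_le_mul_of_nonneg_left (hqR l ξ hξ) (by norm_num))
          have := div_le_div_of_nonneg_right h2 hε.le
          rw [mul_div_assoc] at this
          linarith
        · have := (div_le_one hε).2 (hm.coarse l h hl.le)
          linarith
      have h3 : K * ((ε ^ 1)⁻¹ * q (x l) ^ (k + 1)) ≤ K * (2 * layerGam N x q ε l ξ) := by
        have : q (x l) ^ (k + 1) ≤ q (x l) ^ 1 :=
          pow_le_pow_of_le_one hQ.le (hQ1 l hl) (by omega)
        refine mul_le_mul_of_nonneg_left ?_ hK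
        calc (ε ^ 1)⁻¹ * q (x l) ^ (k + 1) ≤ (ε ^ 1)⁻¹ * q (x l) ^ 1 := by gcongr
          _ = q (x l) / ε := by rw [pow_one, pow_one]; field_simp
          _ ≤ _ := hQε
      have h4 : K * ((ε ^ 1)⁻¹ * q (x l) ^ (k + 1)) ≤ Λ * (K * ((ε ^ 1)⁻¹ * q (x l) ^ (k + 1))) :=
        le_mul_of_one_le_left (by positivity) hΛ
      calc |cellSumDeriv k (x l) (step x l) (fun s => g 0 (x l + s / k * step x l)) ξ|
          ≤ 2 * (Λ * (K * ((ε ^ 1)⁻¹ * q (x l) ^ (k + 1)))) := by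
            simp only [pow_zero, one_mul] at h1
            rw [abs_le] at *; constructor <;> linarith
        _ ≤ 2 * (Λ * (K * (2 * layerGam N x q ε l ξ))) := by gcongr
        _ = 4 * Λ * 1 * K * layerGam N x q ε l ξ := by ring
        _ ≤ _ := by gcongr

/-! ### One-dimensional hat functions. -/

/-- A strictly increasing mesh of `[0, 1]` with `N` intervals, and one more point behind `1`. -/
structure IsMesh (N : ℕ) (x : ℕ → ℝ) : Prop where
  zero : x 0 = 0
  last : x N = 1
  lt : ∀ l ≤ N, x l < x (l + 1)

theorem MeshFacts.isMesh {N : ℕ} {x : ℕ → ℝ} {q : ℝ → ℝ} {ε C : ℝ}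
    (h : MeshFacts N x q ε C) : IsMesh N x := ⟨h.zero, h.last, h.lt⟩

namespace IsMesh

variable {N : ℕ} {x : ℕ → ℝ}

theorem lt_of_lt (hx : IsMesh N x) {i j : ℕ} (hij : i < j) (hj : j ≤ N + 1) : x i < x j := by
  induction j, hij using Nat.le_induction with
  | base => exact hx.lt i (by omega)
  | succ j hj' ih => exact (ih (by omega)).trans (hx.lt j (by omega))

theorem le_of_le (hx : IsMesh N x) {i j : ℕ} (hij : i ≤ j) (hj : j ≤ N + 1) : x i ≤ x j := by
  rcases hij.eq_or_lt with rfl | h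
  · exact le_rfl
  · exact (hx.lt_of_lt h hj).le

theorem step_pos (hx : IsMesh N x) {l : ℕ} (hl : l ≤ N) : 0 < step x l := sub_pos.2 (hx.lt l hl)

theorem one_le (hx : IsMesh N x) : 1 ≤ N := by
  rcases Nat.eq_zero_or_pos N with h | h
  · have h1 := hx.zero
    have h2 := hx.last
    rw [h, h1] at h2
    norm_num at h2
  · exact h

theorem Icc_subset (hx : IsMesh N x) {l : ℕ} (hl : l < N) :
    Icc (x l) (x (l + 1)) ⊆ Icc 0 1 := by
  rw [← hx.zero, ← hx.last]
  exact Icc_subset_Icc (hx.le_of_le (Nat.zero_le _) (by omega)) (hx.le_of_le hl (by omega))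

theorem exists_mem_Icc (hx : IsMesh N x) {ξ : ℝ} (hξ : ξ ∈ Icc (0 : ℝ) 1) :
    ∃ l < N, ξ ∈ Icc (x l) (x (l + 1)) := by
  have key : ∀ n ≤ N, ξ ≤ x n → 1 ≤ n → ∃ l < n, ξ ∈ Icc (x l) (x (l + 1)) := by
    intro n
    induction n with
    | zero => intro _ _ h; omega
    | succ n ih =>
      intro hn hξn _
      rcases le_or_gt (x n) ξ with h | h
      · exact ⟨n, by omega, h, hξn⟩
      · rcases Nat.eq_zero_or_pos n with rfl | h0
        · rw [hx.zero] at h; exact absurd hξ.1 (not_le.2 h)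
        · obtain ⟨l, hl, h1⟩ := ih (by omega) h.le h0
          exact ⟨l, by omega, h1⟩
  exact key N le_rfl (hx.last ▸ hξ.2) hx.one_le

end IsMesh

theorem mem_nodeIdx {k N : ℕ} {a : ℕ × ℕ} :
    a ∈ nodeIdx k N ↔ a = (N, 0) ∨ (a.1 < N ∧ a.2 < k) := by
  simp [nodeIdx]

/-- The closed conditions in `hat` overlap at mesh points; the branches agree there because the
reference polynomials take the values `0` and `1` at the ends. For the node `(N, 0)` the definition
looks at `x (N + 1)`, which is why a mesh has a point behind `1`. -/
theorem hat_eq_of_mem {k N : ℕ} (hk : 1 ≤ k) {x : ℕ → ℝ} (hx : IsMesh N x) {l : ℕ} (hl : l < N)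
    {a : ℕ × ℕ} (ha : a ∈ nodeIdx k N) {ξ : ℝ} (hξ : ξ ∈ Icc (x l) (x (l + 1))) :
    hat k x a ξ = if a.1 = l then lagrangeRef k a.2 ((ξ - x l) / step x l)
      else if a = (l + 1, 0) then lagrangeRef k k ((ξ - x l) / step x l) else 0 := by
  have hkr : (k : ℝ) ≠ 0 := by positivity
  have L0 : ∀ s ≤ k, lagrangeRef k s 0 = if (0 : ℕ) = s then 1 else 0 := fun s hs => by
    simpa using lagrangeRef_node hk hs (Nat.zero_le k)
  have L1 : ∀ s ≤ k, lagrangeRef k s 1 = if k = s then 1 else 0 := fun s hs => by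
    simpa [div_self hkr] using lagrangeRef_node hk hs le_rfl
  obtain ⟨i, s⟩ := a
  have ha' := mem_nodeIdx.1 ha
  simp only [Prod.mk.injEq] at ha'
  have hi : i ≤ N := by rcases ha' with h | h <;> omega
  have hs : s < k := by rcases ha' with h | h <;> omega
  unfold hat
  simp only [Prod.mk.injEq]
  rcases lt_trichotomy i l with h | h | h
  · have e1 : x (i + 1) ≤ x l := hx.le_of_le h (by omega)
    have e2 := hx.lt i hi
    rw [if_neg (by omega : ¬ i = l), if_neg (by omega : ¬ (i = l + 1 ∧ s = 0)),
      if_neg (by rintro ⟨-, -, -, h3⟩; linarith [hξ.1] : ¬ (s = 0 ∧ 1 ≤ i ∧ x (i - 1) ≤ ξ ∧ ξ ≤ x i))]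
    split_ifs with h1
    · have : ξ = x (i + 1) := by linarith [h1.2, hξ.1]
      rw [this, div_self (by linarith), L1 s hs.le, if_neg (by omega)]
    · rfl
  · subst h
    rw [if_pos (show x i ≤ ξ ∧ ξ ≤ x (i + 1) from hξ), if_pos rfl]; rfl
  · rcases (by omega : i = l + 1 ∨ l + 1 < i) with h' | h'
    · subst h'
      rw [if_neg (by omega : ¬ l + 1 = l)]
      simp only [true_and, Nat.add_sub_cancel]
      rcases hξ.2.eq_or_lt with h1 | h1
      · have e2 := hx.lt (l + 1) hi
        have e3 := hx.lt l hl.le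
        rw [if_pos ⟨h1.ge, by rw [h1]; exact e2.le⟩, h1, sub_self, zero_div, L0 s hs.le]
        have : (x (l + 1) - x l) / step x l = 1 := div_self (hx.step_pos hl.le).ne'
        rw [this, L1 k le_rfl, if_pos rfl]
        simp only [eq_comm]
      · rw [if_neg (fun h => absurd h.1 (not_le.2 h1))]
        by_cases h0 : s = 0
        · rw [if_pos ⟨h0, by omega, hξ⟩, if_pos h0]; rfl
        · rw [if_neg (fun h => h0 h.1), if_neg h0]
    · have e1 : x (l + 1) ≤ x (i - 1) := hx.le_of_le (by omega) (by omega)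
      have e2 : x (i - 1) < x i := hx.lt_of_lt (by omega) (by omega)
      rw [if_neg (by omega : ¬ i = l), if_neg (by omega : ¬ (i = l + 1 ∧ s = 0)),
        if_neg (fun h => by linarith [h.1, hξ.2])]
      split_ifs with h1
      · have : ξ = x (i - 1) := by linarith [h1.2.2.1, hξ.2]
        rw [this, sub_self, zero_div, L0 k le_rfl, if_neg (by omega)]
      · rfl

/-- The index of the `s`-th node, `s ≤ k`, of the mesh interval `l`. -/
def locIdx (k l s : ℕ) : ℕ × ℕ := if s < k then (l, s) else (l + 1, 0)

theorem locIdx_mem {k N l s : ℕ} (hk : 1 ≤ k) (hl : l < N) : locIdx k l s ∈ nodeIdx k N := by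
  rw [mem_nodeIdx, locIdx]
  split_ifs with h
  · exact Or.inr ⟨hl, h⟩
  · simp only [Prod.mk.injEq, and_true]
    have : l + 1 = N ∨ l + 1 < N := by omega
    exact this.imp id fun h => ⟨h, hk⟩

theorem node_locIdx {k : ℕ} (hk : 1 ≤ k) (x : ℕ → ℝ) (l : ℕ) {s : ℕ} (hs : s ≤ k) :
    node k x (locIdx k l s) = x l + s / k * step x l := by
  have hkr : (k : ℝ) ≠ 0 := by positivity
  unfold locIdx node step
  split_ifs with h
  · rfl
  · have : s = k := by omega
    subst this
    simp [div_self hkr]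

/-- On one closed mesh interval only the hats of its own `k + 1` nodes survive; this reduces global
sums to `cellSum`. -/
theorem sum_mul_hat {k N : ℕ} (hk : 1 ≤ k) {x : ℕ → ℝ} (hx : IsMesh N x) {l : ℕ} (hl : l < N)
    (c : ℕ × ℕ → ℝ) {ξ : ℝ} (hξ : ξ ∈ Icc (x l) (x (l + 1))) :
    ∑ a ∈ nodeIdx k N, c a * hat k x a ξ
      = cellSum k (x l) (step x l) (fun s => c (locIdx k l s)) ξ := by
  symm
  unfold cellSum
  refine Finset.sum_of_injOn (locIdx k l) ?_ ?_ ?_ ?_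
  · intro s hs t ht hst
    simp only [Finset.coe_range, mem_Iio] at hs ht
    unfold locIdx at hst
    split_ifs at hst <;> simp only [Prod.mk.injEq] at hst <;> omega
  · intro s _
    exact locIdx_mem hk hl
  · intro a ha hna
    rw [hat_eq_of_mem hk hx hl ha hξ]
    have ha' := mem_nodeIdx.1 ha
    obtain ⟨i, r⟩ := a
    simp only [Prod.mk.injEq] at ha' ⊢
    have hr : r < k := by rcases ha' with h | h <;> omega
    rw [if_neg, if_neg, mul_zero]
    · rintro ⟨rfl, rfl⟩
      exact hna ⟨k, by simp, by simp [locIdx]⟩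
    · rintro rfl
      exact hna ⟨r, by simp; omega, by simp [locIdx, hr]⟩
  · intro s hs
    rw [hat_eq_of_mem hk hx hl (locIdx_mem hk hl) hξ]
    unfold locIdx
    have hs' := Finset.mem_range.1 hs
    split_ifs with h1 h2 h3
    · rw [lagrangeRef_eq_eval hk]; simp [h1]
    · exact absurd rfl h2
    · exact absurd rfl h2
    · simp at *
    · have : s = k := by omega
      subst this
      rw [lagrangeRef_eq_eval hk]; simp
    · simp at *

theorem node_mem_Icc {k N : ℕ} (hk : 1 ≤ k) {x : ℕ → ℝ} (hx : IsMesh N x) {a : ℕ × ℕ}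
    (ha : a ∈ nodeIdx k N) : node k x a ∈ Icc (0 : ℝ) 1 := by
  rcases mem_nodeIdx.1 ha with rfl | ⟨h1, h2⟩
  · simp [node, hx.last]
  · have := nodes_mem_Icc hk (a := x a.1) (hx.step_pos h1.le) h2.le
    refine hx.Icc_subset h1 ?_
    have e : x a.1 + step x a.1 = x (a.1 + 1) := by simp [step]
    rw [e] at this
    exact this

theorem hat_node {k N : ℕ} (hk : 1 ≤ k) {x : ℕ → ℝ} (hx : IsMesh N x) {a b : ℕ × ℕ}
    (ha : a ∈ nodeIdx k N) (hb : b ∈ nodeIdx k N) :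
    hat k x a (node k x b) = if a = b then 1 else 0 := by
  have hN := hx.one_le
  -- Every node lies in some interval; the node `(N, 0)` is taken as the `k`-th one of the last
  -- interval.
  obtain ⟨l, s, hl, hs, hlb⟩ : ∃ l s, l < N ∧ s ≤ k ∧ b = locIdx k l s := by
    rcases mem_nodeIdx.1 hb with rfl | ⟨h1, h2⟩
    · exact ⟨N - 1, k, by omega, le_rfl, by simp [locIdx]; omega⟩
    · exact ⟨b.1, b.2, h1, h2.le, by simp [locIdx, h2]⟩
  have hst := hx.step_pos hl.le
  have hmem : node k x b ∈ Icc (x l) (x (l + 1)) := by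
    rw [hlb, node_locIdx hk x l hs]
    have := nodes_mem_Icc hk (a := x l) hst hs
    simpa [step] using this
  have hz : (node k x b - x l) / step x l = s / k := by
    rw [hlb, node_locIdx hk x l hs]
    have := hst.ne'
    field_simp
    ring
  rw [hat_eq_of_mem hk hx hl ha hmem, hz]
  obtain ⟨i, r⟩ := a
  have ha' := mem_nodeIdx.1 ha
  simp only [Prod.mk.injEq] at ha' ⊢
  have hr : r < k := by rcases ha' with h | h <;> omega
  rw [lagrangeRef_node hk hr.le hs, lagrangeRef_node hk le_rfl hs, hlb, locIdx]
  split_ifs <;> simp_all <;> omega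

theorem continuousOn_hat {k N : ℕ} (hk : 1 ≤ k) {x : ℕ → ℝ} (hx : IsMesh N x) {a : ℕ × ℕ}
    (ha : a ∈ nodeIdx k N) : ContinuousOn (hat k x a) (Icc 0 1) := by
  have hcell : ∀ l < N, ContinuousOn (hat k x a) (Icc (x l) (x (l + 1))) := by
    intro l hl
    refine ContinuousOn.congr (f := fun ξ => if a.1 = l then lagrangeRef k a.2 ((ξ - x l) / step x l)
      else if a = (l + 1, 0) then lagrangeRef k k ((ξ - x l) / step x l) else 0) ?_
      (fun ξ hξ => hat_eq_of_mem hk hx hl ha hξ)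
    have hc : ∀ s, Continuous fun ξ : ℝ => lagrangeRef k s ((ξ - x l) / step x l) := fun s => by
      simp only [lagrangeRef_eq_eval hk]
      exact (lagrangePoly k s).continuous.comp ((continuous_id.sub continuous_const).div_const _)
    split_ifs
    · exact (hc _).continuousOn
    · exact (hc _).continuousOn
    · exact continuousOn_const
  have hind : ∀ n ≤ N, ContinuousOn (hat k x a) (Icc (x 0) (x n)) := by
    intro n
    induction n with
    | zero => intro _; simp
    | succ n ih =>
      intro hn
      rw [← Icc_union_Icc_eq_Icc (hx.le_of_le (Nat.zero_le n) (by omega)) (hx.lt n (by omega)).le]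
      exact (ih (by omega)).union_of_isClosed (hcell n (by omega)) isClosed_Icc isClosed_Icc
  have := hind N le_rfl
  rwa [hx.zero, hx.last] at this

/-! ### Tensor-product finite element functions. -/

/-- The finite element function with nodal values `c`. -/
noncomputable def comb (k N : ℕ) (x y : ℕ → ℝ) (c : ℕ × ℕ → ℕ × ℕ → ℝ) (p : ℝ × ℝ) : ℝ :=
  ∑ a ∈ nodeIdx k N, ∑ b ∈ nodeIdx k N, c a b * theta k x y a b p

theorem comb_eq_cellSum {k N : ℕ} (hk : 1 ≤ k) {x y : ℕ → ℝ} (hx : IsMesh N x) (hy : IsMesh N y)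
    (c : ℕ × ℕ → ℕ × ℕ → ℝ) {l m : ℕ} (hl : l < N) (hm : m < N) {p : ℝ × ℝ}
    (h1 : p.1 ∈ Icc (x l) (x (l + 1))) (h2 : p.2 ∈ Icc (y m) (y (m + 1))) :
    comb k N x y c p = cellSum k (x l) (step x l) (fun s =>
      cellSum k (y m) (step y m) (fun t => c (locIdx k l s) (locIdx k m t)) p.2) p.1 := by
  rw [← sum_mul_hat hk hx hl (fun a =>
    cellSum k (y m) (step y m) (fun t => c a (locIdx k m t)) p.2) h1, comb]
  refine Finset.sum_congr rfl fun a _ => ?_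
  rw [← sum_mul_hat hk hy hm (c a) h2, Finset.sum_mul]
  refine Finset.sum_congr rfl fun b _ => ?_
  rw [theta]; ring

theorem comb_swap (k N : ℕ) (x y : ℕ → ℝ) (c : ℕ × ℕ → ℕ × ℕ → ℝ) (p : ℝ × ℝ) :
    comb k N x y c p = comb k N y x (fun a b => c b a) p.swap := by
  unfold comb
  rw [Finset.sum_comm]
  refine Finset.sum_congr rfl fun a _ => Finset.sum_congr rfl fun b _ => ?_
  simp only [theta, Prod.fst_swap, Prod.snd_swap]; ring

theorem comb_congr {k N : ℕ} {x y : ℕ → ℝ} {c d : ℕ × ℕ → ℕ × ℕ → ℝ}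
    (h : ∀ a ∈ nodeIdx k N, ∀ b ∈ nodeIdx k N, c a b = d a b) (p : ℝ × ℝ) :
    comb k N x y c p = comb k N x y d p :=
  Finset.sum_congr rfl fun a ha => Finset.sum_congr rfl fun b hb => by rw [h a ha b hb]

theorem comb_add (k N : ℕ) (x y : ℕ → ℝ) (c d : ℕ × ℕ → ℕ × ℕ → ℝ) (p : ℝ × ℝ) :
    comb k N x y (fun a b => c a b + d a b) p = comb k N x y c p + comb k N x y d p := by
  simp only [comb, add_mul, Finset.sum_add_distrib]

theorem comb_sub (k N : ℕ) (x y : ℕ → ℝ) (c d : ℕ × ℕ → ℕ × ℕ → ℝ) (p : ℝ × ℝ) :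
    comb k N x y (fun a b => c a b - d a b) p = comb k N x y c p - comb k N x y d p := by
  simp only [comb, sub_mul, Finset.sum_sub_distrib]

theorem lagrangeInterp_eq_comb (k N : ℕ) (x y : ℕ → ℝ) (v : ℝ × ℝ → ℝ) (p : ℝ × ℝ) :
    lagrangeInterp k N x y v p = comb k N x y (fun a b => v (node k x a, node k y b)) p := rfl

theorem comb_node {k N : ℕ} (hk : 1 ≤ k) {x y : ℕ → ℝ} (hx : IsMesh N x) (hy : IsMesh N y)
    (c : ℕ × ℕ → ℕ × ℕ → ℝ) {a b : ℕ × ℕ} (ha : a ∈ nodeIdx k N) (hb : b ∈ nodeIdx k N) :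
    comb k N x y c (node k x a, node k y b) = c a b := by
  unfold comb
  rw [Finset.sum_eq_single_of_mem a ha, Finset.sum_eq_single_of_mem b hb]
  · simp [theta, hat_node hk hx ha ha, hat_node hk hy hb hb]
  · intro b' hb' hne
    simp [theta, hat_node hk hy hb' hb, hne]
  · intro a' ha' hne
    refine Finset.sum_eq_zero fun b' _ => ?_
    simp [theta, hat_node hk hx ha' ha, hne]

/-- At the abscissa of `a` every other hat in `x` vanishes, so nodal values that are zero along this
line give zero on all of it, not only at the nodes. -/
theorem comb_eq_zero_left {k N : ℕ} (hk : 1 ≤ k) {x y : ℕ → ℝ} (hx : IsMesh N x)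
    {c : ℕ × ℕ → ℕ × ℕ → ℝ} {a : ℕ × ℕ} (ha : a ∈ nodeIdx k N) {p : ℝ × ℝ}
    (hp : p.1 = node k x a) (hc : ∀ b ∈ nodeIdx k N, c a b = 0) : comb k N x y c p = 0 := by
  refine Finset.sum_eq_zero fun a' ha' => Finset.sum_eq_zero fun b hb => ?_
  rw [theta, hp, hat_node hk hx ha' ha]
  split_ifs with h
  · rw [h, hc b hb, zero_mul]
  · simp

theorem comb_eq_zero_right {k N : ℕ} (hk : 1 ≤ k) {x y : ℕ → ℝ} (hy : IsMesh N y)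
    {c : ℕ × ℕ → ℕ × ℕ → ℝ} {b : ℕ × ℕ} (hb : b ∈ nodeIdx k N) {p : ℝ × ℝ}
    (hp : p.2 = node k y b) (hc : ∀ a ∈ nodeIdx k N, c a b = 0) : comb k N x y c p = 0 := by
  rw [comb_swap]
  exact comb_eq_zero_left hk hy hb hp hc

theorem continuousOn_comb {k N : ℕ} (hk : 1 ≤ k) {x y : ℕ → ℝ} (hx : IsMesh N x) (hy : IsMesh N y)
    (c : ℕ × ℕ → ℕ × ℕ → ℝ) : ContinuousOn (comb k N x y c) closedSquare := by
  unfold comb theta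
  refine continuousOn_finsetSum _ fun a ha => continuousOn_finsetSum _ fun b hb => ?_
  refine continuousOn_const.mul (ContinuousOn.mul ?_ ?_)
  · exact (continuousOn_hat hk hx ha).comp continuousOn_fst fun p hp => hp.1
  · exact (continuousOn_hat hk hy hb).comp continuousOn_snd fun p hp => hp.2

theorem natDegree_lagrangePoly {k : ℕ} (hk : 1 ≤ k) {s : ℕ} (hs : s ≤ k) :
    (lagrangePoly k s).natDegree ≤ k := by
  have := Lagrange.degree_basis (injOn_div_nat hk (Finset.range (k + 1) : Set ℕ))
    (Finset.mem_range.2 (Nat.lt_succ_of_le hs))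
  refine Polynomial.natDegree_le_of_degree_le ?_
  unfold lagrangePoly
  rw [this]
  simp

/-- A `cellSum` is a polynomial of degree at most `k`, with coefficients linear in `c`. -/
theorem exists_cellSum_coeff {k : ℕ} (hk : 1 ≤ k) (a h : ℝ) : ∃ e : ℕ → ℕ → ℝ,
    ∀ (c : ℕ → ℝ) (ξ : ℝ), cellSum k a h c ξ
      = ∑ r ∈ Finset.range (k + 1), (∑ s ∈ Finset.range (k + 1), c s * e s r) * ξ ^ r := by
  set P : ℕ → Polynomial ℝ := fun s =>
    (lagrangePoly k s).comp (Polynomial.C h⁻¹ * (Polynomial.X - Polynomial.C a)) with hP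
  refine ⟨fun s r => (P s).coeff r, fun c ξ => ?_⟩
  have hdeg : ∀ s ≤ k, (P s).natDegree < k + 1 := fun s hs => by
    refine Nat.lt_succ_of_le (Polynomial.natDegree_comp_le.trans ?_)
    have h1 : (Polynomial.C h⁻¹ * (Polynomial.X - Polynomial.C a)).natDegree ≤ 1 := by
      compute_degree
    have h2 := natDegree_lagrangePoly hk hs
    nlinarith
  unfold cellSum
  simp only [Finset.sum_mul]
  rw [Finset.sum_comm]
  refine Finset.sum_congr rfl fun s hs => ?_
  have hs' : s ≤ k := by have := Finset.mem_range.1 hs; omega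
  have : (lagrangePoly k s).eval ((ξ - a) / h) = (P s).eval ξ := by
    rw [hP, Polynomial.eval_comp]
    congr 1
    simp only [Polynomial.eval_mul, Polynomial.eval_C, Polynomial.eval_sub, Polynomial.eval_X]
    ring
  rw [this, Polynomial.eval_eq_sum_range' (hdeg s hs'), Finset.mul_sum]
  exact Finset.sum_congr rfl fun r _ => by ring

theorem memVN_comb {k N : ℕ} (hk : 1 ≤ k) {x y : ℕ → ℝ} (hx : IsMesh N x) (hy : IsMesh N y)
    {c : ℕ × ℕ → ℕ × ℕ → ℝ}
    (h1 : ∀ b ∈ nodeIdx k N, c (0, 0) b = 0) (h2 : ∀ b ∈ nodeIdx k N, c (N, 0) b = 0)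
    (h3 : ∀ a ∈ nodeIdx k N, c a (0, 0) = 0) (h4 : ∀ a ∈ nodeIdx k N, c a (N, 0) = 0) :
    MemVN k N x y (comb k N x y c) := by
  have hN := hx.one_le
  have z : ((0, 0) : ℕ × ℕ) ∈ nodeIdx k N := mem_nodeIdx.2 (Or.inr ⟨by simp; omega, by simp; omega⟩)
  have w : ((N, 0) : ℕ × ℕ) ∈ nodeIdx k N := mem_nodeIdx.2 (Or.inl rfl)
  refine ⟨continuousOn_comb hk hx hy c, ?_, ?_⟩
  · rintro ⟨s, t⟩ ⟨⟨hs, ht⟩, hno⟩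
    simp only at hs ht
    have : s = 0 ∨ s = 1 ∨ t = 0 ∨ t = 1 := by
      by_contra hcon
      push Not at hcon
      exact hno ⟨⟨lt_of_le_of_ne hs.1 (Ne.symm hcon.1), lt_of_le_of_ne hs.2 hcon.2.1⟩,
        ⟨lt_of_le_of_ne ht.1 (Ne.symm hcon.2.2.1), lt_of_le_of_ne ht.2 hcon.2.2.2⟩⟩
    rcases this with h | h | h | h
    · exact comb_eq_zero_left hk hx z (by simp [node, hx.zero, h]) h1
    · exact comb_eq_zero_left hk hx w (by simp [node, hx.last, h]) h2
    · exact comb_eq_zero_right hk hy z (by simp [node, hy.zero, h]) h3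
    · exact comb_eq_zero_right hk hy w (by simp [node, hy.last, h]) h4
  · intro l hl m hm
    obtain ⟨e, he⟩ := exists_cellSum_coeff hk (x l) (step x l)
    obtain ⟨f, hf⟩ := exists_cellSum_coeff hk (y m) (step y m)
    refine ⟨fun r r' => ∑ s ∈ Finset.range (k + 1), (∑ t ∈ Finset.range (k + 1),
      c (locIdx k l s) (locIdx k m t) * f t r') * e s r, fun p hp => ?_⟩
    rw [comb_eq_cellSum hk hx hy c hl hm hp.1 hp.2, he]
    simp only [hf]
    refine Finset.sum_congr rfl fun r _ => ?_
    simp only [Finset.sum_mul]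
    rw [Finset.sum_comm]
    refine Finset.sum_congr rfl fun r' _ => Finset.sum_congr rfl fun s _ =>
      Finset.sum_congr rfl fun t _ => ?_
    ring

/-! ### Partial derivatives on the closed square. -/

/-- `d i j`, `i + j ≤ n`, are the successive partial derivatives of `d 0 0` on the closed square. -/
structure IsJet (n : ℕ) (d : ℕ → ℕ → ℝ × ℝ → ℝ) : Prop where
  deriv_x : ∀ i j, i + j < n → ∀ s ∈ Icc (0 : ℝ) 1, ∀ t ∈ Icc (0 : ℝ) 1,
    HasDerivWithinAt (fun s => d i j (s, t)) (d (i + 1) j (s, t)) (Icc 0 1) s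
  deriv_y : ∀ i j, i + j < n → ∀ s ∈ Icc (0 : ℝ) 1, ∀ t ∈ Icc (0 : ℝ) 1,
    HasDerivWithinAt (fun t => d i j (s, t)) (d i (j + 1) (s, t)) (Icc 0 1) t

/-- Jets are symmetric in the two variables, unlike the iterates `Dx^[i] (Dy^[j] v)`; this allows
each estimate to be proved for `x` only. -/
theorem IsJet.swap {n : ℕ} {d : ℕ → ℕ → ℝ × ℝ → ℝ} (hd : IsJet n d) :
    IsJet n (fun i j p => d j i p.swap) :=
  ⟨fun i j hij s hs t ht => hd.deriv_y j i (by omega) t ht s hs,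
    fun i j hij s hs t ht => hd.deriv_x j i (by omega) t ht s hs⟩

theorem uniqueDiffOn_closedSquare : UniqueDiffOn ℝ closedSquare :=
  (uniqueDiffOn_Icc zero_lt_one).prod (uniqueDiffOn_Icc zero_lt_one)

theorem hasDerivWithinAt_fst {v : ℝ × ℝ → ℝ} {p : ℝ × ℝ}
    (hv : DifferentiableWithinAt ℝ v closedSquare p) (hp : p ∈ closedSquare) :
    HasDerivWithinAt (fun t => v (t, p.2)) (fderivWithin ℝ v closedSquare p (1, 0)) (Icc 0 1) p.1 := by
  have h1 : HasDerivWithinAt (fun t : ℝ => (t, p.2)) ((1 : ℝ), (0 : ℝ)) (Icc 0 1) p.1 :=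
    (hasDerivWithinAt_id _ _).prodMk (hasDerivWithinAt_const _ _ _)
  exact HasFDerivWithinAt.comp_hasDerivWithinAt (t := closedSquare) p.1
    (f := fun t : ℝ => (t, p.2)) hv.hasFDerivWithinAt h1 (fun t ht => ⟨ht, hp.2⟩)

theorem hasDerivWithinAt_snd {v : ℝ × ℝ → ℝ} {p : ℝ × ℝ}
    (hv : DifferentiableWithinAt ℝ v closedSquare p) (hp : p ∈ closedSquare) :
    HasDerivWithinAt (fun t => v (p.1, t)) (fderivWithin ℝ v closedSquare p (0, 1)) (Icc 0 1) p.2 := by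
  have h1 : HasDerivWithinAt (fun t : ℝ => (p.1, t)) ((0 : ℝ), (1 : ℝ)) (Icc 0 1) p.2 :=
    (hasDerivWithinAt_const _ _ _).prodMk (hasDerivWithinAt_id _ _)
  exact HasFDerivWithinAt.comp_hasDerivWithinAt (t := closedSquare) p.2
    (f := fun t : ℝ => (p.1, t)) hv.hasFDerivWithinAt h1 (fun t ht => ⟨hp.1, ht⟩)

theorem Dx_eq_fderivWithin {v : ℝ × ℝ → ℝ} {p : ℝ × ℝ}
    (hv : DifferentiableWithinAt ℝ v closedSquare p) (hp : p ∈ closedSquare) :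
    Dx v p = fderivWithin ℝ v closedSquare p (1, 0) :=
  (hasDerivWithinAt_fst hv hp).derivWithin (uniqueDiffOn_Icc zero_lt_one _ hp.1)

theorem Dy_eq_fderivWithin {v : ℝ × ℝ → ℝ} {p : ℝ × ℝ}
    (hv : DifferentiableWithinAt ℝ v closedSquare p) (hp : p ∈ closedSquare) :
    Dy v p = fderivWithin ℝ v closedSquare p (0, 1) :=
  (hasDerivWithinAt_snd hv hp).derivWithin (uniqueDiffOn_Icc zero_lt_one _ hp.2)

theorem contDiffOn_Dx {n : ℕ} {v : ℝ × ℝ → ℝ} (hv : ContDiffOn ℝ (n + 1 : ℕ) v closedSquare) :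
    ContDiffOn ℝ n (Dx v) closedSquare := by
  have h1 : ContDiffOn ℝ n (fderivWithin ℝ v closedSquare) closedSquare :=
    hv.fderivWithin uniqueDiffOn_closedSquare (by norm_cast)
  refine (h1.clm_apply (contDiffOn_const (c := ((1 : ℝ), (0 : ℝ))))).congr fun p hp => ?_
  exact Dx_eq_fderivWithin (hv.differentiableOn (by norm_cast) p hp) hp

theorem contDiffOn_Dy {n : ℕ} {v : ℝ × ℝ → ℝ} (hv : ContDiffOn ℝ (n + 1 : ℕ) v closedSquare) :
    ContDiffOn ℝ n (Dy v) closedSquare := by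
  have h1 : ContDiffOn ℝ n (fderivWithin ℝ v closedSquare) closedSquare :=
    hv.fderivWithin uniqueDiffOn_closedSquare (by norm_cast)
  refine (h1.clm_apply (contDiffOn_const (c := ((0 : ℝ), (1 : ℝ))))).congr fun p hp => ?_
  exact Dy_eq_fderivWithin (hv.differentiableOn (by norm_cast) p hp) hp

theorem eqOn_Dx {v w : ℝ × ℝ → ℝ} (h : EqOn v w closedSquare) : EqOn (Dx v) (Dx w) closedSquare :=
  fun p hp => derivWithin_congr (fun t ht => h (show (t, p.2) ∈ closedSquare from ⟨ht, hp.2⟩)) (h hp)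

theorem eqOn_Dx_iterate {v w : ℝ × ℝ → ℝ} (h : EqOn v w closedSquare) (i : ℕ) :
    EqOn (Dx^[i] v) (Dx^[i] w) closedSquare := by
  induction i generalizing v w with
  | zero => exact h
  | succ i ih => exact ih (eqOn_Dx h)

theorem mem_closure_interior_closedSquare {p : ℝ × ℝ} (hp : p ∈ closedSquare) :
    p ∈ closure (interior closedSquare) := by
  rw [closedSquare, interior_prod_eq, interior_Icc, closure_prod_eq, closure_Ioo zero_ne_one]
  exact hp

/-- Symmetry of the second derivative persists up to the boundary, because each point of the square
is a limit of interior points and derivatives within the square are unique. -/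
theorem Dy_Dx {v : ℝ × ℝ → ℝ} (hv : ContDiffOn ℝ 2 v closedSquare) :
    EqOn (Dy (Dx v)) (Dx (Dy v)) closedSquare := by
  intro p hp
  have hd : ∀ q ∈ closedSquare, DifferentiableWithinAt ℝ v closedSquare q :=
    fun q hq => hv.differentiableOn (by norm_num) q hq
  have h2 : ContDiffOn ℝ 1 (fderivWithin ℝ v closedSquare) closedSquare :=
    hv.fderivWithin uniqueDiffOn_closedSquare (by norm_num)
  have hdd := (h2.differentiableOn (by norm_num) p hp).hasFDerivWithinAt
  have key : ∀ e : ℝ × ℝ, HasFDerivWithinAt (fun q => fderivWithin ℝ v closedSquare q e)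
      ((fderivWithin ℝ (fderivWithin ℝ v closedSquare) closedSquare p).flip e) closedSquare p :=
    fun e => by simpa using hdd.clm_apply (hasFDerivWithinAt_const e p closedSquare)
  have hx : HasFDerivWithinAt (Dx v)
      ((fderivWithin ℝ (fderivWithin ℝ v closedSquare) closedSquare p).flip (1, 0)) closedSquare p :=
    (key (1, 0)).congr (fun q hq => Dx_eq_fderivWithin (hd q hq) hq) (Dx_eq_fderivWithin (hd p hp) hp)
  have hy : HasFDerivWithinAt (Dy v)
      ((fderivWithin ℝ (fderivWithin ℝ v closedSquare) closedSquare p).flip (0, 1)) closedSquare p :=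
    (key (0, 1)).congr (fun q hq => Dy_eq_fderivWithin (hd q hq) hq) (Dy_eq_fderivWithin (hd p hp) hp)
  have hsymm : IsSymmSndFDerivWithinAt ℝ v closedSquare p :=
    (hv p hp).isSymmSndFDerivWithinAt (by simp) uniqueDiffOn_closedSquare
      (mem_closure_interior_closedSquare hp) hp
  rw [Dy_eq_fderivWithin hx.differentiableWithinAt hp,
    Dx_eq_fderivWithin hy.differentiableWithinAt hp,
    hx.fderivWithin (uniqueDiffOn_closedSquare p hp),
    hy.fderivWithin (uniqueDiffOn_closedSquare p hp)]
  simp only [ContinuousLinearMap.flip_apply]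
  exact hsymm _ _

theorem Dy_Dx_iterate (i : ℕ) : ∀ {v : ℝ × ℝ → ℝ}, ContDiffOn ℝ (i + 1 : ℕ) v closedSquare →
    EqOn (Dy (Dx^[i] v)) (Dx^[i] (Dy v)) closedSquare := by
  induction i with
  | zero => intro v _ p _; rfl
  | succ i ih =>
    intro v hv p hp
    rw [Function.iterate_succ_apply, Function.iterate_succ_apply, ih (contDiffOn_Dx hv) hp]
    exact eqOn_Dx_iterate (Dy_Dx (hv.of_le (by norm_cast; omega))) i hp

theorem contDiffOn_Dx_iterate (i : ℕ) : ∀ {n : ℕ} {v : ℝ × ℝ → ℝ},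
    ContDiffOn ℝ (n + i : ℕ) v closedSquare → ContDiffOn ℝ n (Dx^[i] v) closedSquare := by
  induction i with
  | zero => intro n v hv; exact hv
  | succ i ih => intro n v hv; exact ih (contDiffOn_Dx hv)

theorem contDiffOn_Dy_iterate (i : ℕ) : ∀ {n : ℕ} {v : ℝ × ℝ → ℝ},
    ContDiffOn ℝ (n + i : ℕ) v closedSquare → ContDiffOn ℝ n (Dy^[i] v) closedSquare := by
  induction i with
  | zero => intro n v hv; exact hv
  | succ i ih => intro n v hv; exact ih (contDiffOn_Dy hv)

/-- An `x`-derivative just adds an outer `Dx`; a `y`-derivative has to be commuted past `Dx^[i]`. -/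
theorem isJet_of_contDiffOn {n : ℕ} {v : ℝ × ℝ → ℝ} (hv : ContDiffOn ℝ n v closedSquare) :
    IsJet n (fun i j => Dx^[i] (Dy^[j] v)) := by
  have hreg : ∀ i j, i + j < n → ContDiffOn ℝ 1 (Dx^[i] (Dy^[j] v)) closedSquare := by
    intro i j hij
    have := contDiffOn_Dx_iterate (n := 1) i (contDiffOn_Dy_iterate (n := 1 + i) j
      (hv.of_le (by norm_cast; omega)))
    exact_mod_cast this
  have hdiff : ∀ i j, i + j < n → ∀ p ∈ closedSquare,
      DifferentiableWithinAt ℝ (Dx^[i] (Dy^[j] v)) closedSquare p := fun i j hij p hp =>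
    (hreg i j hij).differentiableOn (by norm_num) p hp
  constructor
  · intro i j hij s hs t ht
    have hp : (s, t) ∈ closedSquare := ⟨hs, ht⟩
    have h := hasDerivWithinAt_fst (hdiff i j hij _ hp) hp
    rw [← Dx_eq_fderivWithin (hdiff i j hij _ hp) hp, ← Function.iterate_succ_apply' Dx] at h
    exact h
  · intro i j hij s hs t ht
    have hp : (s, t) ∈ closedSquare := ⟨hs, ht⟩
    have h := hasDerivWithinAt_snd (hdiff i j hij _ hp) hp
    rw [← Dy_eq_fderivWithin (hdiff i j hij _ hp) hp] at h
    have h2 : ContDiffOn ℝ (i + 1 : ℕ) (Dy^[j] v) closedSquare :=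
      contDiffOn_Dy_iterate (n := i + 1) j (hv.of_le (by norm_cast; omega))
    rw [Dy_Dx_iterate i h2 hp, ← Function.iterate_succ_apply' Dy] at h
    exact h

/-! ### Estimates on mesh rectangles. -/

/-- Bounds, on the open mesh rectangles, for a function and its partial derivatives. -/
structure CellBound (N : ℕ) (x y : ℕ → ℝ) (gx gy : ℕ → ℝ → ℝ) (e : ℝ × ℝ → ℝ) (K₀ K₁ : ℝ) :
    Prop where
  val : ∀ l < N, ∀ m < N, ∀ s ∈ Ioo (x l) (x (l + 1)), ∀ t ∈ Ioo (y m) (y (m + 1)),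
    |e (s, t)| ≤ K₀
  dx : ∀ l < N, ∀ m < N, ∀ s ∈ Ioo (x l) (x (l + 1)), ∀ t ∈ Ioo (y m) (y (m + 1)),
    ∃ D, HasDerivAt (fun s => e (s, t)) D s ∧ |D| ≤ K₁ * gx l s
  dy : ∀ l < N, ∀ m < N, ∀ s ∈ Ioo (x l) (x (l + 1)), ∀ t ∈ Ioo (y m) (y (m + 1)),
    ∃ D, HasDerivAt (fun t => e (s, t)) D t ∧ |D| ≤ K₁ * gy m t

namespace CellBound

variable {N : ℕ} {x y : ℕ → ℝ} {gx gy gx' gy' : ℕ → ℝ → ℝ} {e e' : ℝ × ℝ → ℝ} {K₀ K₁ K₀' K₁' : ℝ}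

theorem add (h : CellBound N x y gx gy e K₀ K₁) (h' : CellBound N x y gx gy e' K₀' K₁') :
    CellBound N x y gx gy (e + e') (K₀ + K₀') (K₁ + K₁') := by
  refine ⟨fun l hl m hm s hs t ht => ?_, fun l hl m hm s hs t ht => ?_,
    fun l hl m hm s hs t ht => ?_⟩
  · exact (abs_add_le _ _).trans (add_le_add (h.val l hl m hm s hs t ht) (h'.val l hl m hm s hs t ht))
  · obtain ⟨D, h1, h2⟩ := h.dx l hl m hm s hs t ht
    obtain ⟨D', h1', h2'⟩ := h'.dx l hl m hm s hs t ht
    refine ⟨D + D', h1.add h1', (abs_add_le _ _).trans ?_⟩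
    rw [add_mul]; exact add_le_add h2 h2'
  · obtain ⟨D, h1, h2⟩ := h.dy l hl m hm s hs t ht
    obtain ⟨D', h1', h2'⟩ := h'.dy l hl m hm s hs t ht
    refine ⟨D + D', h1.add h1', (abs_add_le _ _).trans ?_⟩
    rw [add_mul]; exact add_le_add h2 h2'

theorem mono (h : CellBound N x y gx gy e K₀ K₁) (hK₀ : K₀ ≤ K₀') (hK₁ : 0 ≤ K₁) (hK : K₁ ≤ K₁')
    (hgx0 : ∀ l < N, ∀ s ∈ Ioo (x l) (x (l + 1)), 0 ≤ gx l s)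
    (hgy0 : ∀ m < N, ∀ t ∈ Ioo (y m) (y (m + 1)), 0 ≤ gy m t)
    (hgx : ∀ l < N, ∀ s ∈ Ioo (x l) (x (l + 1)), gx l s ≤ gx' l s)
    (hgy : ∀ m < N, ∀ t ∈ Ioo (y m) (y (m + 1)), gy m t ≤ gy' m t) :
    CellBound N x y gx' gy' e K₀' K₁' := by
  refine ⟨fun l hl m hm s hs t ht => (h.val l hl m hm s hs t ht).trans hK₀,
    fun l hl m hm s hs t ht => ?_, fun l hl m hm s hs t ht => ?_⟩
  · obtain ⟨D, h1, h2⟩ := h.dx l hl m hm s hs t ht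
    exact ⟨D, h1, h2.trans (mul_le_mul hK (hgx l hl s hs) (hgx0 l hl s hs) (hK₁.trans hK))⟩
  · obtain ⟨D, h1, h2⟩ := h.dy l hl m hm s hs t ht
    exact ⟨D, h1, h2.trans (mul_le_mul hK (hgy m hm t ht) (hgy0 m hm t ht) (hK₁.trans hK))⟩

theorem congr (h : CellBound N x y gx gy e K₀ K₁) (hx : IsMesh N x) (hy : IsMesh N y)
    (he : ∀ p ∈ closedSquare, e' p = e p) : CellBound N x y gx gy e' K₀ K₁ := by
  have hmem : ∀ l < N, ∀ m < N, ∀ s ∈ Ioo (x l) (x (l + 1)), ∀ t ∈ Ioo (y m) (y (m + 1)),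
      e' (s, t) = e (s, t) := fun l hl m hm s hs t ht => he _
    ⟨hx.Icc_subset hl (Ioo_subset_Icc_self hs), hy.Icc_subset hm (Ioo_subset_Icc_self ht)⟩
  refine ⟨fun l hl m hm s hs t ht => ?_, fun l hl m hm s hs t ht => ?_,
    fun l hl m hm s hs t ht => ?_⟩
  · rw [hmem l hl m hm s hs t ht]; exact h.val l hl m hm s hs t ht
  · obtain ⟨D, h1, h2⟩ := h.dx l hl m hm s hs t ht
    refine ⟨D, h1.congr_of_eventuallyEq ?_, h2⟩
    filter_upwards [isOpen_Ioo.mem_nhds hs] with s hs using hmem l hl m hm s hs t ht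
  · obtain ⟨D, h1, h2⟩ := h.dy l hl m hm s hs t ht
    refine ⟨D, h1.congr_of_eventuallyEq ?_, h2⟩
    filter_upwards [isOpen_Ioo.mem_nhds ht] with t ht using hmem l hl m hm s hs t ht

end CellBound

theorem interp_eq_cellSum {k N : ℕ} (hk : 1 ≤ k) {x y : ℕ → ℝ} (hx : IsMesh N x) (hy : IsMesh N y)
    (v : ℝ × ℝ → ℝ) {l m : ℕ} (hl : l < N) (hm : m < N) {s t : ℝ}
    (hs : s ∈ Icc (x l) (x (l + 1))) (ht : t ∈ Icc (y m) (y (m + 1))) :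
    lagrangeInterp k N x y v (s, t) = cellSum k (x l) (step x l) (fun i =>
      cellSum k (y m) (step y m)
        (fun j => v (x l + i / k * step x l, y m + j / k * step y m)) t) s := by
  rw [lagrangeInterp_eq_comb, comb_eq_cellSum hk hx hy _ hl hm (p := (s, t)) hs ht]
  unfold cellSum
  refine Finset.sum_congr rfl fun i hi => ?_
  congr 1
  refine Finset.sum_congr rfl fun j hj => ?_
  dsimp only
  rw [node_locIdx hk x l (Nat.lt_succ_iff.1 (Finset.mem_range.1 hi)),
    node_locIdx hk y m (Nat.lt_succ_iff.1 (Finset.mem_range.1 hj))]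

section

variable {k N : ℕ} {x y : ℕ → ℝ} {A B gx gy : ℕ → ℝ → ℝ} {Cx Cy Λ M : ℝ}
  {d : ℕ → ℕ → ℝ × ℝ → ℝ}

/-- The value and the `x`-derivative of the interpolation error. -/
theorem interp_error_dx (hk : 1 ≤ k) (hN : 1 ≤ N) (hx : IsMesh N x) (hy : IsMesh N y)
    (hΛ : ∀ (a h K : ℝ) (c : ℕ → ℝ), 0 < h →
      (∀ s ≤ k, |c s| ≤ K) → ∀ ξ ∈ Icc a (a + h),
      |cellSum k a h c ξ| ≤ Λ * K ∧ |cellSumDeriv k a h c ξ| ≤ Λ * K / h)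
    (hCy : 0 ≤ Cy)
    (hA : WeightBound k N x A gx Cx) (hB : WeightBound k N y B gy Cy) (hM : 0 ≤ M)
    (hd : IsJet (k + 1) d)
    (hb : ∀ i j, i + j ≤ k + 1 → ∀ p ∈ closedSquare, |d i j p| ≤ M * (A i p.1 * B j p.2))
    {l m : ℕ} (hl : l < N) (hm : m < N) {s t : ℝ}
    (hs : s ∈ Ioo (x l) (x (l + 1))) (ht : t ∈ Ioo (y m) (y (m + 1))) :
    |d 0 0 (s, t) - lagrangeInterp k N x y (d 0 0) (s, t)| ≤ (Cx + Λ * Cy) * M / N ^ (k + 1) ∧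
    ∃ D, HasDerivAt (fun s => d 0 0 (s, t) - lagrangeInterp k N x y (d 0 0) (s, t)) D s ∧
      |D| ≤ (Cx + Cx * Cy) * M / N ^ k * gx l s := by
  have hNpos : (0 : ℝ) < N := by exact_mod_cast hN
  have hN1 : (1 : ℝ) ≤ N := by exact_mod_cast hN
  have hsx := hx.step_pos hl.le
  have hsy := hy.step_pos hm.le
  have ex : x l + step x l = x (l + 1) := by simp [step]
  have ey : y m + step y m = y (m + 1) := by simp [step]
  have hIx : Icc (x l) (x l + step x l) ⊆ Icc 0 1 := ex ▸ hx.Icc_subset hl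
  have hIy : Icc (y m) (y m + step y m) ⊆ Icc 0 1 := ey ▸ hy.Icc_subset hm
  have hsI : s ∈ Icc (x l) (x l + step x l) := ex ▸ Ioo_subset_Icc_self hs
  have htI : t ∈ Icc (y m) (y m + step y m) := ey ▸ Ioo_subset_Icc_self ht
  have hnode : ∀ j ≤ k, y m + (j : ℝ) / k * step y m ∈ Icc (0 : ℝ) 1 := fun j hj =>
    hIy (nodes_mem_Icc hk hsy hj)
  -- the error of the interpolation in `y`, and its `x`-derivative
  set w : ℕ → ℝ → ℝ := fun i s => d i 0 (s, t)
    - cellSum k (y m) (step y m) (fun j => d i 0 (s, y m + j / k * step y m)) t with hw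
  have hg1 : IsChain (x l) (step x l) (k + 1) (fun i s => d i 0 (s, t)) := fun i hi s hs =>
    (hd.deriv_x i 0 (by omega) s (hIx hs) t (hIy htI)).mono hIx
  have hb1 : ∀ i ≤ k + 1, ∀ s ∈ Icc (x l) (x l + step x l), |d i 0 (s, t)| ≤ M * A i s := by
    intro i hi s hs
    refine (hb i 0 (by omega) (s, t) ⟨hIx hs, hIy htI⟩).trans ?_
    have h1 := hB.zero_le_one t (hIy htI).1
    have h2 := hA.nonneg i s
    exact mul_le_mul_of_nonneg_left (mul_le_of_le_one_right h2 h1) hM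
  -- Here `s` is frozen, and the weight in `x` goes into the constant of the one-dimensional
  -- estimate in `y`.
  have hw0 : ∀ s ∈ Icc (x l) (x l + step x l), |w 0 s| ≤ Cy * (M * A 0 s) / N ^ (k + 1) := by
    intro s hs
    have hKs : 0 ≤ M * A 0 s := mul_nonneg hM (hA.nonneg 0 s)
    refine hB.error m hm (k + 1) (Or.inr rfl) (M * A 0 s) (fun j t => d 0 j (s, t)) hKs ?_ ?_ t htI
    · exact fun j hj t ht => (hd.deriv_y 0 j (by omega) s (hIx hs) t (hIy ht)).mono hIy
    · intro j hj t ht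
      rw [mul_assoc]
      exact hb 0 j (by omega) (s, t) ⟨hIx hs, hIy ht⟩
  -- One derivative is spent on `x`, so only `k` remain for `y`; this is why `WeightBound.error`
  -- admits `n = k`.
  have hw1 : ∀ s ∈ Icc (x l) (x l + step x l), |w 1 s| ≤ Cy * (M * A 1 s) / N ^ k := by
    intro s hs
    have hKs : 0 ≤ M * A 1 s := mul_nonneg hM (hA.nonneg 1 s)
    refine hB.error m hm k (Or.inl rfl) (M * A 1 s) (fun j t => d 1 j (s, t)) hKs ?_ ?_ t htI
    · exact fun j hj t ht => (hd.deriv_y 1 j (by omega) s (hIx hs) t (hIy ht)).mono hIy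
    · intro j hj t ht
      rw [mul_assoc]
      exact hb 1 j (by omega) (s, t) ⟨hIx hs, hIy ht⟩
  have hwb : ∀ i ≤ 1, ∀ s ∈ Icc (x l) (x l + step x l), |w i s| ≤ Cy * M / N ^ k * A i s := by
    intro i hi s hs
    rcases (by omega : i = 0 ∨ i = 1) with rfl | rfl
    · refine (hw0 s hs).trans ?_
      have h2 := hA.nonneg 0 s
      calc Cy * (M * A 0 s) / N ^ (k + 1) ≤ Cy * (M * A 0 s) / N ^ k := by
            gcongr; omega
        _ = _ := by ring
    · exact (hw1 s hs).trans (le_of_eq (by ring))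
  -- Interpolation in `y` at fixed nodes commutes with differentiation in `x`.
  have hwc : IsChain (x l) (step x l) 1 w := by
    intro i hi s hs
    obtain rfl : i = 0 := by omega
    refine ((hd.deriv_x 0 0 (by omega) s (hIx hs) t (hIy htI)).mono hIx).sub ?_
    unfold cellSum
    refine HasDerivWithinAt.fun_sum fun j hj => HasDerivWithinAt.mul_const ?_ _
    exact (hd.deriv_x 0 0 (by omega) s (hIx hs) _
      (hnode j (Nat.lt_succ_iff.1 (Finset.mem_range.1 hj)))).mono hIx
  -- `v - I_x I_y v = (v - I_x v) + I_x (v - I_y v)`.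
  have hrep : ∀ s ∈ Icc (x l) (x l + step x l),
      d 0 0 (s, t) - lagrangeInterp k N x y (d 0 0) (s, t)
        = (d 0 0 (s, t) - cellSum k (x l) (step x l) (fun i => d 0 0 (x l + i / k * step x l, t)) s)
          + cellSum k (x l) (step x l) (fun i => w 0 (x l + i / k * step x l)) s := by
    intro s hs
    rw [interp_eq_cellSum hk hx hy _ hl hm (ex ▸ hs) (ey ▸ htI), hw, cellSum_sub]
    ring
  have hval1 := hA.error l hl (k + 1) (Or.inr rfl) M _ hM hg1 hb1 s hsI
  have hder1 := hA.deriv_error l hl M _ hM hg1 hb1 s hsI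
  have hder2 := hA.deriv_stable l hl (Cy * M / N ^ k) w (by positivity) hwc hwb s hsI
  have hval2 := (hΛ (x l) (step x l) (Cy * M / N ^ (k + 1))
    (fun i => w 0 (x l + i / k * step x l)) hsx (fun i hi => by
      have hmem := nodes_mem_Icc hk (a := x l) hsx hi
      refine (hw0 _ hmem).trans ?_
      have h1 := hA.zero_le_one _ (hIx hmem).1
      have h2 := hA.nonneg 0 (x l + (i : ℝ) / k * step x l)
      gcongr
      exact mul_le_of_le_one_right hM h1) s hsI).1
  constructor
  · rw [hrep s hsI]
    refine (abs_add_le _ _).trans ((add_le_add hval1 hval2).trans (le_of_eq ?_))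
    ring
  · have hd0 : HasDerivAt (fun s => d 0 0 (s, t)) (d 1 0 (s, t)) s :=
      (hd.deriv_x 0 0 (by omega) s (hIx hsI) t (hIy htI)).hasDerivAt
        (Filter.mem_of_superset (isOpen_Ioo.mem_nhds hs)
          (Ioo_subset_Icc_self.trans (hx.Icc_subset hl)))
    have h1 := (hd0.sub (hasDerivAt_cellSum k (x l) (step x l)
      (fun i => d 0 0 (x l + i / k * step x l, t)) s)).add
      (hasDerivAt_cellSum k (x l) (step x l) (fun i => w 0 (x l + i / k * step x l)) s)
    refine ⟨_, h1.congr_of_eventuallyEq ?_, ?_⟩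
    · filter_upwards [isOpen_Ioo.mem_nhds hs] with s hs
      exact hrep s (ex ▸ Ioo_subset_Icc_self hs)
    · refine (abs_add_le _ _).trans ((add_le_add hder1 hder2).trans (le_of_eq ?_))
      ring

theorem interp_cellBound (hk : 1 ≤ k) (hN : 1 ≤ N) (hx : IsMesh N x) (hy : IsMesh N y)
    (hΛ : ∀ (a h K : ℝ) (c : ℕ → ℝ), 0 < h →
      (∀ s ≤ k, |c s| ≤ K) → ∀ ξ ∈ Icc a (a + h),
      |cellSum k a h c ξ| ≤ Λ * K ∧ |cellSumDeriv k a h c ξ| ≤ Λ * K / h)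
    (hCx : 0 ≤ Cx) (hCy : 0 ≤ Cy)
    (hA : WeightBound k N x A gx Cx) (hB : WeightBound k N y B gy Cy) (hM : 0 ≤ M)
    (hd : IsJet (k + 1) d)
    (hb : ∀ i j, i + j ≤ k + 1 → ∀ p ∈ closedSquare, |d i j p| ≤ M * (A i p.1 * B j p.2)) :
    CellBound N x y gx gy (d 0 0 - lagrangeInterp k N x y (d 0 0))
      ((Cx + Λ * Cy) * M / N ^ (k + 1)) ((Cx + Cy + Cx * Cy) * M / N ^ k) := by
  refine ⟨fun l hl m hm s hs t ht => ?_, fun l hl m hm s hs t ht => ?_,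
    fun l hl m hm s hs t ht => ?_⟩
  · exact (interp_error_dx hk hN hx hy hΛ hCy hA hB hM hd hb hl hm hs ht).1
  · obtain ⟨D, h1, h2⟩ := (interp_error_dx hk hN hx hy hΛ hCy hA hB hM hd hb hl hm hs ht).2
    refine ⟨D, h1, h2.trans ?_⟩
    have := hA.gam_nonneg l hl s
    gcongr
    linarith
  -- The `y`-derivative is the same estimate with the two variables exchanged.
  · have hb' : ∀ i j, i + j ≤ k + 1 → ∀ p ∈ closedSquare,
        |(fun i j (p : ℝ × ℝ) => d j i p.swap) i j p| ≤ M * (B i p.1 * A j p.2) := by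
      intro i j hij p hp
      rw [mul_comm (B i p.1)]
      exact hb j i (by omega) p.swap ⟨hp.2, hp.1⟩
    obtain ⟨D, h1, h2⟩ :=
      (interp_error_dx hk hN hy hx hΛ hCx hB hA hM hd.swap hb' hm hl ht hs).2
    refine ⟨D, ?_, h2.trans ?_⟩
    · convert h1 using 2 with t
      simp only [Pi.sub_apply, lagrangeInterp_eq_comb, comb_swap k N y x, Prod.swap_prod_mk]
    · have := hB.gam_nonneg m hm t
      have : Cy + Cy * Cx ≤ Cx + Cy + Cx * Cy := by rw [mul_comm Cy Cx]; linarith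
      gcongr

/-- Inverse estimate for a finite element function. -/
theorem comb_cellBound (hk : 1 ≤ k) (hN : 1 ≤ N) (hx : IsMesh N x) (hy : IsMesh N y)
    (hΛ : ∀ (a h K : ℝ) (c : ℕ → ℝ), 0 < h →
      (∀ s ≤ k, |c s| ≤ K) → ∀ ξ ∈ Icc a (a + h),
      |cellSum k a h c ξ| ≤ Λ * K ∧ |cellSumDeriv k a h c ξ| ≤ Λ * K / h)
    (hΛ0 : 0 ≤ Λ) {K : ℝ} (hK : 0 ≤ K)
    (hgx : ∀ l < N, ∀ ξ, 1 / (N * step x l) ≤ gx l ξ)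
    (hgy : ∀ l < N, ∀ ξ, 1 / (N * step y l) ≤ gy l ξ)
    {c : ℕ × ℕ → ℕ × ℕ → ℝ} (hc : ∀ a ∈ nodeIdx k N, ∀ b ∈ nodeIdx k N, |c a b| ≤ K) :
    CellBound N x y gx gy (comb k N x y c) (Λ * (Λ * K)) (Λ * (Λ * K) * N) := by
  have hNpos : (0 : ℝ) < N := by exact_mod_cast hN
  have key : ∀ {x y : ℕ → ℝ}, IsMesh N x → IsMesh N y → ∀ {gx : ℕ → ℝ → ℝ},
      (∀ l < N, ∀ ξ, 1 / (N * step x l) ≤ gx l ξ) → ∀ {c : ℕ × ℕ → ℕ × ℕ → ℝ},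
      (∀ a ∈ nodeIdx k N, ∀ b ∈ nodeIdx k N, |c a b| ≤ K) → ∀ l < N, ∀ m < N,
      ∀ s ∈ Ioo (x l) (x (l + 1)), ∀ t ∈ Ioo (y m) (y (m + 1)),
      |comb k N x y c (s, t)| ≤ Λ * (Λ * K) ∧
      ∃ D, HasDerivAt (fun s => comb k N x y c (s, t)) D s ∧ |D| ≤ Λ * (Λ * K) * N * gx l s := by
    intro x y hx hy gx hgx c hc l hl m hm s hs t ht
    have hsx := hx.step_pos hl.le
    have hsy := hy.step_pos hm.le
    have ex : x l + step x l = x (l + 1) := by simp [step]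
    have ey : y m + step y m = y (m + 1) := by simp [step]
    have h1 : ∀ i ≤ k, |cellSum k (y m) (step y m) (fun j => c (locIdx k l i) (locIdx k m j)) t|
        ≤ Λ * K := fun i _ =>
      (hΛ _ _ K _ hsy (fun j _ => hc _ (locIdx_mem hk hl) _ (locIdx_mem hk hm)) t
        (ey ▸ Ioo_subset_Icc_self ht)).1
    have h2 := hΛ _ _ (Λ * K) _ hsx h1 s (ex ▸ Ioo_subset_Icc_self hs)
    have hrep : ∀ s ∈ Icc (x l) (x (l + 1)), comb k N x y c (s, t)
        = cellSum k (x l) (step x l) (fun i => cellSum k (y m) (step y m)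
          (fun j => c (locIdx k l i) (locIdx k m j)) t) s := fun s hs =>
      comb_eq_cellSum hk hx hy c hl hm (p := (s, t)) hs (Ioo_subset_Icc_self ht)
    refine ⟨?_, _, (hasDerivAt_cellSum k (x l) (step x l) _ s).congr_of_eventuallyEq ?_,
      h2.2.trans ?_⟩
    · rw [hrep s (Ioo_subset_Icc_self hs)]; exact h2.1
    · filter_upwards [isOpen_Ioo.mem_nhds hs] with s hs using hrep s (Ioo_subset_Icc_self hs)
    · calc Λ * (Λ * K) / step x l = Λ * (Λ * K) * N * (1 / (N * step x l)) := by field_simp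
        _ ≤ _ := by gcongr; exact hgx l hl s
  refine ⟨fun l hl m hm s hs t ht => (key hx hy hgx hc l hl m hm s hs t ht).1,
    fun l hl m hm s hs t ht => (key hx hy hgx hc l hl m hm s hs t ht).2,
    fun l hl m hm s hs t ht => ?_⟩
  obtain ⟨D, h1, h2⟩ := (key hy hx hgy (c := fun a b => c b a) (fun a ha b hb => hc b hb a ha)
    m hm l hl t ht s hs).2
  refine ⟨D, ?_, h2⟩
  convert h1 using 2 with t
  rw [comb_swap, Prod.swap_prod_mk]

end

/-! ### From pointwise bounds to norms. -/

theorem IsMesh.exists_mem_Ioo {N : ℕ} {x : ℕ → ℝ} (hx : IsMesh N x) {ξ : ℝ}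
    (hξ : ξ ∈ Icc (0 : ℝ) 1) (hne : ξ ∉ range x) : ∃ l < N, ξ ∈ Ioo (x l) (x (l + 1)) := by
  obtain ⟨l, hl, h⟩ := hx.exists_mem_Icc hξ
  exact ⟨l, hl, lt_of_le_of_ne h.1 fun h' => hne ⟨l, h'⟩,
    lt_of_le_of_ne h.2 fun h' => hne ⟨l + 1, h'.symm⟩⟩

theorem volume_restrict_openSquare : (volume.restrict openSquare : Measure (ℝ × ℝ))
    = (volume.restrict (Ioo (0 : ℝ) 1)).prod (volume.restrict (Ioo (0 : ℝ) 1)) := by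
  rw [Measure.prod_restrict, ← Measure.volume_eq_prod]; rfl

theorem ae_mem_cell {N : ℕ} {x y : ℕ → ℝ} (hx : IsMesh N x) (hy : IsMesh N y) :
    ∀ᵐ p ∂(volume.restrict openSquare), p ∈ openSquare ∧ (∃ l < N, p.1 ∈ Ioo (x l) (x (l + 1))) ∧
      ∃ m < N, p.2 ∈ Ioo (y m) (y (m + 1)) := by
  have h0 : ∀ᵐ p ∂(volume.restrict openSquare : Measure (ℝ × ℝ)), p ∈ openSquare :=
    ae_restrict_mem (measurableSet_Ioo.prod measurableSet_Ioo)
  have h1 : ∀ᵐ p : ℝ × ℝ ∂(volume.restrict openSquare), p.1 ∉ range x := by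
    refine ae_restrict_of_ae ?_
    rw [Measure.volume_eq_prod]
    exact Measure.quasiMeasurePreserving_fst.ae ((countable_range x).ae_notMem volume)
  have h2 : ∀ᵐ p : ℝ × ℝ ∂(volume.restrict openSquare), p.2 ∉ range y := by
    refine ae_restrict_of_ae ?_
    rw [Measure.volume_eq_prod]
    exact Measure.quasiMeasurePreserving_snd.ae ((countable_range y).ae_notMem volume)
  filter_upwards [h0, h1, h2] with p hp hp1 hp2
  exact ⟨hp, hx.exists_mem_Ioo (Ioo_subset_Icc_self hp.1) hp1,
    hy.exists_mem_Ioo (Ioo_subset_Icc_self hp.2) hp2⟩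

theorem normL2_sq (v : ℝ × ℝ → ℝ) :
    normL2 v ^ 2 = ∫⁻ p in openSquare, ‖v p‖ₑ ^ 2 := by
  rw [normL2, eLpNorm_eq_lintegral_rpow_enorm_toReal (by norm_num) (by norm_num),
    ← ENNReal.rpow_natCast, ← ENNReal.rpow_mul]
  norm_num

theorem volume_openSquare : volume openSquare = 1 := by
  rw [openSquare, Measure.volume_eq_prod, Measure.prod_prod]
  simp

theorem lintegral_fst (G : ℝ → ℝ≥0∞) (hG : Measurable G) :
    ∫⁻ p in openSquare, G p.1 = ∫⁻ s in Ioo (0 : ℝ) 1, G s := by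
  rw [volume_restrict_openSquare, lintegral_prod (fun p : ℝ × ℝ => G p.1) (hG.comp measurable_fst).aemeasurable]
  simp

theorem lintegral_snd (G : ℝ → ℝ≥0∞) (hG : Measurable G) :
    ∫⁻ p in openSquare, G p.2 = ∫⁻ s in Ioo (0 : ℝ) 1, G s := by
  rw [volume_restrict_openSquare, lintegral_prod (fun p : ℝ × ℝ => G p.2) (hG.comp measurable_snd).aemeasurable]
  simp

theorem enorm_sq_le {a K g : ℝ} (h : |a| ≤ K * g) :
    ‖a‖ₑ ^ 2 ≤ ENNReal.ofReal (K ^ 2) * ENNReal.ofReal (g ^ 2) := by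
  rw [← ENNReal.ofReal_mul (sq_nonneg K), ← mul_pow, Real.enorm_eq_ofReal_abs,
    ← ENNReal.ofReal_pow (abs_nonneg a)]
  refine ENNReal.ofReal_le_ofReal ?_
  have := abs_nonneg a
  nlinarith

theorem rpow_half_le {a : ℝ≥0∞} {b : ℝ} (hb : 0 ≤ b)
    (h : a ≤ ENNReal.ofReal (b ^ 2)) : a ^ (1 / 2 : ℝ) ≤ ENNReal.ofReal b := by
  refine (ENNReal.rpow_le_rpow h (by norm_num)).trans ?_
  rw [ENNReal.ofReal_rpow_of_nonneg (sq_nonneg b) (by norm_num), ← Real.sqrt_eq_rpow,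
    Real.sqrt_sq hb]

theorem seminormH1_sq (v : ℝ × ℝ → ℝ) :
    seminormH1 v ^ 2 = normL2 (Dx v) ^ 2 + normL2 (Dy v) ^ 2 := by
  rw [seminormH1, ← ENNReal.rpow_natCast, ← ENNReal.rpow_mul]
  norm_num

/-- `G` dominates the square of `g` on the mesh intervals. -/
structure Dominates (N : ℕ) (x : ℕ → ℝ) (g : ℕ → ℝ → ℝ) (G : ℝ → ℝ≥0∞) : Prop where
  meas : Measurable G
  le : ∀ l < N, ∀ s ∈ Ioo (x l) (x (l + 1)), ENNReal.ofReal (g l s ^ 2) ≤ G s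

theorem derivWithin_unitInterval {f : ℝ → ℝ} {D s : ℝ} (h : HasDerivAt f D s)
    (hs : s ∈ Icc (0 : ℝ) 1) : derivWithin f (Icc 0 1) s = D :=
  h.hasDerivWithinAt.derivWithin (uniqueDiffOn_Icc zero_lt_one s hs)

namespace CellBound

variable {N : ℕ} {x y : ℕ → ℝ} {gx gy : ℕ → ℝ → ℝ} {e : ℝ × ℝ → ℝ} {K₀ K₁ : ℝ}

theorem normL2_le (h : CellBound N x y gx gy e K₀ K₁) (hx : IsMesh N x) (hy : IsMesh N y) :
    normL2 e ≤ ENNReal.ofReal K₀ := by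
  refine (eLpNorm_le_of_ae_bound (C := K₀) ?_).trans ?_
  · filter_upwards [ae_mem_cell hx hy] with p ⟨_, ⟨l, hl, hs⟩, ⟨m, hm, ht⟩⟩
    exact h.val l hl m hm p.1 hs p.2 ht
  · rw [Measure.restrict_apply_univ, volume_openSquare]
    simp

/-- Mesh lines are null sets, and the bound on the `x`-derivative depends on `x` alone, so Fubini
leaves a one-dimensional integral. -/
theorem normL2_Dx_le (h : CellBound N x y gx gy e K₀ K₁) (hx : IsMesh N x) (hy : IsMesh N y)
    {G : ℝ → ℝ≥0∞} (hG : Dominates N x gx G) :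
    normL2 (Dx e) ^ 2 ≤ ENNReal.ofReal (K₁ ^ 2) * ∫⁻ s in Ioo (0 : ℝ) 1, G s := by
  rw [normL2_sq, ← lintegral_fst G hG.meas, ← lintegral_const_mul' _ _ ENNReal.ofReal_ne_top]
  refine lintegral_mono_ae ?_
  filter_upwards [ae_mem_cell hx hy] with p ⟨hp, ⟨l, hl, hs⟩, ⟨m, hm, ht⟩⟩
  obtain ⟨D, h1, h2⟩ := h.dx l hl m hm p.1 hs p.2 ht
  have : Dx e p = D := derivWithin_unitInterval h1 (Ioo_subset_Icc_self hp.1)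
  rw [this]
  exact (enorm_sq_le h2).trans (mul_le_mul_right (hG.le l hl p.1 hs) _)

theorem normL2_Dy_le (h : CellBound N x y gx gy e K₀ K₁) (hx : IsMesh N x) (hy : IsMesh N y)
    {G : ℝ → ℝ≥0∞} (hG : Dominates N y gy G) :
    normL2 (Dy e) ^ 2 ≤ ENNReal.ofReal (K₁ ^ 2) * ∫⁻ s in Ioo (0 : ℝ) 1, G s := by
  rw [normL2_sq, ← lintegral_snd G hG.meas, ← lintegral_const_mul' _ _ ENNReal.ofReal_ne_top]
  refine lintegral_mono_ae ?_
  filter_upwards [ae_mem_cell hx hy] with p ⟨hp, ⟨l, hl, hs⟩, ⟨m, hm, ht⟩⟩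
  obtain ⟨D, h1, h2⟩ := h.dy l hl m hm p.1 hs p.2 ht
  have : Dy e p = D := derivWithin_unitInterval h1 (Ioo_subset_Icc_self hp.2)
  rw [this]
  exact (enorm_sq_le h2).trans (mul_le_mul_right (hG.le m hm p.2 ht) _)

theorem seminormH1_le (h : CellBound N x y (fun _ _ => 1) (fun _ _ => 1) e K₀ K₁)
    (hx : IsMesh N x) (hy : IsMesh N y) (hK₁ : 0 ≤ K₁) :
    seminormH1 e ≤ ENNReal.ofReal (2 * K₁) := by
  have hG : ∀ x : ℕ → ℝ, Dominates N x (fun _ _ => 1) (fun _ => 1) := fun x =>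
    ⟨measurable_const, fun _ _ _ _ => by simp⟩
  have h1 := h.normL2_Dx_le hx hy (hG x)
  have h2 := h.normL2_Dy_le hx hy (hG y)
  simp only [lintegral_const, Measure.restrict_apply_univ, Real.volume_Ioo, sub_zero,
    ENNReal.ofReal_one, mul_one] at h1 h2
  refine rpow_half_le (by positivity) ((add_le_add h1 h2).trans ?_)
  rw [← ENNReal.ofReal_add (sq_nonneg _) (sq_nonneg _)]
  refine ENNReal.ofReal_le_ofReal ?_
  nlinarith [sq_nonneg K₁]

theorem normEnergy_le (h : CellBound N x y gx gy e K₀ K₁) (hx : IsMesh N x) (hy : IsMesh N y)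
    (hK₀ : 0 ≤ K₀) (hK₁ : 0 ≤ K₁) {ε R₁ R₂ : ℝ} (hR₁ : 0 ≤ R₁) (hR₂ : 0 ≤ R₂)
    {G₁ G₂ : ℝ → ℝ≥0∞} (hG₁ : Dominates N x gx G₁) (hG₂ : Dominates N y gy G₂)
    (h₁ : ENNReal.ofReal ε * ∫⁻ s in Ioo (0 : ℝ) 1, G₁ s ≤ ENNReal.ofReal R₁)
    (h₂ : ENNReal.ofReal ε * ∫⁻ s in Ioo (0 : ℝ) 1, G₂ s ≤ ENNReal.ofReal R₂) :
    normEnergy ε e ≤ ENNReal.ofReal (K₀ + (R₁ + R₂ + 1) * K₁) := by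
  refine rpow_half_le (by positivity) ?_
  have e1 : ENNReal.ofReal ε * normL2 (Dx e) ^ 2 ≤ ENNReal.ofReal (K₁ ^ 2 * R₁) := by
    rw [ENNReal.ofReal_mul (sq_nonneg _)]
    refine (mul_le_mul_right (h.normL2_Dx_le hx hy hG₁) _).trans ?_
    rw [mul_left_comm]
    exact mul_le_mul_right h₁ _
  have e2 : ENNReal.ofReal ε * normL2 (Dy e) ^ 2 ≤ ENNReal.ofReal (K₁ ^ 2 * R₂) := by
    rw [ENNReal.ofReal_mul (sq_nonneg _)]
    refine (mul_le_mul_right (h.normL2_Dy_le hx hy hG₂) _).trans ?_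
    rw [mul_left_comm]
    exact mul_le_mul_right h₂ _
  have e3 : normL2 e ^ 2 ≤ ENNReal.ofReal (K₀ ^ 2) := by
    rw [ENNReal.ofReal_pow hK₀]
    exact pow_le_pow_left' (h.normL2_le hx hy) 2
  rw [seminormH1_sq, mul_add]
  refine (add_le_add (add_le_add e1 e2) e3).trans ?_
  rw [← ENNReal.ofReal_add (by positivity) (by positivity),
    ← ENNReal.ofReal_add (by positivity) (by positivity)]
  refine ENNReal.ofReal_le_ofReal ?_
  have : (K₀ + (R₁ + R₂ + 1) * K₁) ^ 2 = K₁ ^ 2 * R₁ + K₁ ^ 2 * R₂ + K₀ ^ 2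
      + (K₁ ^ 2 * (R₁ + R₂ + 1 + (R₁ + R₂) ^ 2) + 2 * K₀ * ((R₁ + R₂ + 1) * K₁)) := by ring
  rw [this]
  have : 0 ≤ K₁ ^ 2 * (R₁ + R₂ + 1 + (R₁ + R₂) ^ 2) + 2 * K₀ * ((R₁ + R₂ + 1) * K₁) := by
    positivity
  linarith

end CellBound

/-- The integral over the half-line `(0, ∞)` is explicit and equals the right-hand side. -/
theorem lintegral_layerFun_sq_le {σ ε β : ℝ} (hσ : 0 < σ) (hε : 0 < ε) (hβ : 0 < β) :
    ∫⁻ s in Ioo (0 : ℝ) 1, ENNReal.ofReal ((layerFun σ ε β s / ε) ^ 2)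
      ≤ ENNReal.ofReal (σ / (2 * β) / ε) := by
  have ha : -(2 * β / (σ * ε)) < 0 := neg_neg_of_pos (by positivity)
  have h1 := integral_exp_mul_Ioi ha 0
  have h2 := integrableOn_exp_mul_Ioi ha 0
  have h3 : ∀ s, (layerFun σ ε β s / ε) ^ 2
      = (ε ^ 2)⁻¹ * Real.exp (-(2 * β / (σ * ε)) * s) := fun s => by
    rw [div_pow, layerFun, ← Real.exp_nat_mul, div_eq_inv_mul]
    congr 2
    push_cast
    ring
  simp only [h3]
  refine (lintegral_mono_set Ioo_subset_Ioi_self).trans ?_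
  rw [← ofReal_integral_eq_lintegral_ofReal (h2.const_mul _)
    (Filter.Eventually.of_forall fun s => by positivity), integral_const_mul, h1]
  refine ENNReal.ofReal_le_ofReal (le_of_eq ?_)
  simp only [mul_zero, Real.exp_zero]
  field_simp

/-- A function of `ξ` dominating the square of `layerGam`. -/
noncomputable def layerDom (N : ℕ) (x : ℕ → ℝ) (q : ℝ → ℝ) (ε : ℝ) (s : ℝ) : ℝ≥0∞ :=
  3 * (1 + ENNReal.ofReal ((q s / ε) ^ 2) + ∑ l ∈ Finset.range N,
    (Ioo (x l) (x (l + 1))).indicator (fun _ => ENNReal.ofReal ((1 / (N * step x l)) ^ 2)) s)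

theorem dominates_layerDom (N : ℕ) (x : ℕ → ℝ) {q : ℝ → ℝ} (hq : Measurable q) (ε : ℝ) :
    Dominates N x (layerGam N x q ε) (layerDom N x q ε) := by
  constructor
  · have h1 : Measurable fun s => ENNReal.ofReal ((q s / ε) ^ 2) :=
      ((hq.div_const ε).pow_const 2).ennreal_ofReal
    have h2 : Measurable fun s => ∑ l ∈ Finset.range N, (Ioo (x l) (x (l + 1))).indicator
        (fun _ => ENNReal.ofReal ((1 / (N * step x l)) ^ 2)) s :=
      Finset.measurable_fun_sum _ fun l _ => measurable_const.indicator measurableSet_Ioo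
    unfold layerDom
    fun_prop
  · intro l hl s hs
    have h1 : ENNReal.ofReal ((1 / (N * step x l)) ^ 2) ≤ ∑ l ∈ Finset.range N,
        (Ioo (x l) (x (l + 1))).indicator
          (fun _ => ENNReal.ofReal ((1 / (N * step x l)) ^ 2)) s := by
      refine le_trans (le_of_eq ?_) (Finset.single_le_sum (fun _ _ => zero_le)
        (Finset.mem_range.2 hl))
      rw [indicator_of_mem hs]
    unfold layerDom
    refine le_trans ?_ (mul_le_mul_right (add_le_add_right h1 _) _)
    rw [← ENNReal.ofReal_one, ← ENNReal.ofReal_add zero_le_one (sq_nonneg _),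
      ← ENNReal.ofReal_add (by positivity) (sq_nonneg _),
      show (3 : ℝ≥0∞) = ENNReal.ofReal 3 by norm_num, ← ENNReal.ofReal_mul (by norm_num)]
    refine ENNReal.ofReal_le_ofReal ?_
    -- `(a + b + c)² ≤ 3 (a² + b² + c²)`.
    unfold layerGam
    nlinarith [sq_nonneg (1 - q s / ε), sq_nonneg (1 - 1 / (N * step x l)),
      sq_nonneg (q s / ε - 1 / (N * step x l))]

/-- The inverse-estimate term contributes `ε h / (N h)² = ε / (N² h) ≤ D / N` on each of the `N`
intervals, by the lower bound on the steps; the layer term contributes `σ / (2 β)`. -/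
theorem lintegral_layerDom_le {N : ℕ} {x : ℕ → ℝ} {σ ε β D : ℝ} (hσ : 0 < σ) (hε : 0 < ε)
    (hε1 : ε ≤ 1) (hβ : 0 < β) (hD : 0 ≤ D) (hN : 1 ≤ N)
    (hm : MeshFacts N x (layerFun σ ε β) ε D) :
    ENNReal.ofReal ε * ∫⁻ s in Ioo (0 : ℝ) 1, layerDom N x (layerFun σ ε β) ε s
      ≤ ENNReal.ofReal (3 * (1 + σ / (2 * β) + D)) := by
  have hNpos : (0 : ℝ) < N := by exact_mod_cast hN
  have hq : Measurable (layerFun σ ε β) := by unfold layerFun; fun_prop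
  have hq2 : Measurable fun s => ENNReal.ofReal ((layerFun σ ε β s / ε) ^ 2) :=
    ((hq.div_const ε).pow_const 2).ennreal_ofReal
  have hq3 : Measurable fun s => 1 + ENNReal.ofReal ((layerFun σ ε β s / ε) ^ 2) := by fun_prop
  have hsum : ∫⁻ s in Ioo (0 : ℝ) 1, ∑ l ∈ Finset.range N,
      (Ioo (x l) (x (l + 1))).indicator (fun _ => ENNReal.ofReal ((1 / (N * step x l)) ^ 2)) s
      ≤ ENNReal.ofReal (D / ε) := by
    rw [lintegral_finsetSum _ fun l _ => measurable_const.indicator measurableSet_Ioo]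
    calc _ ≤ ∑ l ∈ Finset.range N, ENNReal.ofReal (D / ε / N) := by
          refine Finset.sum_le_sum fun l hl => ?_
          have hl' := Finset.mem_range.1 hl
          have hs := hm.step_pos hl'.le
          refine (lintegral_mono' Measure.restrict_le_self le_rfl).trans ?_
          rw [lintegral_indicator_const measurableSet_Ioo, Real.volume_Ioo,
            ← ENNReal.ofReal_mul (sq_nonneg _)]
          refine ENNReal.ofReal_le_ofReal ?_
          have h1 : ε / N ≤ D * step x l := hm.le_step l hl'
          have h2 : x (l + 1) - x l = step x l := rfl
          rw [h2, div_div, le_div_iff₀ (by positivity)]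
          calc (1 / (N * step x l)) ^ 2 * step x l * (ε * N) = ε / N / step x l := by
                field_simp
            _ ≤ D * step x l / step x l := by gcongr
            _ = D := by field_simp
      _ = ENNReal.ofReal (D / ε) := by
          rw [Finset.sum_const, Finset.card_range, nsmul_eq_mul, ← ENNReal.ofReal_natCast,
            ← ENNReal.ofReal_mul hNpos.le]
          congr 1
          field_simp
  have hint : ∫⁻ s in Ioo (0 : ℝ) 1, layerDom N x (layerFun σ ε β) ε s
      ≤ ENNReal.ofReal (3 * (1 + σ / (2 * β) / ε + D / ε)) := by
    unfold layerDom
    rw [lintegral_const_mul' _ _ (by norm_num), lintegral_add_left hq3,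
      lintegral_add_left measurable_const, lintegral_const, Measure.restrict_apply_univ,
      Real.volume_Ioo, sub_zero, ENNReal.ofReal_one, mul_one]
    refine (mul_le_mul_right (add_le_add (add_le_add_right
      (lintegral_layerFun_sq_le hσ hε hβ) _) hsum) _).trans (le_of_eq ?_)
    rw [← ENNReal.ofReal_one, ← ENNReal.ofReal_add zero_le_one (by positivity),
      ← ENNReal.ofReal_add (by positivity) (by positivity),
      show (3 : ℝ≥0∞) = ENNReal.ofReal 3 by norm_num, ← ENNReal.ofReal_mul (by norm_num)]
  refine (mul_le_mul_right hint _).trans ?_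
  rw [← ENNReal.ofReal_mul hε.le]
  refine ENNReal.ofReal_le_ofReal ?_
  have : ε * (3 * (1 + σ / (2 * β) / ε + D / ε)) = 3 * (ε + σ / (2 * β) + D) := by field_simp
  rw [this]
  linarith

/-! ### The modified interpolant as a nodal correction. -/

theorem sum_nodeIdx_fst {k N n : ℕ} (hn : n < N) (f : ℕ × ℕ → ℝ) :
    ∑ a ∈ nodeIdx k N, (if a.1 = n then f a else 0) = ∑ s ∈ Finset.range k, f (n, s) := by
  symm
  refine Finset.sum_of_injOn (fun s => (n, s)) ?_ ?_ ?_ ?_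
  · intro s _ t _ h
    exact (Prod.mk.inj h).2
  · intro s hs
    exact mem_nodeIdx.2 (Or.inr ⟨hn, Finset.mem_range.1 hs⟩)
  · intro a ha hna
    refine if_neg fun h => hna ?_
    rcases mem_nodeIdx.1 ha with h' | h'
    · rw [h'] at h; exact absurd h hn.ne'
    · exact ⟨a.2, by simpa using h'.2, by rw [← h]⟩
  · intro s _
    simp

theorem sum_nodeIdx_ends {k N : ℕ} (hk : 1 ≤ k) (hN : 1 ≤ N) (f : ℕ × ℕ → ℝ) :
    ∑ b ∈ nodeIdx k N, (if b = (0, 0) ∨ b = (N, 0) then f b else 0)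
      = ∑ j ∈ ({0, N} : Finset ℕ), f (j, 0) := by
  symm
  refine Finset.sum_of_injOn (fun j => (j, 0)) ?_ ?_ ?_ ?_
  · intro s _ t _ h
    exact (Prod.mk.inj h).1
  · intro j hj
    have hj' : j = 0 ∨ j = N := by simpa using hj
    rcases hj' with rfl | rfl
    · exact mem_nodeIdx.2 (Or.inr ⟨hN, hk⟩)
    · exact mem_nodeIdx.2 (Or.inl rfl)
  · intro b _ hnb
    refine if_neg ?_
    rintro (rfl | rfl)
    · exact hnb ⟨0, by simp, rfl⟩
    · exact hnb ⟨N, by simp, rfl⟩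
  · intro j hj
    have hj' : j = 0 ∨ j = N := by simpa using hj
    rcases hj' with rfl | rfl <;> simp

/-- The nodal values of `P₁ E - κ B₁ E`. -/
noncomputable def corr₁ (κ : ℝ) (k N : ℕ) (x y : ℕ → ℝ) (E : ℝ × ℝ → ℝ) (a b : ℕ × ℕ) : ℝ :=
  if a.1 = N / 2 - 1 then
    (1 - κ * if b = (0, 0) ∨ b = (N, 0) then 1 else 0) * E (node k x a, node k y b) else 0

/-- The nodal values of `P₂ E - κ B₂ E`. -/
noncomputable def corr₂ (κ : ℝ) (k N : ℕ) (x y : ℕ → ℝ) (E : ℝ × ℝ → ℝ) (a b : ℕ × ℕ) : ℝ :=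
  if b.1 = N / 2 - 1 then
    (1 - κ * if a = (0, 0) ∨ a = (N, 0) then 1 else 0) * E (node k x a, node k y b) else 0

/-- The nodal values of `P₁₂ E`. -/
noncomputable def corr₁₂ (k N : ℕ) (x y : ℕ → ℝ) (E : ℝ × ℝ → ℝ) (a b : ℕ × ℕ) : ℝ :=
  if a.1 = N / 2 - 1 ∧ b.1 = N / 2 - 1 then E (node k x a, node k y b) else 0

section

variable {k N : ℕ} {x y : ℕ → ℝ}

theorem pi₁_eq (hk : 1 ≤ k) (hN : 4 ≤ N) (κ : ℝ) (E : ℝ × ℝ → ℝ) (p : ℝ × ℝ) :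
    pi₁ κ k N x y E p = lagrangeInterp k N x y E p - comb k N x y (corr₁ κ k N x y E) p := by
  have hn : N / 2 - 1 < N := by omega
  have hP : P₁ k N x y E p = ∑ a ∈ nodeIdx k N, if a.1 = N / 2 - 1 then
      ∑ b ∈ nodeIdx k N, E (node k x a, node k y b) * theta k x y a b p else 0 :=
    (sum_nodeIdx_fst hn (fun a =>
      ∑ b ∈ nodeIdx k N, E (node k x a, node k y b) * theta k x y a b p)).symm
  have hB : B₁ k N x y E p = ∑ a ∈ nodeIdx k N, if a.1 = N / 2 - 1 then
      ∑ b ∈ nodeIdx k N, (if b = (0, 0) ∨ b = (N, 0) then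
        E (node k x a, node k y b) * theta k x y a b p else 0) else 0 := by
    rw [sum_nodeIdx_fst hn (fun a => ∑ b ∈ nodeIdx k N, (if b = (0, 0) ∨ b = (N, 0) then
        E (node k x a, node k y b) * theta k x y a b p else 0)), B₁]
    refine Finset.sum_congr rfl fun s _ => ?_
    rw [sum_nodeIdx_ends hk (by omega)]
  have hC : comb k N x y (corr₁ κ k N x y E) p = P₁ k N x y E p - κ * B₁ k N x y E p := by
    rw [hP, hB, Finset.mul_sum, ← Finset.sum_sub_distrib, comb]
    refine Finset.sum_congr rfl fun a _ => ?_
    unfold corr₁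
    split_ifs with h
    · rw [Finset.mul_sum, ← Finset.sum_sub_distrib]
      refine Finset.sum_congr rfl fun b _ => ?_
      split_ifs <;> ring
    · simp
  rw [hC, pi₁]; ring

theorem pi₂_eq (hk : 1 ≤ k) (hN : 4 ≤ N) (κ : ℝ) (E : ℝ × ℝ → ℝ) (p : ℝ × ℝ) :
    pi₂ κ k N x y E p = lagrangeInterp k N x y E p - comb k N x y (corr₂ κ k N x y E) p := by
  have hθ : ∀ a b, theta k y x b a p.swap = theta k x y a b p := fun a b => by
    simp only [theta, Prod.fst_swap, Prod.snd_swap]; ring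
  have hP : P₂ k N x y E p = P₁ k N y x (fun p => E p.swap) p.swap := by
    simp only [P₁, P₂, hθ, Prod.swap_prod_mk]
  have hB : B₂ k N x y E p = B₁ k N y x (fun p => E p.swap) p.swap := by
    simp only [B₁, B₂, hθ, Prod.swap_prod_mk]
    exact Finset.sum_comm
  have hI : lagrangeInterp k N x y E p = lagrangeInterp k N y x (fun p => E p.swap) p.swap := by
    simp only [lagrangeInterp_eq_comb, Prod.swap_prod_mk]
    exact comb_swap k N x y _ p
  have := pi₁_eq (x := y) (y := x) hk hN κ (fun p => E p.swap) p.swap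
  rw [pi₁, ← hP, ← hB, ← hI] at this
  rw [pi₂, this, comb_swap k N x y]
  rfl

theorem pi₁₂_eq (hN : 4 ≤ N) (E : ℝ × ℝ → ℝ) (p : ℝ × ℝ) :
    pi₁₂ k N x y E p = lagrangeInterp k N x y E p - comb k N x y (corr₁₂ k N x y E) p := by
  have hn : N / 2 - 1 < N := by omega
  rw [pi₁₂]
  congr 1
  have hP : P₁₂ k N x y E p = ∑ a ∈ nodeIdx k N, if a.1 = N / 2 - 1 then
      ∑ b ∈ nodeIdx k N, (if b.1 = N / 2 - 1 then
        E (node k x a, node k y b) * theta k x y a b p else 0) else 0 := by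
    rw [sum_nodeIdx_fst hn (fun a => ∑ b ∈ nodeIdx k N, (if b.1 = N / 2 - 1 then
        E (node k x a, node k y b) * theta k x y a b p else 0)), P₁₂]
    refine Finset.sum_congr rfl fun s _ => ?_
    rw [sum_nodeIdx_fst hn (fun b => E (node k x (N / 2 - 1, s), node k y b)
      * theta k x y (N / 2 - 1, s) b p)]
  rw [hP, comb]
  refine Finset.sum_congr rfl fun a _ => ?_
  unfold corr₁₂
  split_ifs with h
  · refine Finset.sum_congr rfl fun b _ => ?_
    simp only [h, true_and]
    split_ifs <;> simp
  · simp [h]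

/-- The factor is `0`, `1` or `2`; this makes both signs of the boundary correction equally harmless
for the error bounds. -/
theorem abs_one_sub_le {κ : ℝ} (hκ : κ = 1 ∨ κ = -1) (P : Prop) [Decidable P] :
    |1 - κ * if P then 1 else 0| ≤ 2 := by
  rcases hκ with rfl | rfl <;> split_ifs <;> norm_num

theorem abs_corr₁_le {κ K : ℝ} (hκ : κ = 1 ∨ κ = -1) (hK : 0 ≤ K) {E : ℝ × ℝ → ℝ} {a b : ℕ × ℕ}
    (h : a.1 = N / 2 - 1 → |E (node k x a, node k y b)| ≤ K) :
    |corr₁ κ k N x y E a b| ≤ 2 * K := by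
  unfold corr₁
  by_cases h1 : a.1 = N / 2 - 1
  · rw [if_pos h1, abs_mul]
    exact mul_le_mul (abs_one_sub_le hκ _) (h h1) (abs_nonneg _) (by norm_num)
  · rw [if_neg h1, abs_zero]; positivity

theorem abs_corr₂_le {κ K : ℝ} (hκ : κ = 1 ∨ κ = -1) (hK : 0 ≤ K) {E : ℝ × ℝ → ℝ} {a b : ℕ × ℕ}
    (h : b.1 = N / 2 - 1 → |E (node k x a, node k y b)| ≤ K) :
    |corr₂ κ k N x y E a b| ≤ 2 * K := by
  unfold corr₂
  by_cases h1 : b.1 = N / 2 - 1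
  · rw [if_pos h1, abs_mul]
    exact mul_le_mul (abs_one_sub_le hκ _) (h h1) (abs_nonneg _) (by norm_num)
  · rw [if_neg h1, abs_zero]; positivity

theorem abs_corr₁₂_le {K : ℝ} (hK : 0 ≤ K) {E : ℝ × ℝ → ℝ} {a b : ℕ × ℕ}
    (h : a.1 = N / 2 - 1 → |E (node k x a, node k y b)| ≤ K) :
    |corr₁₂ k N x y E a b| ≤ 2 * K := by
  unfold corr₁₂
  split_ifs with h1
  · exact (h h1.1).trans (by linarith)
  · rw [abs_zero]; positivity

theorem pi₁_node_eq_zero (hk : 1 ≤ k) (hN : 4 ≤ N) (hx : IsMesh N x) (hy : IsMesh N y) (κ : ℝ)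
    (E : ℝ × ℝ → ℝ) {s : ℕ} (hs : s < k) {b : ℕ × ℕ} (hb : b ∈ nodeIdx k N) (h0 : b ≠ (0, 0))
    (h1 : b ≠ (N, 0)) : pi₁ κ k N x y E (node k x (N / 2 - 1, s), node k y b) = 0 := by
  have ha : (N / 2 - 1, s) ∈ nodeIdx k N := mem_nodeIdx.2 (Or.inr ⟨by dsimp only; omega, hs⟩)
  rw [pi₁_eq hk hN, lagrangeInterp_eq_comb, comb_node hk hx hy _ ha hb, comb_node hk hx hy _ ha hb,
    corr₁, if_pos rfl, if_neg (by tauto)]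
  ring

theorem pi₂_node_eq_zero (hk : 1 ≤ k) (hN : 4 ≤ N) (hx : IsMesh N x) (hy : IsMesh N y) (κ : ℝ)
    (E : ℝ × ℝ → ℝ) {t : ℕ} (ht : t < k) {a : ℕ × ℕ} (ha : a ∈ nodeIdx k N) (h0 : a ≠ (0, 0))
    (h1 : a ≠ (N, 0)) : pi₂ κ k N x y E (node k x a, node k y (N / 2 - 1, t)) = 0 := by
  have hb : (N / 2 - 1, t) ∈ nodeIdx k N := mem_nodeIdx.2 (Or.inr ⟨by dsimp only; omega, ht⟩)
  rw [pi₂_eq hk hN, lagrangeInterp_eq_comb, comb_node hk hx hy _ ha hb, comb_node hk hx hy _ ha hb,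
    corr₂, if_pos rfl, if_neg (by tauto)]
  ring

theorem pi₁₂_node_eq_zero (hk : 1 ≤ k) (hN : 4 ≤ N) (hx : IsMesh N x) (hy : IsMesh N y)
    (E : ℝ × ℝ → ℝ) {s t : ℕ} (hs : s < k) (ht : t < k) :
    pi₁₂ k N x y E (node k x (N / 2 - 1, s), node k y (N / 2 - 1, t)) = 0 := by
  have ha : (N / 2 - 1, s) ∈ nodeIdx k N := mem_nodeIdx.2 (Or.inr ⟨by dsimp only; omega, hs⟩)
  have hb : (N / 2 - 1, t) ∈ nodeIdx k N := mem_nodeIdx.2 (Or.inr ⟨by dsimp only; omega, ht⟩)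
  rw [pi₁₂_eq hN, lagrangeInterp_eq_comb, comb_node hk hx hy _ ha hb, comb_node hk hx hy _ ha hb,
    corr₁₂, if_pos ⟨rfl, rfl⟩, sub_self]

theorem bigPi_eq_comb (hk : 1 ≤ k) (hN : 4 ≤ N) (κ : ℝ) (S E₁ E₂ E₁₂ : ℝ × ℝ → ℝ) :
    bigPi κ k N x y S E₁ E₂ E₁₂ = comb k N x y (fun a b =>
      S (node k x a, node k y b) + (E₁ (node k x a, node k y b) - corr₁ κ k N x y E₁ a b)
        + (E₂ (node k x a, node k y b) - corr₂ κ k N x y E₂ a b)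
        + (E₁₂ (node k x a, node k y b) - corr₁₂ k N x y E₁₂ a b)) := by
  funext p
  rw [bigPi, pi₁_eq hk hN, pi₂_eq hk hN, pi₁₂_eq hN]
  simp only [comb_add, comb_sub, lagrangeInterp_eq_comb]

/-- For `κ = 1` all three corrections vanish at boundary nodes, where `N / 2 - 1` differs from `0`
and `N` since `N ≥ 4`. The nodal values there are those of `u`. -/
theorem memVN_bigPi (hk : 1 ≤ k) (hN : 4 ≤ N) (hx : IsMesh N x) (hy : IsMesh N y)
    {u S E₁ E₂ E₁₂ : ℝ × ℝ → ℝ} (hu : ∀ p ∈ closedSquare \ openSquare, u p = 0)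
    (hsum : ∀ p ∈ closedSquare, u p = S p + E₁ p + E₂ p + E₁₂ p) :
    MemVN k N x y (bigPi 1 k N x y S E₁ E₂ E₁₂) := by
  have hn0 : (0 : ℕ) ≠ N / 2 - 1 := by omega
  have hnN : N ≠ N / 2 - 1 := by omega
  have hzero : ∀ s ∈ Icc (0 : ℝ) 1, ∀ t ∈ Icc (0 : ℝ) 1, (s = 0 ∨ s = 1 ∨ t = 0 ∨ t = 1) →
      S (s, t) + E₁ (s, t) + E₂ (s, t) + E₁₂ (s, t) = 0 := by
    intro s hs t ht h
    rw [← hsum (s, t) ⟨hs, ht⟩]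
    refine hu _ ⟨⟨hs, ht⟩, fun hmem => ?_⟩
    have h1 : 0 < s ∧ s < 1 := hmem.1
    have h2 : 0 < t ∧ t < 1 := hmem.2
    rcases h with h | h | h | h <;> linarith
  have x0 : node k x (0, 0) = 0 := by simp [node, hx.zero]
  have x1 : node k x (N, 0) = 1 := by simp [node, hx.last]
  have y0 : node k y (0, 0) = 0 := by simp [node, hy.zero]
  have y1 : node k y (N, 0) = 1 := by simp [node, hy.last]
  rw [bigPi_eq_comb hk hN]
  refine memVN_comb hk hx hy ?_ ?_ ?_ ?_
  · intro b hb
    have := hzero 0 (by simp) _ (node_mem_Icc hk hy hb) (by simp)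
    simp [corr₁, corr₂, corr₁₂, hn0, x0, this]
  · intro b hb
    have := hzero 1 (by simp) _ (node_mem_Icc hk hy hb) (by simp)
    simp [corr₁, corr₂, corr₁₂, hnN, x1, this]
  · intro a ha
    have := hzero _ (node_mem_Icc hk hx ha) 0 (by simp) (by simp)
    simp [corr₁, corr₂, corr₁₂, hn0, y0, this]
  · intro a ha
    have := hzero _ (node_mem_Icc hk hx ha) 1 (by simp) (by simp)
    simp [corr₁, corr₂, corr₁₂, hnN, y1, this]

end

/-! ### Bounds for the layer function and the final assembly. -/

theorem WeightBound.mono {k N : ℕ} {x : ℕ → ℝ} {A gam : ℕ → ℝ → ℝ} {C C' : ℝ}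
    (h : WeightBound k N x A gam C) (hC : C ≤ C') : WeightBound k N x A gam C' := by
  refine ⟨h.nonneg, h.zero_le_one, h.gam_nonneg, ?_, ?_, ?_⟩
  · intro l hl n hn K g hK hg hb ξ hξ
    refine (h.error l hl n hn K g hK hg hb ξ hξ).trans ?_
    gcongr
  · intro l hl K g hK hg hb ξ hξ
    refine (h.deriv_error l hl K g hK hg hb ξ hξ).trans ?_
    have := h.gam_nonneg l hl ξ
    gcongr
  · intro l hl K g hK hg hb ξ hξ
    refine (h.deriv_stable l hl K g hK hg hb ξ hξ).trans ?_
    have := h.gam_nonneg l hl ξ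
    gcongr

theorem layerFun_pos (σ ε β ξ : ℝ) : 0 < layerFun σ ε β ξ := Real.exp_pos _

theorem layerFun_le_one {σ ε β : ℝ} (hσ : 0 < σ) (hε : 0 < ε) (hβ : 0 < β) {ξ : ℝ} (hξ : 0 ≤ ξ) :
    layerFun σ ε β ξ ≤ 1 := Real.exp_le_one_iff.2 (neg_nonpos.2 (by positivity))

theorem antitone_layerFun {σ ε β : ℝ} (hσ : 0 < σ) (hε : 0 < ε) (hβ : 0 < β) :
    Antitone (layerFun σ ε β) := by
  intro s t hst
  unfold layerFun
  gcongr

/-- The left side is the `σ`-th power of a number in `(0, 1]`, and `σ ≥ k + 1`. -/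
theorem exp_le_layerFun_pow {k : ℕ} {σ ε β : ℝ} (hσ : (k : ℝ) + 1 ≤ σ) (hε : 0 < ε) (hβ : 0 < β)
    {s : ℝ} (hs : 0 ≤ s) : Real.exp (-β * s / ε) ≤ layerFun σ ε β s ^ (k + 1) := by
  have hσ0 : 0 < σ := lt_of_lt_of_le (by positivity) hσ
  rw [layerFun, ← Real.exp_nat_mul]
  refine Real.exp_le_exp.2 ?_
  have h1 : ((k + 1 : ℕ) : ℝ) * -(β * s / (σ * ε)) = -(β * s / ε) * ((k + 1) / σ) := by
    push_cast; field_simp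
  have h2 : -β * s / ε = -(β * s / ε) := by ring
  have h3 : ((k : ℝ) + 1) / σ ≤ 1 := (div_le_one hσ0).2 hσ
  have h4 : 0 ≤ β * s / ε := by positivity
  rw [h1, h2]
  nlinarith

theorem one_le_layerGam {N : ℕ} {x : ℕ → ℝ} {σ ε β : ℝ} (hε : 0 < ε) (hx : IsMesh N x) {l : ℕ}
    (hl : l < N) (ξ : ℝ) : 1 ≤ layerGam N x (layerFun σ ε β) ε l ξ ∧
      1 / (N * step x l) ≤ layerGam N x (layerFun σ ε β) ε l ξ := by
  have h1 : 0 ≤ layerFun σ ε β ξ / ε := div_nonneg (layerFun_pos _ _ _ _).le hε.le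
  have h2 : 0 ≤ 1 / (N * step x l) := by have := hx.step_pos hl.le; positivity
  unfold layerGam
  constructor <;> linarith

theorem layerFun_node_le {k N : ℕ} {x : ℕ → ℝ} {σ ε β D : ℝ} (hσ : 0 < σ)
    (hε : 0 < ε) (hβ : 0 < β) (hN : 4 ≤ N) (hm : MeshFacts N x (layerFun σ ε β) ε D) {a : ℕ × ℕ}
    (ha : a.1 = N / 2 - 1) : layerFun σ ε β (node k x a) ≤ 3 / N := by
  refine le_trans (antitone_layerFun hσ hε hβ ?_) (hm.transition a.1 (by omega))
  have : 0 ≤ (a.2 : ℝ) / k * (x (a.1 + 1) - x a.1) :=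
    mul_nonneg (by positivity) (hm.step_pos (by omega : a.1 ≤ N)).le
  unfold node
  linarith

theorem normL2_sub_comm (v w : ℝ × ℝ → ℝ) : normL2 (v - w) = normL2 (w - v) :=
  eLpNorm_sub_comm v w 2 _

end Bakhvalov

theorem lemma5 (k : ℕ) (hk : 1 ≤ k) (σ β₁ β₂ M δ : ℝ) (hσ : (k : ℝ) + 1 ≤ σ)
    (hβ₁ : 0 < β₁) (hβ₂ : 0 < β₂) (hδ : 0 < δ) :
    ∃ C : ℝ, ∀ (ε : ℝ) (N : ℕ), 0 < ε → 4 ≤ N → Even N → ε ≤ (N : ℝ)⁻¹ →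
      meshPt σ ε β₁ N (N / 2) ≤ 1 - δ → meshPt σ ε β₂ N (N / 2) ≤ 1 - δ →
      ∀ (x y : ℕ → ℝ), x = meshPt σ ε β₁ N → y = meshPt σ ε β₂ N →
      ∀ (γ : ℝ) (b₁ b₂ c f u S E₁ E₂ E₁₂ : ℝ × ℝ → ℝ),
        ProblemData β₁ β₂ γ b₁ b₂ c f →
        IsSolution ε b₁ b₂ c f u →
        Decomposition k ε β₁ β₂ M u S E₁ E₂ E₁₂ →
        (∀ κ : ℝ, κ = 1 ∨ κ = -1 →
          normL2 (pi₁ κ k N x y E₁ - E₁) + normL2 (pi₂ κ k N x y E₂ - E₂)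
              + normL2 (pi₁₂ k N x y E₁₂ - E₁₂)
            ≤ ENNReal.ofReal (C / (N : ℝ) ^ (k + 1)) ∧
          seminormH1 (S - lagrangeInterp k N x y S)
              + normEnergy ε (u - lagrangeInterp k N x y u)
              + normEnergy ε (u - bigPi κ k N x y S E₁ E₂ E₁₂)
            ≤ ENNReal.ofReal (C / (N : ℝ) ^ k) ∧
          (∀ s < k, ∀ b ∈ nodeIdx k N, b ≠ (0, 0) → b ≠ (N, 0) →
            pi₁ κ k N x y E₁ (node k x (N / 2 - 1, s), node k y b) = 0) ∧
          (∀ t < k, ∀ a ∈ nodeIdx k N, a ≠ (0, 0) → a ≠ (N, 0) →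
            pi₂ κ k N x y E₂ (node k x a, node k y (N / 2 - 1, t)) = 0) ∧
          (∀ s < k, ∀ t < k,
            pi₁₂ k N x y E₁₂ (node k x (N / 2 - 1, s), node k y (N / 2 - 1, t)) = 0)) ∧
        MemVN k N x y (bigPi 1 k N x y S E₁ E₂ E₁₂) := by
  have hσ0 : 0 < σ := lt_of_lt_of_le (by positivity) hσ
  obtain ⟨D₁, hD₁, hmesh₁⟩ := exists_meshFacts hσ0 hβ₁ hδ
  obtain ⟨D₂, hD₂, hmesh₂⟩ := exists_meshFacts hσ0 hβ₂ hδ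
  obtain ⟨W₁, hW₁, hw₁⟩ := exists_weightBound_one hk D₁ hD₁
  obtain ⟨W₂, hW₂, hw₂⟩ := exists_weightBound_layer hk D₁ hD₁
  obtain ⟨W₃, hW₃, hw₃⟩ := exists_weightBound_one hk D₂ hD₂
  obtain ⟨W₄, hW₄, hw₄⟩ := exists_weightBound_layer hk D₂ hD₂
  obtain ⟨Λ, hΛ1, hΛ⟩ := exists_cellSum_bound k
  set W := W₁ + W₂ + W₃ + W₄ with hW
  have hW0 : 0 ≤ W := by linarith
  have hΛ0 : 0 ≤ Λ := by linarith
  set Ce := (W + Λ * W) + (W + W + W * W) with hCe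
  -- One `Λ` per direction, `2` for the sign `κ`, and `3^{k+1}` from `q ≤ 3 / N` at the omitted
  -- nodes.
  set Cc := Λ * (Λ * (2 * 3 ^ (k + 1))) with hCc
  set R₁ := 3 * (1 + σ / (2 * β₁) + D₁) with hR₁
  set R₂ := 3 * (1 + σ / (2 * β₂) + D₂) with hR₂
  have hCe0 : 0 ≤ Ce := by positivity
  have hCc0 : 0 ≤ Cc := by positivity
  have hR₁0 : 0 ≤ R₁ := by positivity
  have hR₂0 : 0 ≤ R₂ := by positivity
  -- The sum of the constants of all bounds: three `L²` errors, the `H¹` error of `S`, and two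
  -- energy errors with four interpolation errors each, the second also with three corrections.
  set T := 3 * (Ce + Cc) + 2 * Ce + (R₁ + R₂ + 2) * (4 * Ce)
    + (R₁ + R₂ + 2) * (4 * Ce + 3 * Cc) with hT
  refine ⟨T * M, ?_⟩
  intro ε N hε hN hev hεN hδ₁ hδ₂ x y hxdef hydef γ b₁ b₂ c f u S E₁ E₂ E₁₂ _ hsol hdec
  have hmx : MeshFacts N x (layerFun σ ε β₁) ε D₁ := hxdef ▸ hmesh₁ ε N hε hN hev hεN hδ₁
  have hmy : MeshFacts N y (layerFun σ ε β₂) ε D₂ := hydef ▸ hmesh₂ ε N hε hN hev hεN hδ₂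
  have hx := hmx.isMesh
  have hy := hmy.isMesh
  have hN1 : 1 ≤ N := by omega
  have hNpos : (0 : ℝ) < N := by exact_mod_cast hN1
  have hN1' : (1 : ℝ) ≤ N := by exact_mod_cast hN1
  have hε1 : ε ≤ 1 := hεN.trans (inv_le_one_of_one_le₀ hN1')
  have hM : 0 ≤ M :=
    (abs_nonneg _).trans (hdec.bound_S 0 0 (by omega) (0, 0) ⟨by simp, by simp⟩)
  have q₁0 : ∀ s, 0 < layerFun σ ε β₁ s := layerFun_pos σ ε β₁
  have q₂0 : ∀ s, 0 < layerFun σ ε β₂ s := layerFun_pos σ ε β₂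
  have q₁1 : ∀ s, 0 ≤ s → layerFun σ ε β₁ s ≤ 1 := fun s => layerFun_le_one hσ0 hε hβ₁
  have q₂1 : ∀ s, 0 ≤ s → layerFun σ ε β₂ s ≤ 1 := fun s => layerFun_le_one hσ0 hε hβ₂
  have wx1 := (hw₁ ε N x _ hN hmx).mono (C' := W) (by linarith)
  have wx2 := (hw₂ ε N x _ hε hN hεN (antitone_layerFun hσ0 hε hβ₁) q₁0 q₁1 hmx).mono (C' := W)
    (by linarith)
  have wy1 := (hw₃ ε N y _ hN hmy).mono (C' := W) (by linarith)
  have wy2 := (hw₄ ε N y _ hε hN hεN (antitone_layerFun hσ0 hε hβ₂) q₂0 q₂1 hmy).mono (C' := W)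
    (by linarith)
  set Lx := layerGam N x (layerFun σ ε β₁) ε with hLx
  set Ly := layerGam N y (layerFun σ ε β₂) ε with hLy
  set m₀ := M / N ^ (k + 1) with hm₀
  set m₁ := M / N ^ k with hm₁
  have hm₀0 : 0 ≤ m₀ := by positivity
  have hm₁0 : 0 ≤ m₁ := by positivity
  have hm₀₁ : m₀ ≤ m₁ := by
    rw [hm₀, hm₁]; gcongr; omega
  -- interpolation errors
  have key : ∀ {A B gx gy : ℕ → ℝ → ℝ}, WeightBound k N x A gx W → WeightBound k N y B gy W →
      (∀ l < N, ∀ s, gx l s ≤ Lx l s) → (∀ l < N, ∀ s, gy l s ≤ Ly l s) →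
      ∀ {v : ℝ × ℝ → ℝ}, ContDiffOn ℝ (k + 1 : ℕ) v closedSquare →
      (∀ i j, i + j ≤ k + 1 → ∀ p ∈ closedSquare,
        |(Dx^[i] (Dy^[j] v)) p| ≤ M * (A i p.1 * B j p.2)) →
      CellBound N x y gx gy (v - lagrangeInterp k N x y v) (Ce * m₀) (Ce * m₁) ∧
      CellBound N x y Lx Ly (v - lagrangeInterp k N x y v) (Ce * m₀) (Ce * m₁) := by
    intro A B gx gy hA hB hgx hgy v hv hb
    have h := interp_cellBound hk hN1 hx hy hΛ hW0 hW0 hA hB hM (isJet_of_contDiffOn hv) hb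
    have e0 : (W + Λ * W) * M / N ^ (k + 1) ≤ Ce * m₀ := by
      rw [hm₀, mul_div_assoc]
      exact mul_le_mul_of_nonneg_right (le_add_of_nonneg_right (by positivity)) hm₀0
    have e1 : (W + W + W * W) * M / N ^ k ≤ Ce * m₁ := by
      rw [hm₁, mul_div_assoc]
      exact mul_le_mul_of_nonneg_right (le_add_of_nonneg_left (by positivity)) hm₁0
    -- The first version keeps the weights at hand, which for `S` are constant and give the `H¹`
    -- bound without `ε`; the second passes to common weights so that the errors of all four parts
    -- can be added.
    exact ⟨h.mono e0 (by positivity) e1 (fun l hl s _ => hA.gam_nonneg l hl s)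
        (fun l hl s _ => hB.gam_nonneg l hl s) (fun _ _ _ _ => le_rfl) (fun _ _ _ _ => le_rfl),
      h.mono e0 (by positivity) e1 (fun l hl s _ => hA.gam_nonneg l hl s)
        (fun l hl s _ => hB.gam_nonneg l hl s) (fun l hl s _ => hgx l hl s)
        (fun l hl s _ => hgy l hl s)⟩
  have gx1 : ∀ l < N, ∀ s, 1 ≤ Lx l s := fun l hl s => (one_le_layerGam hε hx hl s).1
  have gy1 : ∀ l < N, ∀ s, 1 ≤ Ly l s := fun l hl s => (one_le_layerGam hε hy hl s).1
  have gx2 : ∀ l < N, ∀ s, 1 / (N * step x l) ≤ Lx l s := fun l hl s =>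
    (one_le_layerGam hε hx hl s).2
  have gy2 : ∀ l < N, ∀ s, 1 / (N * step y l) ≤ Ly l s := fun l hl s =>
    (one_le_layerGam hε hy hl s).2
  have hbE₁ : ∀ i j, i + j ≤ k + 1 → ∀ p ∈ closedSquare, |(Dx^[i] (Dy^[j] E₁)) p|
      ≤ M * ((ε ^ i)⁻¹ * layerFun σ ε β₁ p.1 ^ (k + 1) * 1) := by
    intro i j hij p hp
    refine (hdec.bound_E₁ i j hij p hp).trans ?_
    rw [mul_one, ← mul_assoc]
    exact mul_le_mul_of_nonneg_left (exp_le_layerFun_pow hσ hε hβ₁ hp.1.1) (by positivity)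
  have hbE₂ : ∀ i j, i + j ≤ k + 1 → ∀ p ∈ closedSquare, |(Dx^[i] (Dy^[j] E₂)) p|
      ≤ M * (1 * ((ε ^ j)⁻¹ * layerFun σ ε β₂ p.2 ^ (k + 1))) := by
    intro i j hij p hp
    refine (hdec.bound_E₂ i j hij p hp).trans ?_
    rw [one_mul, ← mul_assoc]
    exact mul_le_mul_of_nonneg_left (exp_le_layerFun_pow hσ hε hβ₂ hp.2.1) (by positivity)
  have hbE₁₂ : ∀ i j, i + j ≤ k + 1 → ∀ p ∈ closedSquare, |(Dx^[i] (Dy^[j] E₁₂)) p|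
      ≤ M * ((ε ^ i)⁻¹ * layerFun σ ε β₁ p.1 ^ (k + 1)
        * ((ε ^ j)⁻¹ * layerFun σ ε β₂ p.2 ^ (k + 1))) := by
    intro i j hij p hp
    refine (hdec.bound_E₁₂ i j hij p hp).trans ?_
    have e1 : -(β₁ * p.1 + β₂ * p.2) / ε = -β₁ * p.1 / ε + -β₂ * p.2 / ε := by ring
    rw [e1, Real.exp_add, pow_add, mul_inv]
    have h1 := exp_le_layerFun_pow hσ hε hβ₁ hp.1.1
    have h2 := exp_le_layerFun_pow hσ hε hβ₂ hp.2.1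
    have h3 := mul_le_mul h1 h2 (Real.exp_pos _).le (pow_nonneg (q₁0 p.1).le _)
    calc M * ((ε ^ i)⁻¹ * (ε ^ j)⁻¹) * (Real.exp (-β₁ * p.1 / ε) * Real.exp (-β₂ * p.2 / ε))
        ≤ M * ((ε ^ i)⁻¹ * (ε ^ j)⁻¹)
          * (layerFun σ ε β₁ p.1 ^ (k + 1) * layerFun σ ε β₂ p.2 ^ (k + 1)) := by gcongr
      _ = _ := by ring
  obtain ⟨hS1, hS⟩ := key wx1 wy1 gx1 gy1 hdec.smooth_S (fun i j hij p hp => by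
    rw [mul_one, mul_one]; exact hdec.bound_S i j hij p hp)
  have hE₁ := (key wx2 wy1 (fun _ _ _ => le_rfl) gy1 hdec.smooth_E₁ hbE₁).2
  have hE₂ := (key wx1 wy2 gx1 (fun _ _ _ => le_rfl) hdec.smooth_E₂ hbE₂).2
  have hE₁₂ := (key wx2 wy2 (fun _ _ _ => le_rfl) (fun _ _ _ => le_rfl) hdec.smooth_E₁₂ hbE₁₂).2
  -- layer functions at the omitted nodes
  have hnode : ∀ a ∈ nodeIdx k N, ∀ b ∈ nodeIdx k N, (node k x a, node k y b) ∈ closedSquare :=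
    fun a ha b hb => ⟨node_mem_Icc hk hx ha, node_mem_Icc hk hy hb⟩
  have h3N : (3 / (N : ℝ)) ^ (k + 1) = 3 ^ (k + 1) / N ^ (k + 1) := div_pow _ _ _
  have hKdef : M * (3 / (N : ℝ)) ^ (k + 1) = 3 ^ (k + 1) * m₀ := by rw [h3N, hm₀]; ring
  have hval₁ : ∀ a ∈ nodeIdx k N, ∀ b ∈ nodeIdx k N, a.1 = N / 2 - 1 →
      |E₁ (node k x a, node k y b)| ≤ 3 ^ (k + 1) * m₀ := by
    intro a ha b hb h
    refine (hbE₁ 0 0 (by omega) _ (hnode a ha b hb)).trans ?_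
    rw [pow_zero, inv_one, one_mul, mul_one, ← hKdef]
    have := q₁0 (node k x a)
    have := layerFun_node_le (k := k) hσ0 hε hβ₁ hN hmx h
    gcongr
  have hval₂ : ∀ a ∈ nodeIdx k N, ∀ b ∈ nodeIdx k N, b.1 = N / 2 - 1 →
      |E₂ (node k x a, node k y b)| ≤ 3 ^ (k + 1) * m₀ := by
    intro a ha b hb h
    refine (hbE₂ 0 0 (by omega) _ (hnode a ha b hb)).trans ?_
    rw [pow_zero, inv_one, one_mul, one_mul, ← hKdef]
    have := q₂0 (node k y b)
    have := layerFun_node_le (k := k) hσ0 hε hβ₂ hN hmy h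
    gcongr
  have hval₁₂ : ∀ a ∈ nodeIdx k N, ∀ b ∈ nodeIdx k N, a.1 = N / 2 - 1 →
      |E₁₂ (node k x a, node k y b)| ≤ 3 ^ (k + 1) * m₀ := by
    intro a ha b hb h
    refine (hbE₁₂ 0 0 (by omega) _ (hnode a ha b hb)).trans ?_
    rw [pow_zero, inv_one, one_mul, one_mul, ← hKdef]
    have h0 := q₁0 (node k x a)
    have h1 := layerFun_node_le (k := k) hσ0 hε hβ₁ hN hmx h
    have h2 : layerFun σ ε β₂ (node k y b) ^ (k + 1) ≤ 1 :=
      pow_le_one₀ (q₂0 _).le (q₂1 _ (hnode a ha b hb).2.1)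
    have h3 : layerFun σ ε β₁ (node k x a) ^ (k + 1) ≤ (3 / (N : ℝ)) ^ (k + 1) := by gcongr
    exact mul_le_mul_of_nonneg_left
      ((mul_le_of_le_one_right (by positivity) h2).trans h3) hM
  have h3m : 0 ≤ 3 ^ (k + 1) * m₀ := by positivity
  have hcomb : ∀ {c : ℕ × ℕ → ℕ × ℕ → ℝ},
      (∀ a ∈ nodeIdx k N, ∀ b ∈ nodeIdx k N, |c a b| ≤ 2 * (3 ^ (k + 1) * m₀)) →
      CellBound N x y Lx Ly (comb k N x y c) (Cc * m₀) (Cc * m₁) := by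
    intro c hc
    have h := comb_cellBound hk hN1 hx hy hΛ hΛ0 (by positivity) gx2 gy2 hc
    have e0 : Λ * (Λ * (2 * (3 ^ (k + 1) * m₀))) = Cc * m₀ := by rw [hCc]; ring
    -- The factor `N` of the inverse estimate is exactly the power gained by the smallness of the
    -- nodal values.
    have e1 : Cc * m₀ * N = Cc * m₁ := by
      rw [hm₀, hm₁, pow_succ]; field_simp
    rwa [e0, e1] at h
  have hdx := dominates_layerDom N x (antitone_layerFun hσ0 hε hβ₁).measurable ε
  have hdy := dominates_layerDom N y (antitone_layerFun hσ0 hε hβ₂).measurable ε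
  have hix := lintegral_layerDom_le hσ0 hε hε1 hβ₁ (by linarith) hN1 hmx
  have hiy := lintegral_layerDom_le hσ0 hε hε1 hβ₂ (by linarith) hN1 hmy
  have henergy : ∀ {e : ℝ × ℝ → ℝ} {K : ℝ}, 0 ≤ K → CellBound N x y Lx Ly e (K * m₀) (K * m₁) →
      normEnergy ε e ≤ ENNReal.ofReal ((R₁ + R₂ + 2) * K * m₁) := by
    intro e K hK h
    refine (h.normEnergy_le hx hy (by positivity) (by positivity) hR₁0 hR₂0 hdx hdy hix hiy).trans ?_
    refine ENNReal.ofReal_le_ofReal ?_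
    have : K * m₀ ≤ K * m₁ := mul_le_mul_of_nonneg_left hm₀₁ hK
    linarith
  have hsumI : ∀ p, lagrangeInterp k N x y u p = lagrangeInterp k N x y S p
      + lagrangeInterp k N x y E₁ p + lagrangeInterp k N x y E₂ p
      + lagrangeInterp k N x y E₁₂ p := by
    intro p
    simp only [lagrangeInterp_eq_comb, ← comb_add]
    exact comb_congr (fun a ha b hb => hdec.sum_eq _ (hnode a ha b hb)) p
  refine ⟨fun κ hκ => ?_, memVN_bigPi hk hN hx hy hsol.boundary hdec.sum_eq⟩
  have hc₁ := hcomb (c := corr₁ κ k N x y E₁)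
    (fun a ha b hb => abs_corr₁_le hκ h3m (hval₁ a ha b hb))
  have hc₂ := hcomb (c := corr₂ κ k N x y E₂)
    (fun a ha b hb => abs_corr₂_le hκ h3m (hval₂ a ha b hb))
  have hc₁₂ := hcomb (c := corr₁₂ k N x y E₁₂)
    (fun a ha b hb => abs_corr₁₂_le h3m (hval₁₂ a ha b hb))
  refine ⟨?_, ?_, ?_, ?_, ?_⟩
  · have hp₁ := (hE₁.add hc₁).congr (e' := E₁ - pi₁ κ k N x y E₁) hx hy (fun p _ => by
      simp only [Pi.sub_apply, Pi.add_apply, pi₁_eq hk hN]; ring)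
    have hp₂ := (hE₂.add hc₂).congr (e' := E₂ - pi₂ κ k N x y E₂) hx hy (fun p _ => by
      simp only [Pi.sub_apply, Pi.add_apply, pi₂_eq hk hN]; ring)
    have hp₁₂ := (hE₁₂.add hc₁₂).congr (e' := E₁₂ - pi₁₂ k N x y E₁₂) hx hy (fun p _ => by
      simp only [Pi.sub_apply, Pi.add_apply, pi₁₂_eq hN]; ring)
    rw [normL2_sub_comm, normL2_sub_comm _ E₂, normL2_sub_comm _ E₁₂]
    refine (add_le_add (add_le_add (hp₁.normL2_le hx hy) (hp₂.normL2_le hx hy))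
      (hp₁₂.normL2_le hx hy)).trans ?_
    rw [← ENNReal.ofReal_add (by positivity) (by positivity),
      ← ENNReal.ofReal_add (by positivity) (by positivity)]
    refine ENNReal.ofReal_le_ofReal ?_
    have e1 : T * M / N ^ (k + 1) = T * m₀ := by rw [hm₀]; ring
    have e2 : 3 * (Ce + Cc) ≤ T := by
      rw [hT]
      have : 0 ≤ 2 * Ce + (R₁ + R₂ + 2) * (4 * Ce) + (R₁ + R₂ + 2) * (4 * Ce + 3 * Cc) := by
        positivity
      linarith
    rw [e1]
    have := mul_le_mul_of_nonneg_right e2 hm₀0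
    linarith
  · have hu := (((hS.add hE₁).add hE₂).add hE₁₂).congr (e' := u - lagrangeInterp k N x y u) hx hy
      (fun p hp => by
        simp only [Pi.sub_apply, Pi.add_apply, hsumI, hdec.sum_eq p hp]; ring)
    have hpi := ((((hS.add hE₁).add hE₂).add hE₁₂).add ((hc₁.add hc₂).add hc₁₂)).congr
      (e' := u - bigPi κ k N x y S E₁ E₂ E₁₂) hx hy (fun p hp => by
        simp only [Pi.sub_apply, Pi.add_apply, bigPi, pi₁_eq hk hN, pi₂_eq hk hN, pi₁₂_eq hN,
          hdec.sum_eq p hp]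
        ring)
    have a0 : ∀ m, Ce * m + Ce * m + Ce * m + Ce * m = 4 * Ce * m := fun m => by ring
    have b0 : ∀ m, 4 * Ce * m + (Cc * m + Cc * m + Cc * m) = (4 * Ce + 3 * Cc) * m :=
      fun m => by ring
    rw [a0, a0] at hu hpi
    rw [b0, b0] at hpi
    refine (add_le_add (add_le_add (hS1.seminormH1_le hx hy (by positivity))
      (henergy (by positivity) hu)) (henergy (by positivity) hpi)).trans ?_
    rw [← ENNReal.ofReal_add (by positivity) (by positivity),
      ← ENNReal.ofReal_add (by positivity) (by positivity)]
    refine ENNReal.ofReal_le_ofReal ?_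
    have e1 : T * M / N ^ k = T * m₁ := by rw [hm₁]; ring
    have e2 : 0 ≤ 3 * (Ce + Cc) * m₁ := by positivity
    rw [e1, hT]
    linarith
  · exact fun s hs b hb h0 h1 => pi₁_node_eq_zero hk hN hx hy κ E₁ hs hb h0 h1
  · exact fun t ht a ha h0 h1 => pi₂_node_eq_zero hk hN hx hy κ E₂ ht ha h0 h1
  · exact fun s hs t ht => pi₁₂_node_eq_zero hk hN hx hy E₁₂ hs ht
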